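/- **Notation.** Let $\mathbb N_*=\{2,3,\dots\}$ and $\overline{\mathbb N}_*=\mathbb N_*\cup\{\infty\}$ (one-point compactification), and let $\overline{\mathbb N}=\mathbb N\cup\{\infty\}$. For $k\in\overline{\mathbb N}_*^{\,d}$ put $\mathbb Z^d_k=\prod_{j=1}^d\mathbb Z/k(j)\mathbb Z$, with $\infty\mathbb Z=\{0\}$. A normalized $2$-cocycle of $\mathbb Z^d_k$ is a map $\sigma:\mathbb Z^d_k\times\mathbb Z^d_k\to\mathbb T$ with $\sigma(x,y)\sigma(x+y,z)=\sigma(x,y+z)\sigma(y,z)$, $\sigma(x,0)=\sigma(0,x)=1$ and $\sigma(x,-x)=1$. Let $\Xi^d$ be the set of all pairs $(k,\sigma)$ with $k\in\overline{\mathbb N}_*^{\,d}$ and $\sigma$ a normalized $2$-cocycle of $\mathbb Z^d_k$, topologized by convergence of $k$ in $\overline{\mathbb N}_*^{\,d}$ and pointwise convergence on $\mathbb Z^d\times\mathbb Z^d$ of the cocycles pulled back to $\mathbb Z^d$. For $m\in\mathbb Z^d_k$ let $W^m_{k,\sigma}$ be the unitary of $\ell^2(\mathbb Z^d_k)$ with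 $(W^m_{k,\sigma}\xi)(n)=\sigma(m,n-m)\,\xi(n-m)$, and let $C^*(\mathbb Z^d_k,\sigma)$ be the C*-algebra generated by these unitaries. Let $e_j$ be the class of the $j$-th canonical basis vector. **Hypotheses.** Let $2\le d\le d'$. For each $n\in\overline{\mathbb N}$ let $(k_n,\sigma_n)\in\Xi^d$, with $(k_n,\sigma_n)\to(k_\infty,\sigma_\infty)$ as $n\to\infty$ and $k_\infty=(\infty,\dots,\infty)$, such that for each $j$ either $k_n(j)<\infty$ for all $n\in\mathbb N$, or $k_n(j)=\infty$ for all $n\in\mathbb N$. Let $f$ be a permutation of $\{1,\dots,d'\}$ of order $2$ without fixed point, with $\{d+1,\dots,d'\}\subseteq f(\{1,\dots,d\})$. For each $n\in\overline{\mathbb N}$ let $(k'_n,\sigma'_n)\in\Xi^{d'}$ and $U_{n,j}=W^{e_j}_{k'_n,\sigma'_n}$ $(1\le j\le d')$, such that 1. $(k'_n,\sigma'_n)\to(k'_\infty,\sigma'_\infty)$ in $\Xi^{d'}$ and $k'_\infty=(\infty,\dots,\infty)$; 2. $k'_n(f(j))=k'_n(j)=k_n(j)$ for all $n\in\overline{\mathbb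 N}$ and $j\in\{1,\dots,d\}$; 3. for all $n\in\overline{\mathbb N}$, the restriction of $\sigma'_n$ to $\mathbb Z^d_{k_n}\times\{0\}\subseteq\mathbb Z^{d'}_{k'_n}$ is cohomologous to $\sigma_n$; 4. for all $n\in\overline{\mathbb N}$, $j\in\{1,\dots,d\}$ and $s\in\{1,\dots,d'\}$: if $s=j$ and $k_n(j)<\infty$, then $U_{n,f(j)}U_{n,j}=e^{2i\pi\epsilon/k_n(j)}\,U_{n,j}U_{n,f(j)}$, with $\epsilon=1$ if $j<f(j)$ and $\epsilon=-1$ if $f(j)<j$; otherwise $U_{n,f(j)}U_{n,s}=U_{n,s}U_{n,f(j)}$. Let $\mathscr H_n=\ell^2(\mathbb Z^{d'}_{k'_n})$, and let $\mathfrak A_n=C^*(U_{n,1},\dots,U_{n,d})$, a C*-algebra of operators on $\mathscr H_n$ that is canonically *-isomorphic to, and identified with, $C^*(\mathbb Z^d_{k_n},\sigma_n)$. Let $c$ be a faithful unital *-representation, on a finite dimensional Hilbert space $\mathscr C$, of the complex Clifford algebra with generators $\gamma_1,\dots,\gamma_{d+d'}$ subject to $\gamma_j\gamma_s+\gamma_s\gamma_j=-2\delta_{js}$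 and $\gamma_j^*=-\gamma_j$. Let $\mathscr J_n=\mathscr H_n\otimes\mathscr C=\ell^2(\mathbb Z^{d'}_{k'_n},\mathscr C)$, and write $a^\circ=a\otimes1_{\mathscr C}$. **Dirac operators.** Let $\langle m,m\rangle_n=\sum_{j:\,k'_n(j)=\infty}m_j^2$, and let $\operatorname{dom}D_n$ be the space of all $\xi\in\mathscr J_n$ with $\left(\sqrt{1+\langle m,m\rangle_n}\,\xi(m)\right)_m\in\mathscr J_n$. If $k'_n(j)=\infty$, let $(\partial_{n,j}\xi)(m)=i\,m_j\,\xi(m)$. If $k'_n(j)<\infty$, let $(v_{n,j}\xi)(m)=e^{2i\pi m_j/k'_n(j)}\xi(m)$. Let $(J\xi)(m)=\overline{\xi(-m)}$ and $[a,\xi]=a\xi-Ja^*J\xi$ for $a$ bounded on $\mathscr H_n$ and $\xi\in\mathscr H_n$. For $j\in\{1,\dots,d\}$ let $X_{n,j}=\Re U_{n,f(j)}$, and let $Y_{n,j}=\Im U_{n,f(j)}$ if $j<f(j)$, $Y_{n,j}=-\Im U_{n,f(j)}$ if $f(j)<j$, where $\Re a=\frac{a+a^*}{2}$ and $\Im a=\frac{a-a^*}{2i}$.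 Define - for $j\le d$ and $k_n(j)=\infty$: $\Gamma_{n,j}=X_{n,j}\partial_{n,j}$ and $\Gamma_{n,d+j}=Y_{n,j}\partial_{n,j}$; - for $j\le d$ and $k_n(j)<\infty$: $\Gamma_{n,j}=\frac{-k_n(j)}{2i\pi}[Y_{n,j},\cdot]$ and $\Gamma_{n,d+j}=\frac{k_n(j)}{2i\pi}[X_{n,j},\cdot]$; - for $d<j\le d'$ and $k'_n(j)=\infty$: $\Gamma_{n,d+j}=\partial_{n,j}$; - for $d<j\le d'$ and $k'_n(j)<\infty$: $\Gamma_{n,d+j}=\frac{k'_n(j)}{2i\pi}\left(1-\Im v_{n,j}\right)$; and $D_n=\sum_{j=1}^{d+d'}\Gamma_{n,j}\otimes c(\gamma_j)$ on $\operatorname{dom}D_n$. For $a=a^*\in\mathfrak A_n$ let $\mathsf L_n(a)$ be the norm of $[D_n,a^\circ]$ if $a^\circ\operatorname{dom}D_n\subseteq\operatorname{dom}D_n$ and this commutator is bounded, and $\mathsf L_n(a)=\infty$ otherwise. **Definitions.** A spectral triple over a unital C*-algebra $\mathfrak A$, with *-representation $\pi$ on a Hilbert space $\mathscr J$, is given by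 a densely defined self-adjoint operator $D$ on $\mathscr J$ with compact resolvent such that, for all $a$ in some dense *-subalgebra of $\mathfrak A$, $\pi(a)\operatorname{dom}D\subseteq\operatorname{dom}D$ and $[D,\pi(a)]$ is bounded. A pair $(\mathfrak A,\mathsf L)$ of a unital C*-algebra and a seminorm $\mathsf L$ defined on a dense subspace of the self-adjoint part of $\mathfrak A$ (and set to $\infty$ elsewhere) is a quantum compact metric space when: $\mathsf L(a)=0$ if and only if $a\in\mathbb R1$; the distance $\sup\{|\varphi(a)-\psi(a)|:\mathsf L(a)\le1\}$ between states $\varphi,\psi$ is a metric on the state space of $\mathfrak A$ that induces the weak* topology; for all $a,b$ in the domain of $\mathsf L$, $\frac{ab+ba}2$ and $\frac{ab-ba}{2i}$ are in the domain of $\mathsf L$, with $\max\left\{\mathsf L\left(\frac{ab+ba}2\right),\mathsf L\left(\frac{ab-ba}{2i}\right)\right\}\le\|a\|\,\mathsf L(b)+\mathsf L(a)\,\|b\|$; and $\{a:\mathsf L(a)\le1\}$ is closed in $\mathfrak A$. **Theorem.** Under these hypotheses, for every $n\in\mathbb N\cup\{\infty\}$, $(\mathfrak A_n,\mathsf L_n)$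 is a quantum compact metric space, and $(\mathfrak A_n,\mathscr J_n,D_n)$, with $\mathfrak A_n$ acting by $a\mapsto a^\circ$, is a spectral triple; hence it is a metric spectral triple. -/

import Mathlib

open Filter Topology
open scoped ENNReal ComplexConjugate

namespace QuantumTori

noncomputable section

/-! ### Quantum compact metric spaces and metric spectral triples -/

section Metric

variable {A : Type*} [CStarAlgebra A]

/-- The state space of a unital C*-algebra `A`: the positive linear functionals of value `1` at
the unit. As a subset of `WeakDual ℂ A` it carries the weak* topology. -/
def stateSpace (A : Type*) [CStarAlgebra A] : Set (WeakDual ℂ A) :=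
  {φ | φ 1 = 1 ∧ ∀ a : A, 0 ≤ (φ (star a * a)).re ∧ (φ (star a * a)).im = 0}

/-- The weak* topology of the state space. -/
abbrev weakStarTopology (A : Type*) [CStarAlgebra A] : TopologicalSpace (stateSpace A) :=
  instTopologicalSpaceSubtype

/-- The Jordan product `(ab + ba)/2` of two self-adjoint elements. -/
def jordanProd (a b : selfAdjoint A) : selfAdjoint A :=
  ⟨(1 / 2 : ℝ) • ((a : A) * b + b * a), by
    rw [selfAdjoint.mem_iff, star_smul, star_add, star_mul, star_mul, a.2.star_eq, b.2.star_eq,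
      star_trivial, add_comm]⟩

/-- The Lie product `(ab - ba)/(2i)` of two self-adjoint elements. -/
def lieProd (a b : selfAdjoint A) : selfAdjoint A :=
  ⟨(1 / (2 * Complex.I) : ℂ) • ((a : A) * b - b * a), by
    have h : star (1 / (2 * Complex.I) : ℂ) = -(1 / (2 * Complex.I)) := by simp
    rw [selfAdjoint.mem_iff, star_smul, star_sub, star_mul, star_mul, a.2.star_eq, b.2.star_eq,
      h, neg_smul, ← smul_neg, neg_sub]⟩

/-- The (extended) Monge-Kantorovich distance between two functionals. -/
def mkDist (L : selfAdjoint A → ℝ≥0∞) (φ ψ : WeakDual ℂ A) : ℝ≥0∞ :=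
  ⨆ (a : selfAdjoint A) (_ : L a ≤ 1), ‖φ (a : A) - ψ (a : A)‖ₑ

/-- `(A, L)` is a quantum compact metric space. The seminorm `L`, defined on a dense subspace of
the self-adjoint part of `A`, is extended by the value `∞` outside of its domain, so that its
domain is `{a | L a < ∞}`. -/
structure IsQuantumCompactMetricSpace (L : selfAdjoint A → ℝ≥0∞) : Prop where
  add_le : ∀ a b, L (a + b) ≤ L a + L b
  smul_eq : ∀ (r : ℝ) (a), L (r • a) = ENNReal.ofReal |r| * L a
  dense_domain : Dense {a : selfAdjoint A | L a < ⊤}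
  eq_zero_iff : ∀ a, L a = 0 ↔ ∃ r : ℝ, (a : A) = r • (1 : A)
  metrizes : ∃ m : MetricSpace (stateSpace A),
    (∀ φ ψ : stateSpace A, ENNReal.ofReal (m.dist φ ψ) = mkDist L φ ψ) ∧
    m.toUniformSpace.toTopologicalSpace =
      weakStarTopology A
  leibniz : ∀ a b, L a < ⊤ → L b < ⊤ →
    L (jordanProd a b) < ⊤ ∧ L (lieProd a b) < ⊤ ∧
    max (L (jordanProd a b)) (L (lieProd a b)) ≤ ‖a‖ₑ * L b + L a * ‖b‖ₑ
  closed : IsClosed ((fun a : selfAdjoint A => (a : A)) '' {a | L a ≤ 1})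

variable {H : Type*} [NormedAddCommGroup H] [InnerProductSpace ℂ H] [CompleteSpace H]

/-- `D` has a compact resolvent: for some complex number `z`, the operator `D - z` is a bijection
of its domain onto `H` whose inverse `R` is a compact operator. -/
def HasCompactResolvent (D : H →ₗ.[ℂ] H) : Prop :=
  ∃ (z : ℂ) (R : H →L[ℂ] H), IsCompactOperator R ∧
    (∀ ξ : H, ∃ h : R ξ ∈ D.domain, D ⟨R ξ, h⟩ - z • R ξ = ξ) ∧
    ∀ ξ : D.domain, R (D ξ - z • (ξ : H)) = ξ

open Classical in
/-- The operator norm of the commutator `[D, π(a)]`, in `[0, ∞]`, with the value `∞` when `π(a)`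
does not map the domain of `D` into itself. -/
def commNorm (π : A →⋆ₐ[ℂ] (H →L[ℂ] H)) (D : H →ₗ.[ℂ] H) (a : A) : ℝ≥0∞ :=
  if h : ∀ ξ : D.domain, π a (ξ : H) ∈ D.domain then
    ⨆ (ξ : D.domain) (_ : ‖(ξ : H)‖ ≤ 1), ‖D ⟨π a (ξ : H), h ξ⟩ - π a (D ξ)‖ₑ
  else ⊤

/-- `(A, H, D)` is a spectral triple, for the *-representation `π` of `A` on `H`. -/
structure IsSpectralTriple (π : A →⋆ₐ[ℂ] (H →L[ℂ] H)) (D : H →ₗ.[ℂ] H) : Prop where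
  dense_domain : Dense (D.domain : Set H)
  selfAdjoint : IsSelfAdjoint D
  compact_resolvent : HasCompactResolvent D
  dense_subalgebra : ∃ A₀ : StarSubalgebra ℂ A, Dense (A₀ : Set A) ∧
    ∀ a ∈ A₀, commNorm π D a < ⊤

/-- The seminorm `L_D(a) = ‖[D, π(a)]‖` on self-adjoint elements. -/
def diracSeminorm (π : A →⋆ₐ[ℂ] (H →L[ℂ] H)) (D : H →ₗ.[ℂ] H) (a : selfAdjoint A) : ℝ≥0∞ :=
  commNorm π D (a : A)

/-- `(A, H, D)` is a metric spectral triple. -/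
def IsMetricSpectralTriple (π : A →⋆ₐ[ℂ] (H →L[ℂ] H)) (D : H →ₗ.[ℂ] H) : Prop :=
  IsSpectralTriple π D ∧ IsQuantumCompactMetricSpace (diracSeminorm π D)

end Metric

/-! ### Operators on square-summable families -/

section L2

/-- `ℓ²(G, E)`. -/
abbrev L2 (G E : Type*) [NormedAddCommGroup E] := lp (fun _ : G => E) 2

variable {G E F K : Type*} [NormedAddCommGroup E] [NormedAddCommGroup F] [NormedAddCommGroup K]

lemma memℓp_of_norm_eq (e : G ≃ G) {f : G → E} {g : G → F} (hf : Memℓp f 2)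
    (h : ∀ m, ‖g m‖ = ‖f (e m)‖) : Memℓp g 2 := by
  rw [memℓp_gen_iff (by norm_num)] at hf ⊢
  simp_rw [h]
  exact (e.summable_iff (f := fun m => ‖f m‖ ^ (2 : ℝ≥0∞).toReal)).2 hf

lemma norm_eq_of_norm_eq (e : G ≃ G) (f : L2 G E) (g : L2 G F)
    (h : ∀ m, ‖g m‖ = ‖f (e m)‖) : ‖g‖ = ‖f‖ := by
  rw [lp.norm_eq_tsum_rpow (by norm_num), lp.norm_eq_tsum_rpow (by norm_num)]
  simp_rw [h]
  rw [e.tsum_eq (f := fun m => ‖f m‖ ^ (2 : ℝ≥0∞).toReal)]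

variable [InnerProductSpace ℂ E] [InnerProductSpace ℂ F] [InnerProductSpace ℂ K]

/-- The weighted permutation operator `(T ξ)(m) = c(m) ξ(e(m))` on `ℓ²(G, E)`, for a permutation
`e` of `G` and unimodular weights `c`. -/
def weightedPerm (e : G ≃ G) (c : G → Circle) : L2 G E →L[ℂ] L2 G E :=
  LinearIsometry.toContinuousLinearMap
    { toFun := fun ξ => ⟨fun m => (c m : ℂ) • ξ (e m),
        memℓp_of_norm_eq e (lp.memℓp ξ) fun m => by rw [norm_smul, Circle.norm_coe, one_mul]⟩
      map_add' := fun ξ η => by ext m; exact smul_add _ _ _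
      map_smul' := fun z ξ => by ext m; exact smul_comm _ _ _
      norm_map' := fun ξ => norm_eq_of_norm_eq e _ _ fun m => by
        change ‖(c m : ℂ) • ξ (e m)‖ = _
        rw [norm_smul, Circle.norm_coe, one_mul] }

/-- The conjugate linear isometry `(J ξ)(m) = conj (ξ (-m))` of `ℓ²(G)`. -/
def conjJ {G : Type*} [AddCommGroup G] : L2 G ℂ →L⋆[ℂ] L2 G ℂ :=
  LinearIsometry.toContinuousLinearMap
    { toFun := fun ξ => ⟨fun m => conj (ξ (-m)),
        memℓp_of_norm_eq (Equiv.neg G) (lp.memℓp ξ) fun m => by simp⟩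
      map_add' := fun ξ η => by ext m; exact map_add _ _ _
      map_smul' := fun z ξ => by ext m; simp
      norm_map' := fun ξ => norm_eq_of_norm_eq (Equiv.neg G) _ _ fun m => by simp }

/-- A bounded operator `T : E → F` acting pointwise, as an operator `ℓ²(G, E) → ℓ²(G, F)`. -/
def lpMap (T : E →L[ℂ] F) : L2 G E →L[ℂ] L2 G F :=
  LinearMap.mkContinuous
    { toFun := fun ξ => ⟨fun m => T (ξ m),
        ((lp.memℓp ξ).norm.const_mul ‖T‖).mono fun m => T.le_opNorm _⟩
      map_add' := fun ξ η => by ext m; exact map_add _ _ _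
      map_smul' := fun z ξ => by ext m; simp }
    ‖T‖ fun ξ => by
      have h := lp.norm_mono (p := 2) (by norm_num)
        (x := (⟨fun m => T (ξ m),
          ((lp.memℓp ξ).norm.const_mul ‖T‖).mono fun m => T.le_opNorm _⟩ : L2 G F))
        (y := ((‖T‖ : ℂ) • ξ : L2 G E)) (fun m => by
          rw [lp.coeFn_smul, Pi.smul_apply, norm_smul, Complex.norm_real, norm_norm]
          exact T.le_opNorm (ξ m))
      rwa [norm_smul, Complex.norm_real, norm_norm] at h

@[simp] lemma lpMap_apply (T : E →L[ℂ] F) (ξ : L2 G E) (m : G) : lpMap T ξ m = T (ξ m) := rfl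

lemma adjoint_lpMap [CompleteSpace E] [CompleteSpace F] (T : E →L[ℂ] F) :
    ContinuousLinearMap.adjoint (lpMap T : L2 G E →L[ℂ] L2 G F) =
      lpMap (ContinuousLinearMap.adjoint T) := by
  symm
  rw [ContinuousLinearMap.eq_adjoint_iff]
  intro x y
  simp [lp.inner_eq_tsum, ContinuousLinearMap.adjoint_inner_left]

variable [FiniteDimensional ℂ E]

/-- For a vector `v` of `E`, the map `ξ ↦ ξ ⊗ v` from `ℓ²(G)` to `ℓ²(G, E) = ℓ²(G) ⊗ E`. -/
def tensorVec (v : E) : L2 G ℂ →L[ℂ] L2 G E :=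
  lpMap (ContinuousLinearMap.toSpanSingleton ℂ v)

variable (G E) in
/-- The map `ξ ↦ (m ↦ ⟨b i, ξ m⟩)` from `ℓ²(G, E)` to `ℓ²(G)`, for the `i`-th vector `b i` of a
fixed orthonormal basis of `E`. -/
def coord (i : Fin (Module.finrank ℂ E)) : L2 G E →L[ℂ] L2 G ℂ :=
  lpMap (innerSL ℂ (stdOrthonormalBasis ℂ E i))

/-- The operator `a ⊗ 1` on `ℓ²(G, E) = ℓ²(G) ⊗ E`, where `a` is a bounded operator on `ℓ²(G)`. -/
def ampFun (a : L2 G ℂ →L[ℂ] L2 G ℂ) : L2 G E →L[ℂ] L2 G E :=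
  ∑ i, (tensorVec (stdOrthonormalBasis ℂ E i)).comp (a.comp (coord G E i))

lemma coord_tensorVec (i j : Fin (Module.finrank ℂ E)) (ξ : L2 G ℂ) :
    coord G E i (tensorVec (stdOrthonormalBasis ℂ E j) ξ) = if i = j then ξ else 0 := by
  ext m
  have := (orthonormal_iff_ite.1 (stdOrthonormalBasis ℂ E).orthonormal) i j
  simp only [coord, tensorVec, lpMap_apply, innerSL_apply_apply,
    ContinuousLinearMap.toSpanSingleton_apply, inner_smul_right, this]
  split_ifs <;> simp

lemma sum_tensorVec_coord (ξ : L2 G E) :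
    ∑ i, tensorVec (stdOrthonormalBasis ℂ E i) (coord G E i ξ) = ξ := by
  ext m
  rw [lp.coeFn_sum, Finset.sum_apply]
  simpa [coord, tensorVec] using (stdOrthonormalBasis ℂ E).sum_repr' (ξ m)

lemma coord_ampFun (a : L2 G ℂ →L[ℂ] L2 G ℂ) (i) (ξ : L2 G E) :
    coord G E i (ampFun a ξ) = a (coord G E i ξ) := by
  simp [ampFun, map_sum, coord_tensorVec]

lemma ext_coord {ξ η : L2 G E} (h : ∀ i, coord G E i ξ = coord G E i η) : ξ = η := by
  rw [← sum_tensorVec_coord ξ, ← sum_tensorVec_coord η]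
  simp_rw [h]

variable [CompleteSpace E]

variable (G E) in
/-- The *-representation `a ↦ a ⊗ 1` of the bounded operators on `ℓ²(G)` on the Hilbert space
`ℓ²(G, E) = ℓ²(G) ⊗ E`. -/
def amp : (L2 G ℂ →L[ℂ] L2 G ℂ) →⋆ₐ[ℂ] (L2 G E →L[ℂ] L2 G E) where
  toFun := ampFun
  map_one' := by
    ext1 ξ; exact ext_coord fun i => by simp [coord_ampFun]
  map_mul' a b := by
    ext1 ξ; exact ext_coord fun i => by simp [coord_ampFun]
  map_zero' := by
    ext1 ξ; exact ext_coord fun i => by simp [coord_ampFun]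
  map_add' a b := by
    ext1 ξ; exact ext_coord fun i => by simp [coord_ampFun]
  commutes' z := by
    ext1 ξ; exact ext_coord fun i => by simp [coord_ampFun, Algebra.algebraMap_eq_smul_one]
  map_star' a := by
    simp only [ampFun, ContinuousLinearMap.star_eq_adjoint, map_sum,
      ContinuousLinearMap.adjoint_comp, tensorVec, coord, adjoint_lpMap,
      ContinuousLinearMap.adjoint_innerSL_apply, ContinuousLinearMap.adjoint_toSpanSingleton]
    rfl

end L2

/-! ### Quantum and fuzzy tori -/

/-- The group `ℤ^d / kℤ^d`, product of the groups `ℤ / k(j)ℤ`, with `∞ℤ = {0}` (recall that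
`ENat.toNat ⊤ = 0` and that `ZMod 0` is `ℤ`). -/
abbrev Zk {d : ℕ} (k : Fin d → ℕ∞) : Type := ∀ j, ZMod (k j).toNat

/-- The canonical surjection of `ℤ^d` onto `ℤ^d / kℤ^d`. -/
def toZk {d : ℕ} (k : Fin d → ℕ∞) (x : Fin d → ℤ) : Zk k := fun j => (x j : ZMod (k j).toNat)

/-- The `j`-th coordinate of `m`, as an integer: this is `m j` itself if `k j = ∞`, and the
representative in `{0, …, k j - 1}` of the class `m j` if `k j` is finite. -/
def coordInt {d : ℕ} {k : Fin d → ℕ∞} (m : Zk k) (j : Fin d) : ℤ := ZMod.cast (m j)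

/-- `σ` is a normalized 2-cocycle of the Abelian group `G` with values in the circle. -/
structure IsNormalizedCocycle {G : Type*} [AddCommGroup G] (σ : G → G → Circle) : Prop where
  cocycle : ∀ x y z, σ x y * σ (x + y) z = σ x (y + z) * σ y z
  zero_left : ∀ x, σ 0 x = 1
  zero_right : ∀ x, σ x 0 = 1
  neg_right : ∀ x, σ x (-x) = 1

/-- The space of all pairs `(k, σ)`, where `k` is a `d`-tuple of elements of `{2, 3, …, ∞}`, and
`σ` is a normalized 2-cocycle of `ℤ^d / kℤ^d`. -/
structure Xi (d : ℕ) where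
  k : Fin d → ℕ∞
  two_le : ∀ j, 2 ≤ k j
  σ : Zk k → Zk k → Circle
  isCocycle : IsNormalizedCocycle σ

namespace Xi

variable {d : ℕ} (p : Xi d)

/-- The cocycle of `p`, seen as a cocycle of `ℤ^d`. -/
def lifted (x y : Fin d → ℤ) : Circle := p.σ (toZk p.k x) (toZk p.k y)

/-- The product of the topology of `{2, 3, …, ∞}^d` and of the topology of pointwise convergence of
cocycles of `ℤ^d`. -/
instance : TopologicalSpace (Xi d) :=
  TopologicalSpace.induced
    (fun p : Xi d => ((p.k, p.lifted) : (Fin d → ℕ∞) × ((Fin d → ℤ) → (Fin d → ℤ) → Circle)))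
    inferInstance

/-- The group `ℤ^d / kℤ^d`. -/
abbrev G : Type := Zk p.k

/-- The Hilbert space `ℓ²(ℤ^d / kℤ^d)`. -/
abbrev Hilb : Type := L2 p.G ℂ

/-- The unitary `W^m`, with `(W^m ξ)(n) = σ(m, n - m) ξ(n - m)`. -/
def W (m : p.G) : p.Hilb →L[ℂ] p.Hilb :=
  weightedPerm (Equiv.subRight m) fun n => p.σ m (n - m)

/-- The canonical unitary `W^{e_j}`. -/
def U (j : Fin d) : p.Hilb →L[ℂ] p.Hilb := p.W (Pi.single j 1)

/-- The C*-algebra `C*(ℤ^d / kℤ^d, σ)`, generated by all the unitaries `W^m`. -/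
def torusAlgebra : StarSubalgebra ℂ (p.Hilb →L[ℂ] p.Hilb) :=
  (StarAlgebra.adjoin ℂ (Set.range p.W)).topologicalClosure

/-- The right action `ξ ↦ ξ · a = J a* J ξ` of a bounded operator `a`. -/
def rightMul (a : p.Hilb →L[ℂ] p.Hilb) : p.Hilb →L[ℂ] p.Hilb :=
  conjJ.comp ((star a).comp conjJ)

/-- The operator `[a, ·] : ξ ↦ a ξ - ξ · a`. -/
def commutator (a : p.Hilb →L[ℂ] p.Hilb) : p.Hilb →L[ℂ] p.Hilb := a - p.rightMul a

/-- The unitary `v^z`, with `(v^z ξ)(m) = z^m ξ(m)`. It is used for `z` in the dual group of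
`ℤ^d / kℤ^d`, i.e. with `z j ^ k j = 1` if `k j` is finite. -/
def v (z : Fin d → Circle) : p.Hilb →L[ℂ] p.Hilb :=
  weightedPerm (Equiv.refl _) fun m => ∏ j, z j ^ coordInt m j

open Classical in
/-- The element `z_j` of the dual group: its `j`-th component is `exp(2πi/k(j))` if `k(j)` is
finite, and all its other components are `1`; it is the unit if `k(j) = ∞`. -/
def zGen (j : Fin d) : Fin d → Circle :=
  if p.k j = ⊤ then 1 else Pi.mulSingle j (Circle.exp (2 * Real.pi / (p.k j).toNat))

open Classical in
/-- The number `⟨m, m⟩`, i.e. the sum of the squares of the components of `m` of infinite order. -/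
def sq (m : p.G) : ℝ := ∑ j, if p.k j = ⊤ then (coordInt m j : ℝ) ^ 2 else 0

lemma sq_nonneg (m : p.G) : 0 ≤ p.sq m :=
  Finset.sum_nonneg fun j _ => by split_ifs <;> positivity

/-- The space of all `ξ` in `ℓ²(ℤ^d / kℤ^d, E)` such that `m ↦ √(1 + ⟨m, m⟩) ξ(m)` is in
`ℓ²(ℤ^d / kℤ^d, E)`. -/
def sobolev (E : Type*) [NormedAddCommGroup E] [InnerProductSpace ℂ E] :
    Submodule ℂ (L2 p.G E) where
  carrier := {ξ | Memℓp (fun m => (Real.sqrt (1 + p.sq m) : ℂ) • ξ m) 2}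
  zero_mem' := by
    have := zero_memℓp (E := fun _ : p.G => E) (p := 2)
    simpa [Pi.zero_def] using this
  add_mem' {ξ η} hξ hη := by simpa [Pi.add_def, smul_add] using Memℓp.add hξ hη
  smul_mem' z ξ hξ := by
    have := Memℓp.const_smul (𝕜 := ℂ) hξ z
    simpa [Pi.smul_def, smul_comm z] using this

open Classical in
/-- The derivation `∂_j`, with `(∂_j ξ)(m) = i m_j ξ(m)` if `k(j) = ∞` (and `∂_j = 0` if `k(j)` is
finite). -/
def partialDeriv (j : Fin d) : p.sobolev ℂ →ₗ[ℂ] p.Hilb where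
  toFun ξ := ⟨fun m => (if p.k j = ⊤ then Complex.I * coordInt m j else 0) * (ξ : p.Hilb) m, by
    refine Memℓp.mono' ξ.2 fun m => ?_
    rw [norm_mul, norm_smul]
    refine mul_le_mul_of_nonneg_right ?_ (norm_nonneg _)
    rw [Complex.norm_real, Real.norm_of_nonneg (Real.sqrt_nonneg _)]
    split_ifs with h
    · have h1 : (coordInt m j : ℝ) ^ 2 ≤ p.sq m := by
        have := Finset.single_le_sum (f := fun i => if p.k i = ⊤ then (coordInt m i : ℝ) ^ 2 else 0)
          (fun i _ => by split_ifs <;> positivity) (Finset.mem_univ j)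
        simpa [h, sq] using this
      refine Real.le_sqrt_of_sq_le ?_
      have h2 : ‖Complex.I * (coordInt m j : ℂ)‖ ^ 2 = (coordInt m j : ℝ) ^ 2 := by
        rw [norm_mul, Complex.norm_I, one_mul, Complex.norm_intCast, sq_abs]
      rw [h2]; linarith
    · simp⟩
  map_add' ξ η := by ext m; exact mul_add _ _ _
  map_smul' z ξ := by ext m; simp [mul_left_comm]

end Xi

/-! ### The Dirac operators -/

section Dirac

variable {d d' : ℕ}

/-- The real part `(a + a*)/2`. -/
def rePart {H : Type*} [NormedAddCommGroup H] [InnerProductSpace ℂ H] [CompleteSpace H]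
    (a : H →L[ℂ] H) : H →L[ℂ] H := (1 / 2 : ℂ) • (a + star a)

/-- The imaginary part `(a - a*)/(2i)`. -/
def imPart {H : Type*} [NormedAddCommGroup H] [InnerProductSpace ℂ H] [CompleteSpace H]
    (a : H →L[ℂ] H) : H →L[ℂ] H := (1 / (2 * Complex.I) : ℂ) • (a - star a)

/-- The C*-algebra generated by the first `d` canonical unitaries `U_1, …, U_d`. -/
def subTorus (hdd' : d ≤ d') (p : Xi d') : StarSubalgebra ℂ (p.Hilb →L[ℂ] p.Hilb) :=
  (StarAlgebra.adjoin ℂ (Set.range fun j : Fin d => p.U (Fin.castLE hdd' j))).topologicalClosure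

lemma subTorus_le (hdd' : d ≤ d') (p : Xi d') : subTorus hdd' p ≤ p.torusAlgebra := by
  refine StarSubalgebra.topologicalClosure_mono (StarAlgebra.adjoin_mono ?_)
  rintro _ ⟨j, rfl⟩
  exact ⟨_, rfl⟩

instance (p : Xi d') : CStarAlgebra p.torusAlgebra :=
  StarSubalgebra.cstarAlgebra _
    (h_closed := StarSubalgebra.isClosed_topologicalClosure _)

instance (hdd' : d ≤ d') (p : Xi d') : CStarAlgebra (subTorus hdd' p) :=
  StarSubalgebra.cstarAlgebra _
    (h_closed := StarSubalgebra.isClosed_topologicalClosure _)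

/-- `X_j`, the real part of `U_{f(j)}`. -/
def opX (p : Xi d') (f : Equiv.Perm (Fin d')) (j : Fin d') : p.Hilb →L[ℂ] p.Hilb :=
  rePart (p.U (f j))

/-- `Y_j`, the imaginary part of `U_{f(j)}`, up to the sign `1` if `j < f(j)`, and `-1` if
`f(j) < j`. -/
def opY (p : Xi d') (f : Equiv.Perm (Fin d')) (j : Fin d') : p.Hilb →L[ℂ] p.Hilb :=
  (if j < f j then (1 : ℂ) else -1) • imPart (p.U (f j))

open Classical in
/-- The operator `Γ_j`, for `j` in `{1, …, d}`. -/
def gammaFst (hdd' : d ≤ d') (p : Xi d') (f : Equiv.Perm (Fin d')) (i : Fin d) :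
    p.sobolev ℂ →ₗ[ℂ] p.Hilb :=
  let j := Fin.castLE hdd' i
  if p.k j = ⊤ then (opX p f j : p.Hilb →ₗ[ℂ] p.Hilb) ∘ₗ p.partialDeriv j
  else ((-((p.k j).toNat : ℂ) / (2 * Complex.I * Real.pi)) • p.commutator (opY p f j) :
    p.Hilb →L[ℂ] p.Hilb).toLinearMap ∘ₗ (p.sobolev ℂ).subtype

open Classical in
/-- The operator `Γ_{d+j}`, for `j` in `{1, …, d'}`. -/
def gammaSnd (d : ℕ) (p : Xi d') (f : Equiv.Perm (Fin d')) (j : Fin d') :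
    p.sobolev ℂ →ₗ[ℂ] p.Hilb :=
  if (j : ℕ) < d then
    if p.k j = ⊤ then (opY p f j : p.Hilb →ₗ[ℂ] p.Hilb) ∘ₗ p.partialDeriv j
    else ((((p.k j).toNat : ℂ) / (2 * Complex.I * Real.pi)) • p.commutator (opX p f j) :
      p.Hilb →L[ℂ] p.Hilb).toLinearMap ∘ₗ (p.sobolev ℂ).subtype
  else
    if p.k j = ⊤ then p.partialDeriv j
    else ((((p.k j).toNat : ℂ) / (2 * Complex.I * Real.pi)) • (1 - imPart (p.v (p.zGen j))) :
      p.Hilb →L[ℂ] p.Hilb).toLinearMap ∘ₗ (p.sobolev ℂ).subtype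

/-- The quadratic form `x ↦ -(x_1² + … + x_n²)` on `ℂ^n`. Its Clifford algebra is generated by
`γ_1, …, γ_n` subject to `γ_j² = -1` and `γ_j γ_s = -γ_s γ_j` for `j ≠ s`. -/
abbrev cliffordForm (n : ℕ) : QuadraticForm ℂ (Fin n → ℂ) :=
  QuadraticMap.weightedSumSquares ℂ fun _ : Fin n => (-1 : ℂ)

/-- The generator `γ_j` of the Clifford algebra of `ℂ^n`. -/
def cliffordGen (n : ℕ) (j : Fin n) : CliffordAlgebra (cliffordForm n) :=
  CliffordAlgebra.ι (cliffordForm n) (Pi.single j 1)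

lemma coord_mem_sobolev {𝒞 : Type*} [NormedAddCommGroup 𝒞] [InnerProductSpace ℂ 𝒞]
    [FiniteDimensional ℂ 𝒞] (p : Xi d') (i) (ξ : p.sobolev 𝒞) :
    coord p.G 𝒞 i (ξ : L2 p.G 𝒞) ∈ p.sobolev ℂ := by
  have h : Memℓp (fun m => (Real.sqrt (1 + p.sq m) : ℂ) • (ξ : L2 p.G 𝒞) m) 2 := ξ.2
  have := lp.memℓp (lpMap (G := p.G) (innerSL ℂ (stdOrthonormalBasis ℂ 𝒞 i)) ⟨_, h⟩)
  refine this.mono' fun m => ?_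
  simp [coord]

variable {𝒞 : Type*} [NormedAddCommGroup 𝒞] [InnerProductSpace ℂ 𝒞] [CompleteSpace 𝒞]
  [FiniteDimensional ℂ 𝒞]

/-- `c` is a faithful *-representation of the Clifford algebra of `ℂ^n`, whose involution is the
conjugate linear one with `γ_j* = -γ_j` for all `j`. -/
structure IsFaithfulStarRep {n : ℕ} (c : CliffordAlgebra (cliffordForm n) →ₐ[ℂ] (𝒞 →L[ℂ] 𝒞)) :
    Prop where
  injective : Function.Injective c
  star_gen : ∀ j, star (c (cliffordGen n j)) = -c (cliffordGen n j)

/-- The operator `T ⊗ t` on `ℓ²(ℤ^d / kℤ^d) ⊗ 𝒞 = ℓ²(ℤ^d / kℤ^d, 𝒞)`. -/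
def tensorOp (p : Xi d') (T : p.sobolev ℂ →ₗ[ℂ] p.Hilb) (t : 𝒞 →L[ℂ] 𝒞) :
    p.sobolev 𝒞 →ₗ[ℂ] L2 p.G 𝒞 :=
  ∑ i, (tensorVec (t (stdOrthonormalBasis ℂ 𝒞 i)) : p.Hilb →L[ℂ] L2 p.G 𝒞).toLinearMap ∘ₗ T ∘ₗ
    ((coord p.G 𝒞 i).toLinearMap ∘ₗ (p.sobolev 𝒞).subtype).codRestrict (p.sobolev ℂ)
      (fun ξ => coord_mem_sobolev p i ξ)

/-- The Dirac operator `∑ Γ_j ⊗ c(γ_j)`, the sum being over all `j` in `{1, …, d + d'}`. -/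
def diracOp (hdd' : d ≤ d') (p : Xi d') (f : Equiv.Perm (Fin d'))
    (c : CliffordAlgebra (cliffordForm (d + d')) →ₐ[ℂ] (𝒞 →L[ℂ] 𝒞)) :
    L2 p.G 𝒞 →ₗ.[ℂ] L2 p.G 𝒞 where
  domain := p.sobolev 𝒞
  toFun :=
    ∑ i : Fin d, tensorOp p (gammaFst hdd' p f i) (c (cliffordGen (d + d') (Fin.castAdd d' i))) +
    ∑ j : Fin d', tensorOp p (gammaSnd d p f j) (c (cliffordGen (d + d') (Fin.natAdd d j)))

/-- The *-representation `a ↦ a° = a ⊗ 1` of the C*-algebra generated by `U_1, …, U_d` on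
`ℓ²(ℤ^d' / kℤ^d', 𝒞)`. -/
def torusRep (hdd' : d ≤ d') (p : Xi d') (𝒞 : Type*) [NormedAddCommGroup 𝒞]
    [InnerProductSpace ℂ 𝒞] [CompleteSpace 𝒞] [FiniteDimensional ℂ 𝒞] :
    subTorus hdd' p →⋆ₐ[ℂ] (L2 p.G 𝒞 →L[ℂ] L2 p.G 𝒞) :=
  (amp p.G 𝒞).comp (subTorus hdd' p).subtype

end Dirac

/-! ### The standing hypotheses -/

section Hypotheses

variable {d d' : ℕ}

/-- `(k_n, σ_n)` converges to `(k_∞, σ_∞)`, with `k_∞ = (∞, …, ∞)`; moreover, for each `j`, either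
`k_n(j)` is finite for all `n` in `ℕ`, or `k_n(j) = ∞` for all `n` in `ℕ`. -/
structure IsApproximation (p : ℕ∞ → Xi d) : Prop where
  tendsto : Tendsto (fun n : ℕ => p n) atTop (𝓝 (p ⊤))
  k_top : ∀ j, (p ⊤).k j = ⊤
  finite_or_infinite : ∀ j, (∀ n : ℕ, (p n).k j ≠ ⊤) ∨ ∀ n : ℕ, (p n).k j = ⊤

/-- Extension of elements of `ℤ^d` to `ℤ^d'` by `0`. -/
def extendZero (d' : ℕ) (x : Fin d → ℤ) : Fin d' → ℤ :=
  fun j => if h : (j : ℕ) < d then x ⟨j, h⟩ else 0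

/-- The conditions relating the fuzzy and quantum `d`-tori given by `(k_n, σ_n)`, the fuzzy and
quantum `d'`-tori given by `(k'_n, σ'_n)`, and the permutation `f` of `{1, …, d'}`. -/
structure IsInnerification (hdd' : d ≤ d') (p : ℕ∞ → Xi d) (f : Equiv.Perm (Fin d'))
    (p' : ℕ∞ → Xi d') : Prop where
  order_two : ∀ j, f (f j) = j
  no_fixed_point : ∀ j, f j ≠ j
  tendsto : Tendsto (fun n : ℕ => p' n) atTop (𝓝 (p' ⊤))
  k_top : ∀ j, (p' ⊤).k j = ⊤
  covers : ∀ j : Fin d', d ≤ (j : ℕ) → ∃ i : Fin d, f (Fin.castLE hdd' i) = j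
  k_eq : ∀ (n : ℕ∞) (i : Fin d),
    (p' n).k (f (Fin.castLE hdd' i)) = (p n).k i ∧ (p' n).k (Fin.castLE hdd' i) = (p n).k i
  /-- The restriction of `σ'_n` to the first `d` coordinates is cohomologous to `σ_n`. -/
  cohomologous : ∀ n : ℕ∞, ∃ h : (p n).G → Circle, ∀ x y : Fin d → ℤ,
    (p' n).lifted (extendZero d' x) (extendZero d' y) =
      h (toZk (p n).k x) * h (toZk (p n).k y) * (h (toZk (p n).k (x + y)))⁻¹ * (p n).lifted x y
  commutation : ∀ (n : ℕ∞) (i : Fin d) (s : Fin d'),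
    (s = Fin.castLE hdd' i → (p n).k i ≠ ⊤ → s < f s →
      (p' n).U (f s) * (p' n).U s =
        Complex.exp (2 * Complex.I * Real.pi / ((p n).k i).toNat) •
          ((p' n).U s * (p' n).U (f s))) ∧
    (s = Fin.castLE hdd' i → (p n).k i ≠ ⊤ → f s < s →
      (p' n).U (f s) * (p' n).U s =
        Complex.exp (-(2 * Complex.I * Real.pi) / ((p n).k i).toNat) •
          ((p' n).U s * (p' n).U (f s))) ∧
    ((s ≠ Fin.castLE hdd' i ∨ (p n).k i = ⊤) →
      (p' n).U (f (Fin.castLE hdd' i)) * (p' n).U s =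
        (p' n).U s * (p' n).U (f (Fin.castLE hdd' i)))

end Hypotheses

end

end QuantumTori

open QuantumTori

/-! Analytic part. Each component of $D$ has the form $\Gamma_i=A_i\partial_{j(i)}+B_i$ with $A_i$,
$B_i$ bounded: $A_i$ is $X_j$, $Y_j$ or $1$ in a direction of infinite order and $0$ otherwise. When
$k(j)=\infty$ the unitary $U_{f(j)}$ commutes with every $U_s$, so the $A_i$ commute with one
another; the Clifford generators anticommute; and $X_j^2+Y_j^2=1$. Hence, modulo lower order terms,
the leading part of $D$ squares to multiplication by $\langle m,m\rangle$. This is made exact by a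
large parameter. Let $r_x$ be multiplication by $(1+x^2+\langle m,m\rangle)^{-1/2}$. The operators
$(D\mp i\sqrt{1+x^2})\,r_x$ are bounded, and their product, in either order, tends to $1$ in norm as
$x\to\infty$, because the commutators of the symbols with finite combinations of the $W^g$ are
$O((1+x^2)^{-1/2})$ (`tendsto_parametrix_mul`, `Xi.tendsto_commutator_of_mem_span`). So both are
invertible for some $x$. Since $f$ has no fixed point, each $A_i$ commutes with its own derivation,
which makes $D$ symmetric; as $r_x$ is compact with range $\operatorname{dom}D$, the operator $D$ is
self-adjoint with compact resolvent (`isSelfAdjoint_diracOp`). The generators $U_1,\dots,U_d$ have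
bounded commutators with $D$, whence a spectral triple.

Metric part. `isQuantumCompactMetricSpace_of_isSpectralTriple` reduces everything to two facts: the
kernel of the seminorm is made of scalars, and its unit ball is, modulo scalars, uniformly close to
bounded subsets of finite dimensional spaces. The Leibniz rule and closedness hold for every
self-adjoint $D$, the latter by testing the commutator against pairs of vectors of the domain
(`commNorm_le_iff_inner`).

For these two facts, the orthogonality of the Clifford generators for the trace isolates each
$[\Gamma_i,a]$ (`mem_sobolev_and_norm_gammaOp_sub_le`). If $k(j)=\infty$, then $X_j$ and $Y_j$
commute with $a$ and $X_j^2+Y_j^2=1$, so $[\partial_j,a]$ is bounded. If $k(j)<\infty$, right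
multiplications commute with $a$, so $[U_{f(j)},a]$ is bounded. Elements of the algebra commute with
right translations, hence are determined by Fourier coefficients, and at $g\neq0$ the two bounds
control the coefficient, through $g_j\ne0$ or through $\omega^{g_j}\neq1$ with $\omega$ a primitive
root of unity (`exists_norm_coeff_le`). This settles the kernel. For the approximation, a bounded
$[\partial_j,a]$ has matrix $i(m_j-n_j)a_{mn}$; dividing by $m_j-n_j$ outside a finite set is a
Schur multiplier of norm at most the $\ell^2$ norm of a tail of $1/l$, so Fourier series can be
truncated uniformly (`exists_uniform_truncation`). Coordinates of finite order need no truncation.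
-/

namespace QuantumTori

/-! ### States, and a criterion for the Monge-Kantorovich metric to induce the weak* topology. -/

section States

variable {A : Type*} [CStarAlgebra A]

/-- The element $\|b\|1-b$ is positive, hence of the form $x^*x$, on which a state is nonnegative;
this is applied to $a$ and $-a$. -/
lemma norm_state_le_of_isSelfAdjoint {φ : WeakDual ℂ A} (hφ : φ ∈ stateSpace A) {a : A}
    (ha : IsSelfAdjoint a) : ‖φ a‖ ≤ ‖a‖ := by
  let _ := CStarAlgebra.spectralOrder A
  let _ := CStarAlgebra.spectralOrderedRing A
  have key : ∀ b : A, IsSelfAdjoint b → (φ b).re ≤ ‖b‖ ∧ (φ b).im = 0 := by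
    intro b hb
    have h0 : 0 ≤ algebraMap ℝ A ‖b‖ - b := sub_nonneg.2 hb.le_algebraMap_norm_self
    obtain ⟨x, hx⟩ := CStarAlgebra.nonneg_iff_eq_star_mul_self.1 h0
    have h1 := hφ.2 x
    have h2 : φ (algebraMap ℝ A ‖b‖) = (‖b‖ : ℂ) := by
      have : algebraMap ℝ A ‖b‖ = (‖b‖ : ℂ) • (1 : A) := by
        rw [Algebra.algebraMap_eq_smul_one]
        exact (Complex.coe_smul _ _).symm
      rw [this, map_smul, hφ.1, smul_eq_mul, mul_one]
    rw [← hx, map_sub, h2] at h1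
    simp at h1
    exact h1
  obtain ⟨h1, h2⟩ := key a ha
  obtain ⟨h3, -⟩ := key (-a) ha.neg
  rw [map_neg, norm_neg, Complex.neg_re] at h3
  have : φ a = ((φ a).re : ℂ) := Complex.ext rfl (by simp [h2])
  rw [this, Complex.norm_real, Real.norm_eq_abs]
  exact abs_le.2 ⟨by linarith, h1⟩

/-- The constant 2, from splitting into real and imaginary parts, is not sharp but suffices for the
estimates below. -/
lemma norm_state_le {φ : WeakDual ℂ A} (hφ : φ ∈ stateSpace A) (a : A) : ‖φ a‖ ≤ 2 * ‖a‖ := by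
  have h := realPart_add_I_smul_imaginaryPart a
  have h1 := norm_state_le_of_isSelfAdjoint hφ (realPart a).2
  have h2 := norm_state_le_of_isSelfAdjoint hφ (imaginaryPart a).2
  have h3 : ‖(realPart a : A)‖ ≤ ‖a‖ := realPart.norm_le a
  have h4 : ‖(imaginaryPart a : A)‖ ≤ ‖a‖ := imaginaryPart.norm_le a
  calc ‖φ a‖ = ‖φ (realPart a : A) + Complex.I * φ (imaginaryPart a : A)‖ := by
        conv_lhs => rw [← h]
        rw [map_add, map_smul, smul_eq_mul]
    _ ≤ ‖φ (realPart a : A)‖ + ‖φ (imaginaryPart a : A)‖ := by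
        refine (norm_add_le _ _).trans_eq ?_
        rw [norm_mul, Complex.norm_I, one_mul]
    _ ≤ 2 * ‖a‖ := by linarith

/-- Up to scalars, the unit ball of `L` is contained, up to any given error, in a bounded subset
of a finite dimensional space. -/
def HasFiniteApproximation (L : selfAdjoint A → ℝ≥0∞) : Prop :=
  ∀ ε > (0 : ℝ), ∃ (ι : Type) (_ : Fintype ι) (b : ι → A) (C : ι → ℝ),
    ∀ a, L a ≤ 1 → ∃ (t : ℂ) (c : ι → ℂ), (∀ i, ‖c i‖ ≤ C i) ∧
      ‖(a : A) - (t • 1 + ∑ i, c i • b i)‖ ≤ ε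

/-- Scalars disappear because both states take the value 1 at the unit, and the error of norm at
most $\varepsilon$ costs $2\varepsilon$ under each state. Only finitely many evaluations remain,
which is what weak* continuity can control. -/
lemma norm_state_sub_state_le {ι : Type*} [Fintype ι] {φ ψ : WeakDual ℂ A}
    (hφ : φ ∈ stateSpace A) (hψ : ψ ∈ stateSpace A) {a : A} {b : ι → A} {C : ι → ℝ} {t : ℂ}
    {c : ι → ℂ} {ε : ℝ} (hc : ∀ i, ‖c i‖ ≤ C i) (h : ‖a - (t • 1 + ∑ i, c i • b i)‖ ≤ ε) :
    ‖φ a - ψ a‖ ≤ 4 * ε + ∑ i, C i * ‖φ (b i) - ψ (b i)‖ := by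
  set x := a - (t • 1 + ∑ i, c i • b i) with hx
  have ha : a = x + (t • 1 + ∑ i, c i • b i) := by rw [hx]; abel
  have h1 : φ a - ψ a = (φ x - ψ x) + ∑ i, c i * (φ (b i) - ψ (b i)) := by
    rw [ha]
    simp only [map_add, map_smul, map_sum, hφ.1, hψ.1, smul_eq_mul, mul_sub,
      Finset.sum_sub_distrib]
    ring
  have h2 := norm_state_le hφ x
  have h3 := norm_state_le hψ x
  calc ‖φ a - ψ a‖ ≤ ‖φ x - ψ x‖ + ‖∑ i, c i * (φ (b i) - ψ (b i))‖ := by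
        rw [h1]; exact norm_add_le _ _
    _ ≤ 4 * ε + ∑ i, C i * ‖φ (b i) - ψ (b i)‖ := by
        refine add_le_add ((norm_sub_le _ _).trans (by linarith)) ?_
        refine (norm_sum_le _ _).trans (Finset.sum_le_sum fun i _ => ?_)
        rw [norm_mul]
        exact mul_le_mul_of_nonneg_right (hc i) (norm_nonneg _)

variable {L : selfAdjoint A → ℝ≥0∞}

lemma mkDist_le {φ ψ : WeakDual ℂ A} {C : ℝ} (h : ∀ a, L a ≤ 1 → ‖φ (a : A) - ψ (a : A)‖ ≤ C) :
    mkDist L φ ψ ≤ ENNReal.ofReal C :=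
  iSup₂_le fun a ha => by
    rw [← ofReal_norm]
    exact ENNReal.ofReal_le_ofReal (h a ha)

lemma mkDist_lt_top (hL : HasFiniteApproximation L) {φ ψ : WeakDual ℂ A}
    (hφ : φ ∈ stateSpace A) (hψ : ψ ∈ stateSpace A) : mkDist L φ ψ < ⊤ := by
  obtain ⟨ι, _, b, C, h⟩ := hL 1 one_pos
  refine (mkDist_le (C := 4 * 1 + ∑ i, C i * ‖φ (b i) - ψ (b i)‖) fun a ha => ?_).trans_lt
    ENNReal.ofReal_lt_top
  obtain ⟨t, c, hc, h⟩ := h a ha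
  exact norm_state_sub_state_le hφ hψ hc h

lemma mkDist_comm (φ ψ : WeakDual ℂ A) : mkDist L φ ψ = mkDist L ψ φ := by
  simp only [mkDist, enorm_sub_rev]

lemma mkDist_self (φ : WeakDual ℂ A) : mkDist L φ φ = 0 := by
  simp [mkDist]

lemma mkDist_triangle (φ ψ χ : WeakDual ℂ A) :
    mkDist L φ χ ≤ mkDist L φ ψ + mkDist L ψ χ := by
  refine iSup₂_le fun a ha => ?_
  have h : φ (a : A) - χ (a : A) = (φ (a : A) - ψ (a : A)) + (ψ (a : A) - χ (a : A)) := by abel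
  rw [h]
  refine (enorm_add_le _ _).trans (add_le_add ?_ ?_)
  · exact le_iSup₂ (f := fun (a : selfAdjoint A) (_ : L a ≤ 1) => ‖φ (a : A) - ψ (a : A)‖ₑ) a ha
  · exact le_iSup₂ (f := fun (a : selfAdjoint A) (_ : L a ≤ 1) => ‖ψ (a : A) - χ (a : A)‖ₑ) a ha

lemma norm_sub_le_mkDist (hsmul : ∀ (r : ℝ) (a), L (r • a) = ENNReal.ofReal |r| * L a)
    {φ ψ : WeakDual ℂ A} (hfin : mkDist L φ ψ < ⊤) {a : selfAdjoint A} (ha : L a < ⊤) :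
    ‖φ (a : A) - ψ (a : A)‖ ≤ ((L a).toReal + 1) * (mkDist L φ ψ).toReal := by
  -- Adding 1 keeps the normalising constant positive when `L a = 0`.
  set c := (L a).toReal + 1 with hc
  have hc0 : 0 < c := by positivity
  have h1 : L (c⁻¹ • a) ≤ 1 := by
    rw [hsmul, abs_of_pos (inv_pos.2 hc0), ← ENNReal.ofReal_toReal ha.ne,
      ← ENNReal.ofReal_mul (inv_pos.2 hc0).le, ← ENNReal.ofReal_one]
    refine ENNReal.ofReal_le_ofReal ?_
    rw [inv_mul_le_one₀ hc0, hc]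
    linarith
  have h2 : ‖φ ((c⁻¹ • a : selfAdjoint A) : A) - ψ ((c⁻¹ • a : selfAdjoint A) : A)‖ₑ ≤
      mkDist L φ ψ :=
    le_iSup₂ (f := fun (a : selfAdjoint A) (_ : L a ≤ 1) => ‖φ (a : A) - ψ (a : A)‖ₑ) _ h1
  have h3 : ((c⁻¹ • a : selfAdjoint A) : A) = ((c⁻¹ : ℝ) : ℂ) • (a : A) := by
    rw [selfAdjoint.val_smul]; exact (Complex.coe_smul _ _).symm
  rw [h3, map_smul, map_smul, ← smul_sub] at h2
  have h4 := ENNReal.toReal_mono hfin.ne h2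
  rw [toReal_enorm, norm_smul, Complex.norm_real, Real.norm_of_nonneg (inv_pos.2 hc0).le,
    inv_mul_le_iff₀ hc0] at h4
  exact h4

/-- A seminorm whose unit ball is approximately finite dimensional, modulo scalars, induces a
metric on the state space whose topology is the weak* topology. -/
theorem exists_metricSpace_mkDist
    (hsmul : ∀ (r : ℝ) (a), L (r • a) = ENNReal.ofReal |r| * L a)
    (hdense : Dense {a : selfAdjoint A | L a < ⊤}) (hL : HasFiniteApproximation L) :
    ∃ m : MetricSpace (stateSpace A),
      (∀ φ ψ : stateSpace A, ENNReal.ofReal (m.dist φ ψ) = mkDist L φ ψ) ∧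
      m.toUniformSpace.toTopologicalSpace = weakStarTopology A := by
  have hfin : ∀ φ ψ : stateSpace A, mkDist L φ ψ < ⊤ := fun φ ψ => mkDist_lt_top hL φ.2 ψ.2
  -- self-adjoint elements are approximated by elements of the domain
  have happrox : ∀ (φ : stateSpace A) (a : selfAdjoint A) (ε : ℝ), 0 < ε →
      ∃ C > 0, ∀ ψ : stateSpace A, ‖(ψ : WeakDual ℂ A) (a : A) - (φ : WeakDual ℂ A) (a : A)‖ ≤
        ε + C * (mkDist L ψ φ).toReal := by
    -- Replacing $a$ by an element of the domain at distance less than $\varepsilon/2$ costs at most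
    -- $\varepsilon/2$ under each of the two states.
    intro φ a ε hε
    obtain ⟨b, hb, hab⟩ := hdense.exists_dist_lt a (half_pos hε)
    refine ⟨(L b).toReal + 1, by positivity, fun ψ => ?_⟩
    have h1 := norm_sub_le_mkDist hsmul (hfin ψ φ) hb
    have hab' : ‖(a - b : selfAdjoint A)‖ < ε / 2 := by rwa [← dist_eq_norm]
    have h2 := norm_state_le_of_isSelfAdjoint ψ.2 (a - b).2
    have h3 := norm_state_le_of_isSelfAdjoint φ.2 (a - b).2
    have h4 : ‖((a - b : selfAdjoint A) : A)‖ < ε / 2 := hab'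
    have h5 : (ψ : WeakDual ℂ A) (a : A) - (φ : WeakDual ℂ A) (a : A) =
        ((ψ : WeakDual ℂ A) ((a - b : selfAdjoint A) : A) -
          (φ : WeakDual ℂ A) ((a - b : selfAdjoint A) : A)) +
        ((ψ : WeakDual ℂ A) (b : A) - (φ : WeakDual ℂ A) (b : A)) := by
      rw [AddSubgroup.coe_sub, map_sub, map_sub]; ring
    rw [h5]
    refine (norm_add_le _ _).trans (add_le_add ((norm_sub_le _ _).trans ?_) h1)
    linarith
  let m : MetricSpace (stateSpace A) :=
    { dist := fun φ ψ => (mkDist L φ ψ).toReal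
      dist_self := fun φ => by simp [mkDist_self]
      dist_comm := fun φ ψ => by rw [mkDist_comm]
      dist_triangle := fun φ ψ χ => by
        rw [← ENNReal.toReal_add (hfin _ _).ne (hfin _ _).ne]
        exact ENNReal.toReal_mono (ENNReal.add_lt_top.2 ⟨hfin _ _, hfin _ _⟩).ne
          (mkDist_triangle _ _ _)
      eq_of_dist_eq_zero := fun {φ ψ} h => by
        have hsa : ∀ a : selfAdjoint A,
            (φ : WeakDual ℂ A) (a : A) = (ψ : WeakDual ℂ A) (a : A) := by
          intro a
          rw [← sub_eq_zero, ← norm_le_zero_iff]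
          refine le_of_forall_pos_le_add fun ε hε => ?_
          obtain ⟨C, -, hC⟩ := happrox ψ a ε hε
          have := hC φ
          change (mkDist L φ ψ).toReal = 0 at h
          rw [h] at this
          linarith
        refine Subtype.ext (DFunLike.ext _ _ fun a => ?_)
        rw [← realPart_add_I_smul_imaginaryPart a, map_add, map_smul, map_add, map_smul,
          hsa, hsa] }
  refine ⟨m, fun φ ψ => ENNReal.ofReal_toReal (hfin φ ψ).ne, ?_⟩
  refine TopologicalSpace.ext_nhds fun φ => le_antisymm ?_ ?_
  -- The metric topology is finer than the weak* topology: evaluations at self-adjoint elements are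
  -- continuous for the metric by density of the domain, and then so are all evaluations.
  · have hsa : ∀ a : selfAdjoint A, Tendsto (fun ψ : stateSpace A => (ψ : WeakDual ℂ A) (a : A))
        (@nhds _ m.toUniformSpace.toTopologicalSpace φ) (𝓝 ((φ : WeakDual ℂ A) (a : A))) := by
      intro a
      rw [Metric.tendsto_nhds]
      intro ε hε
      obtain ⟨C, hC0, hC⟩ := happrox φ a (ε / 2) (half_pos hε)
      filter_upwards [Metric.ball_mem_nhds φ (show 0 < ε / 2 / C by positivity)] with ψ hψ
      have h1 : (mkDist L ψ φ).toReal < ε / 2 / C := hψ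
      rw [dist_eq_norm]
      have := hC ψ
      rw [lt_div_iff₀ hC0] at h1
      linarith
    have : Tendsto (id : stateSpace A → stateSpace A)
        (@nhds _ m.toUniformSpace.toTopologicalSpace φ) (@nhds _ (weakStarTopology A) φ) := by
      rw [tendsto_subtype_rng, tendsto_iff_forall_eval_tendsto_topDualPairing]
      intro a
      change Tendsto (fun ψ : stateSpace A => (ψ : WeakDual ℂ A) a) _
        (𝓝 ((φ : WeakDual ℂ A) a))
      have h1 := (hsa (realPart a)).add ((hsa (imaginaryPart a)).const_mul Complex.I)
      have h2 : ∀ χ : WeakDual ℂ A, χ a = χ (realPart a : A) +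
          Complex.I * χ (imaginaryPart a : A) := fun χ => by
        conv_lhs => rw [← realPart_add_I_smul_imaginaryPart a]
        rw [map_add, map_smul, smul_eq_mul]
      simp only [h2]
      exact h1
    exact this
  · refine Metric.nhds_basis_ball.ge_iff.2 fun ε hε => ?_
    -- Conversely, balls are weak* neighbourhoods. The error contributes
    -- $4\cdot\varepsilon/8=\varepsilon/2$, leaving room for the finitely many evaluations.
    obtain ⟨ι, _, b, C, h⟩ := hL (ε / 8) (by positivity)
    have hcont : Continuous fun ψ : stateSpace A => 4 * (ε / 8) +
        ∑ i, C i * ‖(ψ : WeakDual ℂ A) (b i) - (φ : WeakDual ℂ A) (b i)‖ := by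
      refine continuous_const.add (continuous_finsetSum _ fun i _ => continuous_const.mul ?_)
      exact (((WeakDual.eval_continuous (b i)).comp continuous_subtype_val).sub
        continuous_const).norm
    have hlt := hcont.continuousAt (x := φ)
    have h0 : 4 * (ε / 8) +
        ∑ i, C i * ‖(φ : WeakDual ℂ A) (b i) - (φ : WeakDual ℂ A) (b i)‖ < ε := by
      simp; linarith
    filter_upwards [hlt.eventually (gt_mem_nhds h0)] with ψ hψ
    change (mkDist L ψ φ).toReal < ε
    refine lt_of_le_of_lt (ENNReal.toReal_le_of_le_ofReal ?_ ?_) hψ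
    -- The approximation of the element 0 is used only to see that the bounds `C i` are nonnegative.
    · obtain ⟨t, c, hc, h⟩ := h 0 (by
        have := hsmul 0 0
        simp at this
        simp [this])
      refine add_nonneg (by positivity) (Finset.sum_nonneg fun i _ => ?_)
      exact mul_nonneg ((norm_nonneg _).trans (hc i)) (norm_nonneg _)
    · refine mkDist_le fun a ha => ?_
      obtain ⟨t, c, hc, h⟩ := h a ha
      exact norm_state_sub_state_le ψ.2 φ.2 hc h

end States

/-! ### Commutators with a self-adjoint operator: linearity, Leibniz rule, lower semicontinuity. -/

section CommutatorNorm

open scoped InnerProductSpace NNReal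

variable {A : Type*} [CStarAlgebra A]
variable {H : Type*} [NormedAddCommGroup H] [InnerProductSpace ℂ H]

lemma norm_le_of_dense_inner {S : Set H} (hS : Dense S) {v : H} {C : ℝ} (hC : 0 ≤ C)
    (h : ∀ η ∈ S, ‖⟪η, v⟫_ℂ‖ ≤ C * ‖η‖) : ‖v‖ ≤ C := by
  have h1 : ∀ η : H, ‖⟪η, v⟫_ℂ‖ ≤ C * ‖η‖ := fun η => by
    have hcl : IsClosed {η : H | ‖⟪η, v⟫_ℂ‖ ≤ C * ‖η‖} :=
      isClosed_le (by fun_prop) (by fun_prop)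
    exact hcl.closure_subset_iff.2 h (hS η)
  rcases eq_or_ne v 0 with rfl | hv
  · rwa [norm_zero]
  · have := h1 v
    rw [inner_self_eq_norm_sq_to_K, norm_pow, RCLike.norm_ofReal, abs_norm, sq] at this
    exact le_of_mul_le_mul_right this (norm_pos_iff.2 hv)

variable [CompleteSpace H] {π : A →⋆ₐ[ℂ] (H →L[ℂ] H)} {D : H →ₗ.[ℂ] H}

lemma norm_starAlgHom_apply_le (π : A →⋆ₐ[ℂ] (H →L[ℂ] H)) (a : A) (ξ : H) :
    ‖π a ξ‖ ≤ ‖a‖ * ‖ξ‖ :=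
  (ContinuousLinearMap.le_opNorm _ _).trans
    (mul_le_mul_of_nonneg_right (NonUnitalStarAlgHom.norm_apply_le π a) (norm_nonneg _))

lemma inner_map_left_eq (hD : IsSelfAdjoint D) (ξ η : D.domain) :
    ⟪D ξ, (η : H)⟫_ℂ = ⟪(ξ : H), D η⟫_ℂ := by
  have h := LinearPMap.adjoint_isFormalAdjoint (T := D) hD.dense_domain
  rw [LinearPMap.isSelfAdjoint_def.1 hD] at h
  exact h ξ η

lemma commNorm_le_iff {a : A} {C : ℝ≥0} :
    commNorm π D a ≤ C ↔ ∃ h : ∀ ξ : D.domain, π a (ξ : H) ∈ D.domain,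
      ∀ ξ : D.domain, ‖D ⟨π a (ξ : H), h ξ⟩ - π a (D ξ)‖ ≤ C * ‖(ξ : H)‖ := by
  unfold commNorm
  constructor
  · intro h
    split_ifs at h with hdom
    · refine ⟨hdom, fun ξ => ?_⟩
      rw [iSup₂_le_iff] at h
      rcases eq_or_ne ξ 0 with rfl | hξ
      · have h1 : (⟨π a ((0 : D.domain) : H), hdom 0⟩ : D.domain) = 0 := by ext; simp
        rw [h1]; simp
      · have hn : 0 < ‖(ξ : H)‖ := norm_pos_iff.2 (by simpa using hξ)
        set r : ℂ := ((‖(ξ : H)‖⁻¹ : ℝ) : ℂ) with hr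
        have hr' : ‖r‖ = ‖(ξ : H)‖⁻¹ := by
          rw [hr, Complex.norm_real, Real.norm_of_nonneg (inv_nonneg.2 hn.le)]
        have h2 := h (r • ξ) (by
          rw [Submodule.coe_smul, norm_smul, hr', inv_mul_cancel₀ hn.ne'])
        have h3 : (⟨π a ((r • ξ : D.domain) : H), hdom _⟩ : D.domain) =
            r • ⟨π a (ξ : H), hdom ξ⟩ := by ext; simp
        rw [h3, LinearPMap.map_smul, LinearPMap.map_smul, map_smul, ← smul_sub, enorm_smul,
          ← ofReal_norm,
          ← ofReal_norm, ← ENNReal.ofReal_mul (norm_nonneg _), ← ENNReal.ofReal_coe_nnreal,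
          hr'] at h2
        have h4 := (ENNReal.ofReal_le_ofReal_iff C.2).1 h2
        rw [inv_mul_le_iff₀ hn] at h4
        exact h4.trans_eq (mul_comm _ _)
    · simp at h
  · rintro ⟨hdom, h⟩
    rw [dif_pos hdom]
    refine iSup₂_le fun ξ hξ => ?_
    rw [← ofReal_norm, ← ENNReal.ofReal_coe_nnreal]
    refine ENNReal.ofReal_le_ofReal ((h ξ).trans ?_)
    exact mul_le_of_le_one_right C.2 hξ

/-- For a self-adjoint operator, the norm of a commutator can be computed weakly. -/
lemma commNorm_le_iff_inner (hD : IsSelfAdjoint D) {a : A} {C : ℝ≥0} :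
    commNorm π D a ≤ C ↔ ∀ ξ η : D.domain,
      ‖⟪D η, π a (ξ : H)⟫_ℂ - ⟪(η : H), π a (D ξ)⟫_ℂ‖ ≤ C * ‖(ξ : H)‖ * ‖(η : H)‖ := by
  rw [commNorm_le_iff]
  constructor
  · rintro ⟨hdom, h⟩ ξ η
    have h1 : ⟪D η, π a (ξ : H)⟫_ℂ = ⟪(η : H), D ⟨π a (ξ : H), hdom ξ⟩⟫_ℂ :=
      inner_map_left_eq hD η ⟨π a (ξ : H), hdom ξ⟩
    rw [h1, ← inner_sub_right]
    refine (norm_inner_le_norm _ _).trans ?_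
    rw [mul_comm]
    exact mul_le_mul_of_nonneg_right (h ξ) (norm_nonneg _)
  · intro h
    -- The weak bound makes $\eta\mapsto\langle a\xi,D\eta\rangle$ continuous, so $a\xi$ is in the
    -- domain of $D^*=D$: preservation of the domain is a consequence of the estimate.
    have hdom : ∀ ξ : D.domain, π a (ξ : H) ∈ D.domain := by
      intro ξ
      suffices h0 : π a (ξ : H) ∈ D.adjoint.domain by
        rwa [LinearPMap.isSelfAdjoint_def.1 hD] at h0
      rw [LinearPMap.mem_adjoint_domain_iff]
      refine AddMonoidHomClass.continuous_of_bound _ (C * ‖(ξ : H)‖ + ‖π a (D ξ)‖) fun η => ?_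
      change ‖⟪π a (ξ : H), D η⟫_ℂ‖ ≤ _
      rw [norm_inner_symm]
      have h1 := h ξ η
      have h2 := norm_inner_le_norm (𝕜 := ℂ) (η : H) (π a (D ξ))
      have h3 := norm_sub_norm_le ⟪D η, π a (ξ : H)⟫_ℂ ⟪(η : H), π a (D ξ)⟫_ℂ
      change _ ≤ _ * ‖(η : H)‖
      linarith
    refine ⟨hdom, fun ξ => norm_le_of_dense_inner hD.dense_domain (by positivity)
      fun η hη => ?_⟩
    have h1 := h ξ ⟨η, hη⟩
    have h2 : ⟪D ⟨η, hη⟩, π a (ξ : H)⟫_ℂ = ⟪(η : H), D ⟨π a (ξ : H), hdom ξ⟩⟫_ℂ :=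
      inner_map_left_eq hD ⟨η, hη⟩ ⟨π a (ξ : H), hdom ξ⟩
    rw [h2, ← inner_sub_right] at h1
    exact h1

lemma commNorm_add_le (hD : IsSelfAdjoint D) (a b : A) :
    commNorm π D (a + b) ≤ commNorm π D a + commNorm π D b := by
  cases ha : commNorm π D a with
  | top => simp
  | coe C =>
  cases hb : commNorm π D b with
  | top => simp
  | coe C' =>
  rw [← ENNReal.coe_add, commNorm_le_iff_inner hD]
  intro ξ η
  have h1 := (commNorm_le_iff_inner hD).1 ha.le ξ η
  have h2 := (commNorm_le_iff_inner hD).1 hb.le ξ η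
  have h3 : ⟪D η, π (a + b) (ξ : H)⟫_ℂ - ⟪(η : H), π (a + b) (D ξ)⟫_ℂ =
      (⟪D η, π a (ξ : H)⟫_ℂ - ⟪(η : H), π a (D ξ)⟫_ℂ) +
      (⟪D η, π b (ξ : H)⟫_ℂ - ⟪(η : H), π b (D ξ)⟫_ℂ) := by
    simp only [map_add, add_apply, inner_add_right]; ring
  rw [h3, NNReal.coe_add, add_mul, add_mul]
  exact (norm_add_le _ _).trans (add_le_add h1 h2)

lemma commNorm_smul_le (hD : IsSelfAdjoint D) (z : ℂ) (a : A) :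
    commNorm π D (z • a) ≤ ‖z‖ₑ * commNorm π D a := by
  cases ha : commNorm π D a with
  | top =>
    rcases eq_or_ne z 0 with rfl | hz
    · rw [zero_smul, enorm_zero, zero_mul, ← ENNReal.coe_zero, commNorm_le_iff_inner hD]
      intro ξ η
      simp
    · rw [ENNReal.mul_top (by simpa using hz)]
      exact le_top
  | coe C =>
  rw [enorm_eq_nnnorm, ← ENNReal.coe_mul, commNorm_le_iff_inner hD]
  intro ξ η
  have h1 := (commNorm_le_iff_inner hD).1 ha.le ξ η
  rw [map_smul, smul_apply, smul_apply, inner_smul_right,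
    inner_smul_right, ← mul_sub, norm_mul, NNReal.coe_mul, mul_assoc, mul_assoc, coe_nnnorm,
    ← mul_assoc (C : ℝ)]
  exact mul_le_mul_of_nonneg_left h1 (norm_nonneg _)

lemma commNorm_smul (hD : IsSelfAdjoint D) (z : ℂ) (a : A) :
    commNorm π D (z • a) = ‖z‖ₑ * commNorm π D a := by
  refine le_antisymm (commNorm_smul_le hD z a) ?_
  rcases eq_or_ne z 0 with rfl | hz
  · simp
  · have h := commNorm_smul_le (π := π) hD z⁻¹ (z • a)
    rw [inv_smul_smul₀ hz, enorm_inv hz] at h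
    refine (mul_le_mul_right h _).trans ?_
    rw [← mul_assoc, ENNReal.mul_inv_cancel (by simpa using hz) enorm_ne_top, one_mul]

/-- Passing to the adjoint exchanges the two test vectors in the weak form of the commutator, up to
sign and conjugation. -/
lemma commNorm_star_le (hD : IsSelfAdjoint D) (a : A) :
    commNorm π D (star a) ≤ commNorm π D a := by
  cases ha : commNorm π D a with
  | top => simp
  | coe C =>
  rw [commNorm_le_iff_inner hD]
  intro ξ η
  have h1 := (commNorm_le_iff_inner hD).1 ha.le η ξ
  rw [map_star, ContinuousLinearMap.star_eq_adjoint, ContinuousLinearMap.adjoint_inner_right,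
    ContinuousLinearMap.adjoint_inner_right, norm_sub_rev, ← RCLike.norm_conj, map_sub,
    inner_conj_symm, inner_conj_symm]
  linarith

lemma commNorm_algebraMap (z : ℂ) : commNorm π D (algebraMap ℂ A z) = 0 := by
  refine le_antisymm ?_ bot_le
  rw [← ENNReal.coe_zero, commNorm_le_iff]
  have h : ∀ ξ : H, π (algebraMap ℂ A z) ξ = z • ξ := fun ξ => by
    rw [AlgHomClass.commutes, Algebra.algebraMap_eq_smul_one]; rfl
  refine ⟨fun ξ => by rw [h]; exact D.domain.smul_mem _ ξ.2, fun ξ => ?_⟩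
  have h1 : ∀ hm, D ⟨π (algebraMap ℂ A z) (ξ : H), hm⟩ = z • D ξ := fun hm => by
    rw [← LinearPMap.map_smul]
    congr 1
    ext
    exact h ξ
  rw [h1, h]
  simp

/-- This is $[D,ab]=[D,a]b+a[D,b]$; finiteness of both norms ensures that $b$, then $a$, preserve
the domain. -/
lemma commNorm_mul_le {a b : A} (ha : commNorm π D a < ⊤) (hb : commNorm π D b < ⊤) :
    commNorm π D (a * b) ≤ ‖a‖ₑ * commNorm π D b + commNorm π D a * ‖b‖ₑ := by
  lift commNorm π D a to ℝ≥0 using ha.ne with C hC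
  lift commNorm π D b to ℝ≥0 using hb.ne with C' hC'
  rw [enorm_eq_nnnorm, enorm_eq_nnnorm, ← ENNReal.coe_mul, ← ENNReal.coe_mul,
    ← ENNReal.coe_add, commNorm_le_iff]
  obtain ⟨hda, ha⟩ := commNorm_le_iff.1 hC.ge
  obtain ⟨hdb, hb⟩ := commNorm_le_iff.1 hC'.ge
  have hmul : ∀ ξ, π (a * b) ξ = π a (π b ξ) := fun ξ => by rw [map_mul]; rfl
  have hdom : ∀ ξ : D.domain, π (a * b) (ξ : H) ∈ D.domain := fun ξ => by
    rw [hmul]; exact hda ⟨_, hdb ξ⟩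
  refine ⟨hdom, fun ξ => ?_⟩
  have h1 := ha ⟨_, hdb ξ⟩
  have h2 := hb ξ
  have h3 : D ⟨π (a * b) (ξ : H), hdom ξ⟩ - π (a * b) (D ξ) =
      (D ⟨π a (π b (ξ : H)), hda ⟨_, hdb ξ⟩⟩ - π a (D ⟨π b (ξ : H), hdb ξ⟩)) +
      π a (D ⟨π b (ξ : H), hdb ξ⟩ - π b (D ξ)) := by
    have h4 : (⟨π (a * b) (ξ : H), hdom ξ⟩ : D.domain) =
      ⟨π a (π b (ξ : H)), hda ⟨_, hdb ξ⟩⟩ := by ext; exact hmul _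
    rw [h4, hmul, map_sub]; abel
  rw [h3]
  calc _ ≤ (C : ℝ) * (‖b‖ * ‖(ξ : H)‖) + ‖a‖ * (C' * ‖(ξ : H)‖) := by
        refine (norm_add_le _ _).trans (add_le_add (h1.trans ?_) ?_)
        · exact mul_le_mul_of_nonneg_left (norm_starAlgHom_apply_le π b _) C.2
        · exact (norm_starAlgHom_apply_le π a _).trans
            (mul_le_mul_of_nonneg_left h2 (norm_nonneg _))
    _ = _ := by push_cast; ring

variable (π) in
/-- The *-algebra of all elements with a bounded commutator with the self-adjoint operator `D`. -/
def lipschitzAlgebra (hD : IsSelfAdjoint D) : StarSubalgebra ℂ A where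
  carrier := {a | commNorm π D a < ⊤}
  mul_mem' {a b} ha hb := (commNorm_mul_le ha hb).trans_lt <| ENNReal.add_lt_top.2
    ⟨ENNReal.mul_lt_top enorm_lt_top hb, ENNReal.mul_lt_top ha enorm_lt_top⟩
  add_mem' {a b} ha hb := (commNorm_add_le hD a b).trans_lt (ENNReal.add_lt_top.2 ⟨ha, hb⟩)
  algebraMap_mem' z := by
    rw [Set.mem_ofPred_eq, commNorm_algebraMap]; exact ENNReal.zero_lt_top
  star_mem' {a} ha := (commNorm_star_le hD a).trans_lt ha

lemma diracSeminorm_jordanProd_le (hD : IsSelfAdjoint D) {a b : selfAdjoint A}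
    (ha : diracSeminorm π D a < ⊤) (hb : diracSeminorm π D b < ⊤) :
    diracSeminorm π D (jordanProd a b) ≤
      ‖a‖ₑ * diracSeminorm π D b + diracSeminorm π D a * ‖b‖ₑ := by
  have h : ((jordanProd a b : selfAdjoint A) : A) =
      (1 / 2 : ℂ) • ((a : A) * b) + (1 / 2 : ℂ) • ((b : A) * a) := by
    rw [← smul_add]
    change (1 / 2 : ℝ) • ((a : A) * b + b * a) = _
    rw [← Complex.coe_smul]
    norm_num
  have h2 : ‖(1 / 2 : ℂ)‖ₑ = 2⁻¹ := by
    rw [← ofReal_norm, ← ENNReal.ofReal_ofNat 2, ← ENNReal.ofReal_inv_of_pos two_pos]; norm_num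
  unfold diracSeminorm at *
  rw [h]
  refine (commNorm_add_le hD _ _).trans ?_
  rw [commNorm_smul hD, commNorm_smul hD, h2]
  calc _ ≤ 2⁻¹ * (‖(a : A)‖ₑ * commNorm π D (b : A) + commNorm π D (a : A) * ‖(b : A)‖ₑ) +
        2⁻¹ * (‖(b : A)‖ₑ * commNorm π D (a : A) + commNorm π D (b : A) * ‖(a : A)‖ₑ) :=
        add_le_add (mul_le_mul_right (commNorm_mul_le ha hb) _)
          (mul_le_mul_right (commNorm_mul_le hb ha) _)
    _ = (2⁻¹ + 2⁻¹) *
        (‖(a : A)‖ₑ * commNorm π D (b : A) + commNorm π D (a : A) * ‖(b : A)‖ₑ) := by ring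
    _ = _ := by rw [ENNReal.inv_two_add_inv_two, one_mul]; rfl

lemma diracSeminorm_lieProd_le (hD : IsSelfAdjoint D) {a b : selfAdjoint A}
    (ha : diracSeminorm π D a < ⊤) (hb : diracSeminorm π D b < ⊤) :
    diracSeminorm π D (lieProd a b) ≤
      ‖a‖ₑ * diracSeminorm π D b + diracSeminorm π D a * ‖b‖ₑ := by
  have h : ((lieProd a b : selfAdjoint A) : A) =
      (1 / (2 * Complex.I) : ℂ) • ((a : A) * b) + (-(1 / (2 * Complex.I)) : ℂ) • ((b : A) * a) := by
    rw [neg_smul, ← sub_eq_add_neg, ← smul_sub]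
    rfl
  have h2 : ‖(1 / (2 * Complex.I) : ℂ)‖ₑ = 2⁻¹ := by
    rw [← ofReal_norm, ← ENNReal.ofReal_ofNat 2, ← ENNReal.ofReal_inv_of_pos two_pos]; norm_num
  unfold diracSeminorm at *
  rw [h]
  refine (commNorm_add_le hD _ _).trans ?_
  rw [commNorm_smul hD, commNorm_smul hD, enorm_neg, h2]
  calc _ ≤ 2⁻¹ * (‖(a : A)‖ₑ * commNorm π D (b : A) + commNorm π D (a : A) * ‖(b : A)‖ₑ) +
        2⁻¹ * (‖(b : A)‖ₑ * commNorm π D (a : A) + commNorm π D (b : A) * ‖(a : A)‖ₑ) :=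
        add_le_add (mul_le_mul_right (commNorm_mul_le ha hb) _)
          (mul_le_mul_right (commNorm_mul_le hb ha) _)
    _ = (2⁻¹ + 2⁻¹) *
        (‖(a : A)‖ₑ * commNorm π D (b : A) + commNorm π D (a : A) * ‖(b : A)‖ₑ) := by ring
    _ = _ := by rw [ENNReal.inv_two_add_inv_two, one_mul]; rfl

/-- The real part is a contraction that maps a *-subalgebra to itself and fixes self-adjoint
elements, so it turns approximants into self-adjoint ones. -/
lemma dense_diracSeminorm_lt_top {A₀ : StarSubalgebra ℂ A}
    (hdense : Dense (A₀ : Set A)) (hA₀ : ∀ a ∈ A₀, commNorm π D a < ⊤) :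
    Dense {a : selfAdjoint A | diracSeminorm π D a < ⊤} := by
  rw [Metric.dense_iff]
  intro a ε hε
  obtain ⟨x, hx, hax⟩ := hdense.exists_dist_lt (a : A) hε
  refine ⟨realPart x, ?_, ?_⟩
  · have h1 : a = realPart (a : A) := Subtype.ext a.2.coe_realPart.symm
    rw [Metric.mem_ball, h1, dist_eq_norm, ← map_sub]
    refine (realPart.norm_le _).trans_lt ?_
    rwa [← dist_eq_norm, dist_comm]
  · change commNorm π D ((realPart x : selfAdjoint A) : A) < ⊤
    refine hA₀ _ ?_
    rw [realPart_apply_coe, ← Complex.coe_smul]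
    have hs : star x ∈ A₀ := star_mem (show x ∈ A₀ from hx)
    exact A₀.smul_mem (A₀.add_mem hx hs) _

/-- In weak form the bound is a family of closed conditions on $a$, one for each pair of vectors of
the domain. -/
lemma isClosed_diracSeminorm_le_one (hD : IsSelfAdjoint D) :
    IsClosed ((fun a : selfAdjoint A => (a : A)) '' {a | diracSeminorm π D a ≤ 1}) := by
  have h : (fun a : selfAdjoint A => (a : A)) '' {a | diracSeminorm π D a ≤ 1} =
      {a : A | IsSelfAdjoint a} ∩ ⋂ (ξ : D.domain) (η : D.domain),
        {a | ‖⟪D η, π a (ξ : H)⟫_ℂ - ⟪(η : H), π a (D ξ)⟫_ℂ‖ ≤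
          (1 : ℝ≥0) * ‖(ξ : H)‖ * ‖(η : H)‖} := by
    ext a
    simp only [Set.mem_image, Set.mem_ofPred_eq, Set.mem_inter_iff, Set.mem_iInter,
      ← commNorm_le_iff_inner hD, ENNReal.coe_one]
    exact ⟨by rintro ⟨b, hb, rfl⟩; exact ⟨b.2, hb⟩, fun h => ⟨⟨a, h.1⟩, h.2, rfl⟩⟩
  have hπ : ∀ ξ : H, Continuous fun a => π a ξ := fun ξ => by
    have : Continuous π := AddMonoidHomClass.continuous_of_bound π 1 fun a => by
      rw [one_mul]; exact NonUnitalStarAlgHom.norm_apply_le π a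
    exact this.clm_apply continuous_const
  rw [h]
  refine IsClosed.inter (isClosed_eq continuous_star continuous_id)
    (isClosed_iInter fun ξ => isClosed_iInter fun η => ?_)
  have h1 := hπ (ξ : H)
  have h2 := hπ (D ξ)
  exact isClosed_le (by fun_prop) continuous_const

/-- The seminorm of a spectral triple defines a quantum compact metric space as soon as its kernel
consists of the scalars and its unit ball is approximately finite dimensional, modulo scalars. -/
theorem isQuantumCompactMetricSpace_of_isSpectralTriple (hST : IsSpectralTriple π D)
    (hzero : ∀ a : selfAdjoint A, diracSeminorm π D a = 0 → ∃ r : ℝ, (a : A) = r • (1 : A))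
    (hfin : HasFiniteApproximation (diracSeminorm π D)) :
    IsQuantumCompactMetricSpace (diracSeminorm π D) := by
  have hD := hST.selfAdjoint
  obtain ⟨A₀, hdense, hA₀⟩ := hST.dense_subalgebra
  have hdom := dense_diracSeminorm_lt_top hdense hA₀
  have hsmul : ∀ (r : ℝ) (a : selfAdjoint A),
      diracSeminorm π D (r • a) = ENNReal.ofReal |r| * diracSeminorm π D a := by
    intro r a
    unfold diracSeminorm
    rw [selfAdjoint.val_smul, ← Complex.coe_smul, commNorm_smul hD, ← ofReal_norm,
      Complex.norm_real, Real.norm_eq_abs]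
  refine ⟨fun a b => commNorm_add_le hD _ _, hsmul, hdom, fun a => ⟨hzero a, ?_⟩,
    exists_metricSpace_mkDist hsmul hdom hfin, fun a b ha hb => ?_,
    isClosed_diracSeminorm_le_one hD⟩
  · rintro ⟨r, hr⟩
    unfold diracSeminorm
    rw [hr, ← Complex.coe_smul, ← Algebra.algebraMap_eq_smul_one, commNorm_algebraMap]
  · have h1 := diracSeminorm_jordanProd_le hD ha hb
    have h2 := diracSeminorm_lieProd_le hD ha hb
    have h3 : ‖a‖ₑ * diracSeminorm π D b + diracSeminorm π D a * ‖b‖ₑ < ⊤ :=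
      ENNReal.add_lt_top.2
        ⟨ENNReal.mul_lt_top enorm_lt_top hb, ENNReal.mul_lt_top ha enorm_lt_top⟩
    exact ⟨h1.trans_lt h3, h2.trans_lt h3, max_le h1 h2⟩

end CommutatorNorm

/-! ### Multiplication operators, pointwise operators and amplifications on $\ell^2(G,E)$. -/

section Multiplication

open scoped InnerProductSpace

variable {G E F K : Type*} [NormedAddCommGroup E] [NormedAddCommGroup F] [NormedAddCommGroup K]

lemma L2.norm_sq_eq_tsum (f : L2 G E) : ‖f‖ ^ 2 = ∑' m, ‖f m‖ ^ 2 := by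
  have := lp.norm_rpow_eq_tsum (p := 2) (by norm_num) f
  simpa using this

lemma L2.summable_norm_sq (f : L2 G E) : Summable fun m => ‖f m‖ ^ 2 := by
  have := (lp.memℓp f).summable (by norm_num)
  simpa using this

lemma L2.memℓp_of_summable {f : G → E} (h : Summable fun m => ‖f m‖ ^ 2) : Memℓp f 2 := by
  rw [memℓp_gen_iff (by norm_num)]
  simpa using h

lemma L2.memℓp_of_bound {f : G → E} {g : G → F} {C : ℝ} (hg : Memℓp g 2)
    (h : ∀ m, ‖f m‖ ≤ C * ‖g m‖) : Memℓp f 2 :=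
  (hg.norm.const_mul C).mono fun m => by simpa using h m

lemma L2.norm_le_of_bound (f : L2 G E) (g : L2 G F) {C : ℝ} (hC : 0 ≤ C)
    (e : G ≃ G) (h : ∀ m, ‖f m‖ ≤ C * ‖g (e m)‖) : ‖f‖ ≤ C * ‖g‖ := by
  refine le_of_sq_le_sq ?_ (by positivity)
  rw [mul_pow, L2.norm_sq_eq_tsum, L2.norm_sq_eq_tsum, ← tsum_mul_left]
  have hs := ((e.summable_iff (f := fun m => ‖g m‖ ^ 2)).2 (L2.summable_norm_sq g)).mul_left (C ^ 2)
  rw [← e.tsum_eq (f := fun m => C ^ 2 * ‖g m‖ ^ 2)]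
  refine (L2.summable_norm_sq f).tsum_le_tsum (fun m => ?_) hs
  calc ‖f m‖ ^ 2 ≤ (C * ‖g (e m)‖) ^ 2 := pow_le_pow_left₀ (norm_nonneg _) (h m) 2
    _ = _ := by rw [mul_pow]

variable [InnerProductSpace ℂ E] [InnerProductSpace ℂ F] [InnerProductSpace ℂ K]

open Classical in
/-- The operator of multiplication by a bounded function `w` (and `0` if `w` is not bounded). -/
noncomputable def mulOp (w : G → ℂ) : L2 G E →L[ℂ] L2 G E :=
  if h : ∃ C, ∀ m, ‖w m‖ ≤ C then
    LinearMap.mkContinuous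
      { toFun := fun ξ => ⟨fun m => w m • ξ m, L2.memℓp_of_bound (C := h.choose) (lp.memℓp ξ)
          fun m => by
            rw [norm_smul]
            exact mul_le_mul_of_nonneg_right (h.choose_spec m) (norm_nonneg _)⟩
        map_add' := fun ξ η => by ext m; exact smul_add _ _ _
        map_smul' := fun z ξ => by ext m; exact smul_comm _ _ _ }
      (max h.choose 0) fun ξ => by
        refine L2.norm_le_of_bound _ _ (le_max_right _ _) (Equiv.refl _) fun m => ?_
        change ‖w m • ξ m‖ ≤ _ * ‖ξ m‖
        rw [norm_smul]
        exact mul_le_mul_of_nonneg_right ((h.choose_spec m).trans (le_max_left _ _))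
          (norm_nonneg _)
  else 0

lemma mulOp_apply {w : G → ℂ} (h : ∃ C, ∀ m, ‖w m‖ ≤ C) (ξ : L2 G E) (m : G) :
    mulOp w ξ m = w m • ξ m := by
  rw [mulOp, dif_pos h]; rfl

lemma norm_mulOp_le {w : G → ℂ} {C : ℝ} (hC : 0 ≤ C) (h : ∀ m, ‖w m‖ ≤ C) :
    ‖(mulOp w : L2 G E →L[ℂ] L2 G E)‖ ≤ C :=
  ContinuousLinearMap.opNorm_le_bound _ hC fun ξ =>
    L2.norm_le_of_bound _ _ hC (Equiv.refl _) fun m => by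
      rw [mulOp_apply ⟨C, h⟩, norm_smul]
      exact mul_le_mul_of_nonneg_right (h m) (norm_nonneg _)

lemma mulOp_mul {w w' : G → ℂ} (h : ∃ C, ∀ m, ‖w m‖ ≤ C) (h' : ∃ C, ∀ m, ‖w' m‖ ≤ C) :
    (mulOp w * mulOp w' : L2 G E →L[ℂ] L2 G E) = mulOp (fun m => w m * w' m) := by
  have h2 : ∃ C, ∀ m, ‖w m * w' m‖ ≤ C := by
    obtain ⟨C, hC⟩ := h
    obtain ⟨C', hC'⟩ := h'
    refine ⟨C * C', fun m => ?_⟩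
    rw [norm_mul]
    exact mul_le_mul (hC m) (hC' m) (norm_nonneg _) ((norm_nonneg _).trans (hC m))
  ext ξ m
  rw [mul_apply_eq_comp, mulOp_apply h, mulOp_apply h', mulOp_apply h2, mul_smul]

lemma mulOp_comm {w w' : G → ℂ} (h : ∃ C, ∀ m, ‖w m‖ ≤ C) (h' : ∃ C, ∀ m, ‖w' m‖ ≤ C) :
    Commute (mulOp w : L2 G E →L[ℂ] L2 G E) (mulOp w') := by
  rw [Commute, SemiconjBy, mulOp_mul h h', mulOp_mul h' h]
  simp_rw [mul_comm]

lemma star_mulOp [CompleteSpace E] {w : G → ℂ} (h : ∃ C, ∀ m, ‖w m‖ ≤ C) :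
    star (mulOp w : L2 G E →L[ℂ] L2 G E) = mulOp fun m => conj (w m) := by
  have h' : ∃ C, ∀ m, ‖conj (w m)‖ ≤ C := by simpa using h
  rw [ContinuousLinearMap.star_eq_adjoint]
  symm
  rw [ContinuousLinearMap.eq_adjoint_iff]
  intro x y
  simp only [lp.inner_eq_tsum, mulOp_apply h, mulOp_apply h', inner_smul_left, inner_smul_right,
    RingHomCompTriple.comp_apply, RingHom.id_apply]

lemma weightedPerm_apply (e : G ≃ G) (c : G → Circle) (ξ : L2 G E) (m : G) :
    weightedPerm e c ξ m = (c m : ℂ) • ξ (e m) := rfl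

/-- The commutator is again a permutation with weights, namely $(w(m)-w(e(m)))c(m)$; only the
oscillation of $w$ along $e$ matters. -/
lemma norm_mulOp_commutator_weightedPerm_le {w : G → ℂ} (h : ∃ C, ∀ m, ‖w m‖ ≤ C) (e : G ≃ G)
    (c : G → Circle) {δ : ℝ} (hδ : 0 ≤ δ) (hw : ∀ m, ‖w m - w (e m)‖ ≤ δ) :
    ‖(mulOp w * weightedPerm e c - weightedPerm e c * mulOp w : L2 G E →L[ℂ] L2 G E)‖ ≤ δ :=
  ContinuousLinearMap.opNorm_le_bound _ hδ fun ξ =>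
    L2.norm_le_of_bound _ _ hδ e fun m => by
      have : (mulOp w * weightedPerm e c - weightedPerm e c * mulOp w : L2 G E →L[ℂ] L2 G E) ξ m =
          ((w m - w (e m)) * c m) • ξ (e m) := by
        change mulOp w (weightedPerm e c ξ) m - weightedPerm e c (mulOp w ξ) m = _
        rw [mulOp_apply h, weightedPerm_apply, weightedPerm_apply, mulOp_apply h, smul_smul,
          smul_smul, ← sub_smul]
        congr 1; ring
      rw [this, norm_smul, norm_mul, Circle.norm_coe, mul_one]
      exact mul_le_mul_of_nonneg_right (hw m) (norm_nonneg _)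

/-- Multiplication by a function vanishing at infinity is a compact operator, if `E` is finite
dimensional. -/
lemma isCompactOperator_mulOp [FiniteDimensional ℂ E] {w : G → ℂ}
    (hw : Tendsto w cofinite (𝓝 0)) : IsCompactOperator (mulOp w : L2 G E →L[ℂ] L2 G E) := by
  classical
  have hproper : ProperSpace E := FiniteDimensional.proper ℂ E
  -- Truncations to finite sets are compact since $E$ is finite dimensional; they converge in norm
  -- because $w$ is small outside a finite set.
  have hcomp : ∀ s : Finset G, IsCompactOperator
      (∑ m ∈ s, w m • (lp.singleContinuousLinearMap ℂ (fun _ : G => E) 2 m).comp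
        (lp.evalCLM ℂ (fun _ : G => E) 2 m) : L2 G E →L[ℂ] L2 G E) := by
    intro s
    refine (compactOperator (RingHom.id ℂ) (L2 G E) (L2 G E)).sum_mem fun m _ => ?_
    have h1 : IsCompactOperator (lp.evalCLM ℂ (fun _ : G => E) 2 m) :=
      isCompactOperator_of_locallyCompactSpace_dom (lp.evalCLM ℂ (fun _ : G => E) 2 m)
    exact (h1.clm_comp (lp.singleContinuousLinearMap ℂ (fun _ : G => E) 2 m)).smul (w m)
  have hb : ∃ C, ∀ m, ‖w m‖ ≤ C := by
    have h1 : {m | ¬ ‖w m‖ < 1}.Finite := by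
      have := hw.norm.eventually (gt_mem_nhds (show ‖(0 : ℂ)‖ < 1 by simp))
      exact this
    obtain ⟨C, hC⟩ := (h1.image fun m => ‖w m‖).bddAbove
    refine ⟨max C 1, fun m => ?_⟩
    by_cases hm : ‖w m‖ < 1
    · exact hm.le.trans (le_max_right _ _)
    · exact (hC ⟨m, hm, rfl⟩).trans (le_max_left _ _)
  refine isCompactOperator_of_tendsto (l := atTop) ?_ (Eventually.of_forall hcomp)
  rw [tendsto_iff_norm_sub_tendsto_zero, Metric.tendsto_atTop]
  intro ε hε
  have h1 : {m | ¬ ‖w m‖ < ε / 2}.Finite := by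
    have := hw.norm.eventually (gt_mem_nhds (show ‖(0 : ℂ)‖ < ε / 2 by simpa using hε))
    exact this
  refine ⟨h1.toFinset, fun s hs => ?_⟩
  rw [dist_zero_right, norm_norm]
  refine lt_of_le_of_lt (ContinuousLinearMap.opNorm_le_bound _ (half_pos hε).le fun ξ =>
    L2.norm_le_of_bound _ _ (half_pos hε).le (Equiv.refl _) fun m => ?_) (half_lt_self hε)
  have h2 : ((∑ m ∈ s, w m • (lp.singleContinuousLinearMap ℂ (fun _ : G => E) 2 m).comp
        (lp.evalCLM ℂ (fun _ : G => E) 2 m) - mulOp w : L2 G E →L[ℂ] L2 G E) ξ) m =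
      (if m ∈ s then w m • ξ m else 0) - w m • ξ m := by
    rw [sub_apply, lp.coeFn_sub, Pi.sub_apply, mulOp_apply hb, sum_apply,
      lp.coeFn_sum, Finset.sum_apply]
    congr 1
    have : ∀ x ∈ s, ((w x • (lp.singleContinuousLinearMap ℂ (fun _ : G => E) 2 x).comp
        (lp.evalCLM ℂ (fun _ : G => E) 2 x)) ξ) m = if m = x then w m • ξ m else 0 := by
      intro x _
      change w x • (lp.single 2 x (ξ x) : L2 G E) m = _
      rw [lp.single_apply, Pi.single_apply]
      split_ifs with h
      · rw [h]
      · rw [smul_zero]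
    rw [Finset.sum_congr rfl this, Finset.sum_ite_eq]
  rw [h2]
  split_ifs with hm
  · rw [sub_self, norm_zero]; positivity
  · have : ‖w m‖ < ε / 2 := by
      by_contra h
      exact hm (hs (h1.mem_toFinset.2 h))
    rw [zero_sub, norm_neg, norm_smul]
    exact mul_le_mul_of_nonneg_right this.le (norm_nonneg _)

lemma lpMap_mul (s t : E →L[ℂ] E) : (lpMap (s * t) : L2 G E →L[ℂ] L2 G E) = lpMap s * lpMap t :=
  rfl

lemma lpMap_tensorVec (t : E →L[ℂ] E) (v : E) (ξ : L2 G ℂ) :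
    lpMap t (tensorVec v ξ) = tensorVec (t v) ξ := by
  ext m
  simp [tensorVec]

lemma norm_lpMap_le (T : E →L[ℂ] F) : ‖(lpMap T : L2 G E →L[ℂ] L2 G F)‖ ≤ ‖T‖ :=
  ContinuousLinearMap.opNorm_le_bound _ (norm_nonneg _) fun _ =>
    L2.norm_le_of_bound _ _ (norm_nonneg _) (Equiv.refl _) fun _ => T.le_opNorm _

lemma mulOp_lpMap {w : G → ℂ} (h : ∃ C, ∀ m, ‖w m‖ ≤ C) (T : E →L[ℂ] F) (ξ : L2 G E) :
    mulOp w (lpMap T ξ) = lpMap T (mulOp w ξ) := by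
  ext m
  rw [mulOp_apply h, lpMap_apply, lpMap_apply, mulOp_apply h, map_smul]

variable [FiniteDimensional ℂ E] [CompleteSpace E]

lemma amp_apply (a : L2 G ℂ →L[ℂ] L2 G ℂ) (ξ : L2 G E) :
    amp G E a ξ = ∑ i, tensorVec (stdOrthonormalBasis ℂ E i) (a (coord G E i ξ)) := by
  change ampFun a ξ = _
  rw [ampFun, sum_apply]
  rfl

lemma coord_amp (a : L2 G ℂ →L[ℂ] L2 G ℂ) (i) (ξ : L2 G E) :
    coord G E i (amp G E a ξ) = a (coord G E i ξ) := coord_ampFun a i ξ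

lemma coord_tensorVec' (i) (v : E) (ξ : L2 G ℂ) :
    coord G E i (tensorVec v ξ) = ⟪stdOrthonormalBasis ℂ E i, v⟫_ℂ • ξ := by
  ext m
  simp [coord, tensorVec, mul_comm]

lemma amp_tensorVec (a : L2 G ℂ →L[ℂ] L2 G ℂ) (v : E) (ξ : L2 G ℂ) :
    amp G E a (tensorVec v ξ) = tensorVec v (a ξ) :=
  ext_coord fun i => by rw [coord_amp, coord_tensorVec', coord_tensorVec', map_smul]

lemma commute_amp_lpMap (a : L2 G ℂ →L[ℂ] L2 G ℂ) (t : E →L[ℂ] E) :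
    Commute (amp G E a) (lpMap t) := by
  ext1 ξ
  change amp G E a (lpMap t ξ) = lpMap t (amp G E a ξ)
  conv_lhs => rw [← sum_tensorVec_coord ξ]
  simp only [map_sum, lpMap_tensorVec, amp_tensorVec, amp_apply a ξ]

lemma amp_weightedPerm (e : G ≃ G) (c : G → Circle) :
    amp G E (weightedPerm e c) = weightedPerm e c := by
  ext1 ξ
  refine ext_coord fun i => ?_
  rw [coord_amp]
  ext m
  simp [coord, weightedPerm_apply]

lemma amp_mulOp {w : G → ℂ} (h : ∃ C, ∀ m, ‖w m‖ ≤ C) : amp G E (mulOp w) = mulOp w := by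
  ext1 ξ
  refine ext_coord fun i => ?_
  rw [coord_amp, coord, mulOp_lpMap h]

lemma star_lpMap (t : E →L[ℂ] E) : star (lpMap t : L2 G E →L[ℂ] L2 G E) = lpMap (star t) :=
  adjoint_lpMap t

end Multiplication

/-! ### Self-adjointness and compact resolvent from a compact operator onto the domain. -/

section SelfAdjointness

open scoped InnerProductSpace

variable {H : Type*} [NormedAddCommGroup H] [InnerProductSpace ℂ H] [CompleteSpace H]
  {D : H →ₗ.[ℂ] H}

/-- A symmetric operator `D` such that `D - i l` and `D + i l` are surjective is self-adjoint. -/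
lemma isSelfAdjoint_of_symmetric_of_surjective (hdense : Dense (D.domain : Set H))
    (hsymm : ∀ ξ η : D.domain, ⟪D ξ, (η : H)⟫_ℂ = ⟪(ξ : H), D η⟫_ℂ) (l : ℝ)
    (hsub : ∀ ζ : H, ∃ ξ : D.domain, D ξ - (Complex.I * l) • (ξ : H) = ζ)
    (hadd : ∀ ζ : H, ∃ ξ : D.domain, D ξ + (Complex.I * l) • (ξ : H) = ζ) :
    IsSelfAdjoint D := by
  have hle : D ≤ D.adjoint := LinearPMap.IsFormalAdjoint.le_adjoint hdense hsymm
  rw [LinearPMap.isSelfAdjoint_def]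
  refine (LinearPMap.eq_of_le_of_domain_eq hle (le_antisymm hle.1 fun η hη => ?_)).symm
  obtain ⟨ξ, hξ⟩ := hsub (D.adjoint ⟨η, hη⟩ - (Complex.I * l) • η)
  suffices h : η - ξ = 0 by rw [sub_eq_zero.1 h]; exact ξ.2
  -- With $\xi$ solving $(D-il)\xi=(D^*-il)\eta$, the difference $\eta-\xi$ is orthogonal to the
  -- range of $D+il$, which is the whole space.
  have h1 : ∀ ζ : D.domain, ⟪η - ξ, D ζ + (Complex.I * l) • (ζ : H)⟫_ℂ = 0 := by
    intro ζ
    have h2 : ⟪η, D ζ⟫_ℂ = ⟪D.adjoint ⟨η, hη⟩, (ζ : H)⟫_ℂ :=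
      (LinearPMap.adjoint_isFormalAdjoint hdense ⟨η, hη⟩ ζ).symm
    have h3 := hsymm ξ ζ
    have h4 : D ξ - D.adjoint ⟨η, hη⟩ = (Complex.I * l) • ((ξ : H) - η) := by
      rw [smul_sub, sub_eq_sub_iff_add_eq_add]
      rw [sub_eq_sub_iff_add_eq_add] at hξ
      rw [hξ, add_comm]
    have h5 : ⟪D ξ, (ζ : H)⟫_ℂ - ⟪D.adjoint ⟨η, hη⟩, (ζ : H)⟫_ℂ =
        -(Complex.I * l) * ⟪(ξ : H) - η, (ζ : H)⟫_ℂ := by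
      rw [← inner_sub_left, h4, inner_smul_left, map_mul, Complex.conj_I, Complex.conj_ofReal,
        neg_mul]
    rw [inner_add_right, inner_smul_right, inner_sub_left, inner_sub_left, h2, ← h3]
    rw [inner_sub_left] at h5
    linear_combination -h5
  obtain ⟨ζ, hζ⟩ := hadd (η - ξ)
  have := h1 ζ
  rwa [hζ, inner_self_eq_zero] at this

/-- If the domain of a symmetric operator `D` is the range of a compact operator `r` such that
`(D - i l) r` and `(D + i l) r` are invertible, then `D` is self-adjoint, with a compact
resolvent. -/
theorem isSelfAdjoint_and_hasCompactResolvent (hdense : Dense (D.domain : Set H))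
    (hsymm : ∀ ξ η : D.domain, ⟪D ξ, (η : H)⟫_ℂ = ⟪(ξ : H), D η⟫_ℂ) (l : ℝ)
    {r K K' : H →L[ℂ] H} (hr : IsCompactOperator r) (hmem : ∀ x, r x ∈ D.domain)
    (hsurj : ∀ ξ ∈ D.domain, ∃ x, r x = ξ)
    (hK : ∀ x, D ⟨r x, hmem x⟩ - (Complex.I * l) • r x = K x)
    (hK' : ∀ x, D ⟨r x, hmem x⟩ + (Complex.I * l) • r x = K' x)
    (hu : IsUnit K) (hu' : IsUnit K') : IsSelfAdjoint D ∧ HasCompactResolvent D := by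
  obtain ⟨u, rfl⟩ := hu
  obtain ⟨u', rfl⟩ := hu'
  have h1 : ∀ x : H, (u : H →L[ℂ] H) ((↑u⁻¹ : H →L[ℂ] H) x) = x := fun x => by
    rw [← mul_apply_eq_comp, u.mul_inv]; rfl
  have h1' : ∀ x : H, (u' : H →L[ℂ] H) ((↑u'⁻¹ : H →L[ℂ] H) x) = x := fun x => by
    rw [← mul_apply_eq_comp, u'.mul_inv]; rfl
  have h2 : ∀ x : H, (↑u⁻¹ : H →L[ℂ] H) ((u : H →L[ℂ] H) x) = x := fun x => by
    rw [← mul_apply_eq_comp, u.inv_mul]; rfl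
  refine ⟨isSelfAdjoint_of_symmetric_of_surjective hdense hsymm l
    (fun ζ => ⟨⟨_, hmem ((↑u⁻¹ : H →L[ℂ] H) ζ)⟩, by rw [hK, h1]⟩)
    (fun ζ => ⟨⟨_, hmem ((↑u'⁻¹ : H →L[ℂ] H) ζ)⟩, by rw [hK', h1']⟩),
    Complex.I * l, r.comp (↑u⁻¹ : H →L[ℂ] H), hr.comp_clm _,
    fun ξ => ⟨hmem _, (hK _).trans (h1 ξ)⟩, fun ξ => ?_⟩
  obtain ⟨x, hx⟩ := hsurj ξ ξ.2
  have h3 : ξ = ⟨r x, hmem x⟩ := Subtype.ext hx.symm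
  rw [h3]
  change r ((↑u⁻¹ : H →L[ℂ] H) (D ⟨r x, hmem x⟩ - (Complex.I * l) • r x)) = r x
  rw [hK, h2]

end SelfAdjointness

/-! ### The approximate inverse built from anticommuting coefficients. -/

section Parametrix

variable {R : Type*} [NormedRing R] {ι : Type*} [Fintype ι]

lemma tendsto_mul_zero_of_norm_le {u v : ℝ → R} {C : ℝ} {l : Filter ℝ} (hu : ∀ x, ‖u x‖ ≤ C)
    (hv : Tendsto v l (𝓝 0)) : Tendsto (fun x => u x * v x) l (𝓝 0) := by
  refine squeeze_zero_norm (a := fun x => C * ‖v x‖) (fun x => (norm_mul_le _ _).trans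
    (mul_le_mul_of_nonneg_right (hu x) (norm_nonneg _))) ?_
  simpa using hv.norm.const_mul C

lemma tendsto_zero_mul_of_norm_le {u v : ℝ → R} {C : ℝ} {l : Filter ℝ} (hu : ∀ x, ‖u x‖ ≤ C)
    (hv : Tendsto v l (𝓝 0)) : Tendsto (fun x => v x * u x) l (𝓝 0) := by
  refine squeeze_zero_norm (a := fun x => ‖v x‖ * C) (fun x => (norm_mul_le _ _).trans
    (mul_le_mul_of_nonneg_left (hu x) (norm_nonneg _))) ?_
  simpa using hv.norm.mul_const C

variable [NormedAlgebra ℂ R]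

/-- Adding the sum to its transpose kills the off-diagonal terms and doubles the diagonal ones. -/
lemma sum_sum_eq_sum_of_anticomm {M : Type*} [AddCommGroup M] [Module ℂ M] (f : ι → ι → M)
    (h : ∀ i s, i ≠ s → f i s + f s i = 0) : ∑ i, ∑ s, f i s = ∑ i, f i i := by
  classical
  have h1 : (2 : ℂ) • ∑ i, ∑ s, f i s = (2 : ℂ) • ∑ i, f i i := by
    calc (2 : ℂ) • ∑ i, ∑ s, f i s = ∑ i, ∑ s, (f i s + f s i) := by
          rw [two_smul]
          simp_rw [Finset.sum_add_distrib]
          rw [Finset.sum_comm (f := fun i s => f s i)]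
      _ = ∑ i, ∑ s, if i = s then (2 : ℂ) • f i i else 0 := by
          refine Finset.sum_congr rfl fun i _ => Finset.sum_congr rfl fun s _ => ?_
          split_ifs with his
          · rw [his, two_smul]
          · exact h i s his
      _ = _ := by simp [Finset.smul_sum]
  exact smul_right_injective M (two_ne_zero' ℂ) h1

/-- The key computation with anticommuting symbols: modulo terms that tend to `0`, the product of
`i ∑ T_j b_j - i c + S` and of `i ∑ T_j b_j + i c + S` is `1`. -/
lemma tendsto_parametrix_mul {T : ι → R} {b : ι → ℝ → R} {c S : ℝ → R} {l : Filter ℝ} {C : ℝ}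
    (hT : ∀ i s, i ≠ s → T i * T s + T s * T i = 0)
    (hbb : ∀ i s x, Commute (b i x) (b s x))
    (hsum : ∀ᶠ x in l, -(∑ i, T i * T i * (b i x * b i x)) + c x * c x = 1)
    (hbC : ∀ i x, ‖b i x‖ ≤ C) (hcC : ∀ x, ‖c x‖ ≤ C)
    (hbc : ∀ i x, Commute (b i x) (c x))
    (hbT : ∀ i s, Tendsto (fun x => b i x * T s - T s * b i x) l (𝓝 0))
    (hcT : ∀ s, Tendsto (fun x => c x * T s - T s * c x) l (𝓝 0))
    (hS : Tendsto S l (𝓝 0)) (hSC : ∀ x, ‖S x‖ ≤ C) :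
    Tendsto (fun x => (Complex.I • ∑ i, T i * b i x - Complex.I • c x + S x) *
      (Complex.I • ∑ i, T i * b i x + Complex.I • c x + S x)) l (𝓝 1) := by
  set P : ℝ → R := fun x => ∑ i, T i * b i x with hP
  have hPC : ∀ x, ‖P x‖ ≤ ∑ i, ‖T i‖ * C := fun x => (norm_sum_le _ _).trans <|
    Finset.sum_le_sum fun i _ => (norm_mul_le _ _).trans
      (mul_le_mul_of_nonneg_left (hbC i x) (norm_nonneg _))
  have hE1 : Tendsto (fun x => ∑ i, ∑ s, T i * ((b i x * T s - T s * b i x) * b s x)) l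
      (𝓝 0) := by
    have h0 : (0 : R) = ∑ i : ι, ∑ s : ι, 0 := by simp
    rw [h0]
    refine tendsto_finsetSum _ fun i _ => tendsto_finsetSum _ fun s _ => ?_
    exact tendsto_mul_zero_of_norm_le (u := fun _ => T i) (fun _ => le_rfl)
      (tendsto_zero_mul_of_norm_le (hbC s) (hbT i s))
  have hE2 : Tendsto (fun x => ∑ s, (c x * T s - T s * c x) * b s x) l (𝓝 0) := by
    have h0 : (0 : R) = ∑ s : ι, 0 := by simp
    rw [h0]
    exact tendsto_finsetSum _ fun s _ => tendsto_zero_mul_of_norm_le (hbC s) (hcT s)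
  have hE3 : Tendsto (fun x => (Complex.I • P x - Complex.I • c x + S x) * S x) l (𝓝 0) := by
    refine tendsto_mul_zero_of_norm_le (C := (∑ i, ‖T i‖ * C) + C + C) (fun x => ?_) hS
    refine (norm_add_le _ _).trans (add_le_add ((norm_sub_le _ _).trans (add_le_add ?_ ?_))
      (hSC x))
    · rw [norm_smul, Complex.norm_I, one_mul]; exact hPC x
    · rw [norm_smul, Complex.norm_I, one_mul]; exact hcC x
  have hE4 : Tendsto (fun x => S x * (Complex.I • P x + Complex.I • c x)) l (𝓝 0) := by
    refine tendsto_zero_mul_of_norm_le (C := (∑ i, ‖T i‖ * C) + C) (fun x => ?_) hS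
    refine (norm_add_le _ _).trans (add_le_add ?_ ?_)
    · rw [norm_smul, Complex.norm_I, one_mul]; exact hPC x
    · rw [norm_smul, Complex.norm_I, one_mul]; exact hcC x
  -- Moving the symbols to the right of the coefficients costs commutators that tend to 0;
  -- afterwards the mixed terms cancel by anticommutation.
  have hPP : ∀ x, P x * P x = ∑ i, T i * T i * (b i x * b i x) +
      ∑ i, ∑ s, T i * ((b i x * T s - T s * b i x) * b s x) := by
    intro x
    rw [← sum_sum_eq_sum_of_anticomm (fun i s => T i * T s * (b i x * b s x)), hP,
      Finset.sum_mul_sum, ← Finset.sum_add_distrib]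
    · refine Finset.sum_congr rfl fun i _ => ?_
      rw [← Finset.sum_add_distrib]
      refine Finset.sum_congr rfl fun s _ => ?_
      noncomm_ring
    · intro i s his
      rw [(hbb s i x).eq, ← add_mul, hT i s his, zero_mul]
  have hPc : ∀ x, c x * P x = P x * c x + ∑ s, (c x * T s - T s * c x) * b s x := by
    intro x
    rw [hP, Finset.mul_sum, Finset.sum_mul, ← Finset.sum_add_distrib]
    refine Finset.sum_congr rfl fun s _ => ?_
    rw [mul_assoc (T s), (hbc s x).eq]
    noncomm_ring
  have hlim := (((hE2.sub hE1).add hE3).add hE4).const_add (1 : R)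
  simp only [sub_zero, add_zero] at hlim
  refine hlim.congr' ?_
  filter_upwards [hsum] with x hx
  have hI : ∀ u v : R, (Complex.I • u) * (Complex.I • v) = -(u * v) := fun u v => by
    rw [smul_mul_smul_comm, Complex.I_mul_I, neg_one_smul]
  -- The product is $-P^2+c^2+[c,P]$; by `hsum` its main part is exactly 1, and everything else is a
  -- commutator.
  have h1 : (Complex.I • P x - Complex.I • c x) * (Complex.I • P x + Complex.I • c x) =
      1 + (∑ s, (c x * T s - T s * c x) * b s x -
        ∑ i, ∑ s, T i * ((b i x * T s - T s * b i x) * b s x)) := by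
    rw [mul_add, sub_mul, sub_mul, hI, hI, hI, hI, hPP, hPc, ← hx]
    abel
  have h2 : ∀ u v w : R, (u - v + w) * (u + v + w) =
      (u - v) * (u + v) + (u - v + w) * w + w * (u + v) := fun u v w => by noncomm_ring
  rw [h2, h1]
  abel

end Parametrix

/-! ### The unitaries $W^m$, right multiplications, and real and imaginary parts of the generators.
-/

section WeightedPerm

variable {G E : Type*} [NormedAddCommGroup E] [InnerProductSpace ℂ E]

lemma star_weightedPerm [CompleteSpace E] (e : G ≃ G) (c : G → Circle) :
    star (weightedPerm e c : L2 G E →L[ℂ] L2 G E) =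
      weightedPerm e.symm (fun m => (c (e.symm m))⁻¹) := by
  rw [ContinuousLinearMap.star_eq_adjoint]
  symm
  rw [ContinuousLinearMap.eq_adjoint_iff]
  intro x y
  rw [lp.inner_eq_tsum, lp.inner_eq_tsum, ← e.tsum_eq]
  refine tsum_congr fun m => ?_
  rw [weightedPerm_apply, weightedPerm_apply, e.symm_apply_apply, inner_smul_left,
    inner_smul_right, Circle.coe_inv_eq_conj, Complex.conj_conj]

end WeightedPerm

namespace IsNormalizedCocycle

variable {G : Type*} [AddCommGroup G] {σ : G → G → Circle} (h : IsNormalizedCocycle σ)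
include h

lemma mul_add_neg (x y : G) : σ x y * σ (x + y) (-y) = 1 := by
  rw [h.cocycle, add_neg_cancel, h.zero_right, h.neg_right, one_mul]

lemma mul_neg_add (x y : G) : σ (-x) (x + y) * σ x y = 1 := by
  rw [← h.cocycle, neg_add_cancel, h.zero_left, mul_one]
  simpa using h.neg_right (-x)

lemma mul_neg_neg (x y : G) : σ x y * σ (-y) (-x) = 1 := by
  have h1 := h.cocycle (x + y) (-y) (-x)
  rw [add_neg_cancel_right, h.neg_right, mul_one, ← neg_add_rev, h.neg_right, one_mul] at h1
  rw [← h1, h.mul_add_neg]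

end IsNormalizedCocycle

namespace Xi

variable {d : ℕ} (p : Xi d)

lemma W_apply (m : p.G) (ξ : p.Hilb) (n : p.G) :
    p.W m ξ n = (p.σ m (n - m) : ℂ) * ξ (n - m) := rfl

lemma W_mul (m n : p.G) : p.W m * p.W n = (p.σ m n : ℂ) • p.W (m + n) := by
  ext ξ x
  change p.W m (p.W n ξ) x = (p.σ m n : ℂ) * p.W (m + n) ξ x
  rw [W_apply, W_apply, W_apply, ← mul_assoc, ← mul_assoc, ← Circle.coe_mul, ← Circle.coe_mul,
    sub_sub, p.isCocycle.cocycle]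
  congr 4
  abel

lemma W_zero : p.W 0 = 1 := by
  ext ξ x
  rw [W_apply, p.isCocycle.zero_left, sub_zero, Circle.coe_one, one_mul]
  rfl

lemma star_W (m : p.G) : star (p.W m) = p.W (-m) := by
  rw [W, star_weightedPerm]
  ext ξ n
  rw [weightedPerm_apply, W_apply, Equiv.subRight_symm_apply, add_sub_cancel_right, smul_eq_mul,
    sub_neg_eq_add]
  congr 2
  refine inv_eq_of_mul_eq_one_right (G := Circle) ?_
  rw [mul_comm, add_comm, p.isCocycle.mul_neg_add]

lemma W_mul_W_neg (m : p.G) : p.W m * p.W (-m) = 1 := by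
  rw [W_mul, p.isCocycle.neg_right, add_neg_cancel, W_zero, Circle.coe_one, one_smul]

lemma W_neg_mul_W (m : p.G) : p.W (-m) * p.W m = 1 := by
  simpa using p.W_mul_W_neg (-m)

/-- Multiplication on the right by `W^m`. -/
noncomputable def rightW (m : p.G) : p.Hilb →L[ℂ] p.Hilb :=
  weightedPerm (Equiv.subRight m) fun n => p.σ (n - m) m

lemma rightW_apply (m : p.G) (ξ : p.Hilb) (n : p.G) :
    p.rightW m ξ n = (p.σ (n - m) m : ℂ) * ξ (n - m) := rfl

/-- Conjugating $W^{-m}$ by $J$ produces the weight $\overline{\sigma(-m,m-n)}$, which equals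
$\sigma(n-m,m)$ for a normalized cocycle by `IsNormalizedCocycle.mul_neg_neg`. -/
lemma rightMul_W (m : p.G) : p.rightMul (p.W m) = p.rightW m := by
  ext ξ n
  rw [rightMul, star_W, rightW_apply]
  change conj (p.W (-m) (conjJ ξ) (-n)) = _
  rw [W_apply, map_mul]
  change _ * conj (conj (ξ (-(-n - -m)))) = _
  rw [Complex.conj_conj, ← Circle.coe_inv_eq_conj]
  have h : -n - -m = -(n - m) := by abel
  rw [h, neg_neg]
  congr 2
  refine inv_eq_of_mul_eq_one_right (G := Circle) ?_
  rw [mul_comm, p.isCocycle.mul_neg_neg]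

lemma star_rightW (m : p.G) : star (p.rightW m) = p.rightW (-m) := by
  rw [rightW, star_weightedPerm]
  ext ξ n
  rw [weightedPerm_apply, rightW_apply, Equiv.subRight_symm_apply, add_sub_cancel_right,
    smul_eq_mul, sub_neg_eq_add]
  congr 2
  refine inv_eq_of_mul_eq_one_right (G := Circle) ?_
  rw [p.isCocycle.mul_add_neg]

/-- Left and right twisted translations commute by the cocycle identity, which is the associativity
of the twisted product. -/
lemma commute_rightW_W (m n : p.G) : Commute (p.rightW m) (p.W n) := by
  ext ξ x
  change p.rightW m (p.W n ξ) x = p.W n (p.rightW m ξ) x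
  rw [rightW_apply, W_apply, W_apply, rightW_apply, ← mul_assoc, ← mul_assoc, ← Circle.coe_mul,
    ← Circle.coe_mul, sub_right_comm]
  congr 2
  have h := p.isCocycle.cocycle n (x - n - m) m
  rw [sub_add_cancel, mul_comm, add_comm n, sub_right_comm, sub_add_cancel] at h
  rw [sub_right_comm x m n] at h
  exact h

lemma rightMul_add (a b : p.Hilb →L[ℂ] p.Hilb) :
    p.rightMul (a + b) = p.rightMul a + p.rightMul b := by
  ext ξ n
  simp only [rightMul, star_add]
  change conjJ ((star a + star b) (conjJ ξ)) n = _
  rw [add_apply, map_add]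
  rfl

lemma rightMul_smul (z : ℂ) (a : p.Hilb →L[ℂ] p.Hilb) : p.rightMul (z • a) = z • p.rightMul a := by
  ext ξ n
  simp only [rightMul, star_smul]
  change conjJ ((star z • star a) (conjJ ξ)) n = _
  rw [smul_apply, map_smulₛₗ]
  simp

lemma rePart_U (j : Fin d) : rePart (p.U j) =
    (1 / 2 : ℂ) • p.W (Pi.single j 1) + (1 / 2 : ℂ) • p.W (-Pi.single j 1) := by
  rw [rePart, U, star_W, smul_add]

lemma imPart_U (j : Fin d) : imPart (p.U j) =
    (1 / (2 * Complex.I) : ℂ) • p.W (Pi.single j 1) +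
      (-(1 / (2 * Complex.I)) : ℂ) • p.W (-Pi.single j 1) := by
  rw [imPart, U, star_W, smul_sub, neg_smul, sub_eq_add_neg]

lemma U_mul_star (j : Fin d) : p.U j * star (p.U j) = 1 := by rw [U, star_W, W_mul_W_neg]

lemma star_mul_U (j : Fin d) : star (p.U j) * p.U j = 1 := by rw [U, star_W, W_neg_mul_W]

lemma commute_star_U {T : p.Hilb →L[ℂ] p.Hilb} {j : Fin d} (h : Commute T (p.U j)) :
    Commute T (star (p.U j)) := by
  have h1 := h.eq
  calc T * star (p.U j) = star (p.U j) * (p.U j * T) * star (p.U j) := by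
        rw [← mul_assoc (star (p.U j)), star_mul_U, one_mul]
    _ = star (p.U j) * T := by rw [← h1, mul_assoc, mul_assoc, U_mul_star, mul_one]

lemma commute_rePart_U {T : p.Hilb →L[ℂ] p.Hilb} {j : Fin d} (h : Commute T (p.U j)) :
    Commute T (rePart (p.U j)) :=
  (h.add_right (p.commute_star_U h)).smul_right _

lemma commute_imPart_U {T : p.Hilb →L[ℂ] p.Hilb} {j : Fin d} (h : Commute T (p.U j)) :
    Commute T (imPart (p.U j)) :=
  (h.sub_right (p.commute_star_U h)).smul_right _

lemma rePart_sq_add_imPart_sq_U (j : Fin d) :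
    rePart (p.U j) * rePart (p.U j) + imPart (p.U j) * imPart (p.U j) = 1 := by
  have h1 := p.U_mul_star j
  have h2 := p.star_mul_U j
  have h3 : (1 / (2 * Complex.I) : ℂ) * (1 / (2 * Complex.I)) = -(1 / 4) := by
    field_simp
    rw [Complex.I_sq]
    norm_num
  have h4 : (1 / 2 : ℂ) * (1 / 2) = 1 / 4 := by norm_num
  rw [rePart, imPart, smul_mul_smul_comm, smul_mul_smul_comm, h3, h4, neg_smul,
    ← sub_eq_add_neg, ← smul_sub]
  -- The difference of squares is $2(UU^*+U^*U)$, so the four units on the right are written as two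
  -- copies of each product.
  have h5 : (p.U j + star (p.U j)) * (p.U j + star (p.U j)) -
      (p.U j - star (p.U j)) * (p.U j - star (p.U j)) = (4 : ℂ) • 1 := by
    have : (4 : ℂ) • (1 : p.Hilb →L[ℂ] p.Hilb) = 1 + 1 + 1 + 1 := by
      rw [show (4 : ℂ) = 1 + 1 + 1 + 1 by norm_num]
      simp only [add_smul, one_smul]
    rw [this]
    nth_rewrite 1 [← h1]
    nth_rewrite 1 [← h1]
    nth_rewrite 1 [← h2]
    rw [← h2]
    noncomm_ring
  rw [h5, smul_smul]
  norm_num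

lemma star_rePart {H : Type*} [NormedAddCommGroup H] [InnerProductSpace ℂ H] [CompleteSpace H]
    (a : H →L[ℂ] H) : star (rePart a) = rePart a := by
  rw [rePart, star_smul, star_add, star_star, add_comm]
  simp

lemma star_imPart {H : Type*} [NormedAddCommGroup H] [InnerProductSpace ℂ H] [CompleteSpace H]
    (a : H →L[ℂ] H) : star (imPart a) = imPart a := by
  have h : star (1 / (2 * Complex.I) : ℂ) = -(1 / (2 * Complex.I)) := by simp
  rw [imPart, star_smul, star_sub, star_star, h, neg_smul, ← smul_neg, neg_sub]

/-- Finite combinations of the $W^m$ suffice here, since only $X_j$ and $Y_j$ enter the Dirac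
operator through right multiplication. -/
lemma star_rightMul_of_mem_span {a : p.Hilb →L[ℂ] p.Hilb}
    (ha : a ∈ Submodule.span ℂ (Set.range p.W)) :
    star (p.rightMul a) = p.rightMul (star a) := by
  induction ha using Submodule.span_induction with
  | mem x hx =>
    obtain ⟨m, rfl⟩ := hx
    rw [rightMul_W, star_W, rightMul_W, star_rightW]
  | zero =>
    have : p.rightMul 0 = 0 := by simpa using p.rightMul_smul 0 0
    rw [star_zero, this, star_zero]
  | add x y _ _ hx hy => rw [rightMul_add, star_add, star_add, rightMul_add, hx, hy]
  | smul z x _ hx => rw [rightMul_smul, star_smul, star_smul, rightMul_smul, hx]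

lemma commute_rightMul_of_mem_span {a : p.Hilb →L[ℂ] p.Hilb}
    (ha : a ∈ Submodule.span ℂ (Set.range p.W)) (n : p.G) :
    Commute (p.rightMul a) (p.W n) := by
  induction ha using Submodule.span_induction with
  | mem x hx =>
    obtain ⟨m, rfl⟩ := hx
    rw [rightMul_W]
    exact p.commute_rightW_W m n
  | zero =>
    have : p.rightMul 0 = 0 := by simpa using p.rightMul_smul 0 0
    rw [this]
    exact Commute.zero_left _
  | add x y _ _ hx hy => rw [rightMul_add]; exact hx.add_left hy
  | smul z x _ hx => rw [rightMul_smul]; exact hx.smul_left z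

end Xi

/-! ### The commutant of the algebra generated by the first $d$ unitaries. -/

section SubTorus

variable {d d' : ℕ}

/-- The *-centralizer of $T$ is closed, so generators are enough. It also demands commutation with
$T^*$, which holds because the generators are unitary. -/
lemma commute_of_mem_subTorus (hdd' : d ≤ d') (p : Xi d') {T a : p.Hilb →L[ℂ] p.Hilb}
    (h : ∀ i : Fin d, Commute T (p.U (Fin.castLE hdd' i))) (ha : a ∈ subTorus hdd' p) :
    Commute T a := by
  have h1 : subTorus hdd' p ≤ StarSubalgebra.centralizer ℂ {T} := by
    refine StarSubalgebra.topologicalClosure_minimal (StarAlgebra.adjoin_le ?_) ?_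
    · rintro _ ⟨i, rfl⟩
      rw [SetLike.mem_coe, StarSubalgebra.mem_centralizer_iff]
      rintro g rfl
      refine ⟨h i, ?_⟩
      have := congrArg star (p.commute_star_U (h i)).eq
      rw [star_mul, star_mul, star_star] at this
      exact this.symm
    · rw [StarSubalgebra.coe_centralizer]
      exact Set.isClosed_centralizer _
  exact (StarSubalgebra.mem_centralizer_iff ℂ).1 (h1 ha) T rfl |>.1

end SubTorus

/-! ### Coordinates of infinite order, the weights $\sqrt{1+x^2+\langle m,m\rangle}$ and their
symbols. -/

section ZMod

/-- For modulus 0 the cast is the identity of $\mathbb Z$. For finite moduli it is not additive,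
which is why `infCoord` discards these coordinates. -/
lemma zmod_cast_add_of_eq_zero {N : ℕ} (hN : N = 0) (a b : ZMod N) :
    (ZMod.cast (a + b) : ℤ) = ZMod.cast a + ZMod.cast b := by
  subst hN
  exact rfl

end ZMod

namespace Xi

variable {d : ℕ} (p : Xi d)

open Classical in
/-- The `j`-th coordinate, if its order is infinite, and `0` otherwise. -/
noncomputable def infCoord (j : Fin d) : p.G →+ ℤ where
  toFun m := if p.k j = ⊤ then coordInt m j else 0
  map_zero' := by simp [coordInt]
  map_add' m n := by
    split_ifs with h
    · exact zmod_cast_add_of_eq_zero (by rw [h]; rfl) _ _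
    · simp

lemma infCoord_of_eq_top {j : Fin d} (h : p.k j = ⊤) (m : p.G) :
    p.infCoord j m = coordInt m j := if_pos h

lemma infCoord_of_ne_top {j : Fin d} (h : p.k j ≠ ⊤) (m : p.G) : p.infCoord j m = 0 := if_neg h

lemma infCoord_single_of_ne {j t : Fin d} (h : j ≠ t) :
    p.infCoord j (Pi.single t 1) = 0 := by
  change (if p.k j = ⊤ then (ZMod.cast ((Pi.single t 1 : p.G) j) : ℤ) else 0) = 0
  rw [Pi.single_eq_of_ne h, ZMod.cast_zero, ite_self]

lemma coordInt_injective : Function.Injective (fun (m : p.G) j => coordInt m j) := by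
  intro m n h
  funext j
  have h1 : (ZMod.cast (m j) : ℤ) = ZMod.cast (n j) := congrFun h j
  have h2 := congrArg (Int.cast : ℤ → ZMod (p.k j).toNat) h1
  simpa using h2

lemma coordInt_eq_zero_iff {m : p.G} {j : Fin d} : coordInt m j = 0 ↔ m j = 0 := by
  constructor
  · intro h
    have h2 := congrArg (Int.cast : ℤ → ZMod (p.k j).toNat) (show (ZMod.cast (m j) : ℤ) = 0 from h)
    simpa using h2
  · intro h
    simp [coordInt, h]

lemma coordInt_mem_Ico {j : Fin d} (h : p.k j ≠ ⊤) (m : p.G) :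
    coordInt m j ∈ Set.Ico (0 : ℤ) (p.k j).toNat := by
  have h0 : (p.k j).toNat ≠ 0 := by
    intro h0
    have h2 := p.two_le j
    rw [ENat.toNat_eq_zero] at h0
    rcases h0 with h0 | h0
    · rw [h0] at h2; simp at h2
    · exact h h0
  have : NeZero (p.k j).toNat := ⟨h0⟩
  rw [coordInt, ZMod.cast_eq_val]
  exact ⟨by positivity, by exact_mod_cast ZMod.val_lt _⟩

lemma sum_coordInt_smul_single (m : p.G) :
    ∑ j, coordInt m j • (Pi.single j 1 : p.G) = m := by
  funext i
  rw [Finset.sum_apply, Finset.sum_eq_single i]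
  · simp [coordInt]
  · intro j _ hj
    simp [Pi.single_eq_of_ne hj.symm]
  · simp

/-- Coordinates of infinite order are bounded by assumption, the others by their order, and the
integer coordinates determine the element. -/
lemma finite_setOf_coordInt_le (N : Fin d → ℕ) :
    {m : p.G | ∀ j, |p.infCoord j m| ≤ N j}.Finite := by
  classical
  let M : Fin d → ℕ := fun j => N j + (p.k j).toNat
  have h1 : (Set.pi Set.univ fun j => Set.Icc (-(M j : ℤ)) (M j)).Finite :=
    Set.Finite.pi fun j => Set.finite_Icc _ _
  refine (h1.preimage p.coordInt_injective.injOn).subset fun m hm => ?_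
  rw [Set.mem_preimage, Set.mem_univ_pi]
  intro j
  by_cases h : p.k j = ⊤
  · have := hm j
    rw [infCoord_of_eq_top p h] at this
    have h2 : (N j : ℤ) ≤ M j := by simp [M]
    exact abs_le.1 (this.trans h2)
  · have h2 := p.coordInt_mem_Ico h m
    have h3 : ((p.k j).toNat : ℤ) ≤ M j := by simp [M]
    exact ⟨by have := h2.1; omega, by have := h2.2; omega⟩

lemma sq_eq_sum_infCoord (m : p.G) : p.sq m = ∑ j, (p.infCoord j m : ℝ) ^ 2 := by
  unfold sq
  refine Finset.sum_congr rfl fun j _ => ?_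
  split_ifs with h
  · rw [infCoord_of_eq_top p h]
  · rw [infCoord_of_ne_top p h]; simp

/-- The weight `√(1 + x² + ⟨m, m⟩)`. -/
noncomputable def weight (x : ℝ) (m : p.G) : ℝ := Real.sqrt (1 + x ^ 2 + p.sq m)

lemma weight_sq (x : ℝ) (m : p.G) : p.weight x m ^ 2 = 1 + x ^ 2 + p.sq m :=
  Real.sq_sqrt (by have := p.sq_nonneg m; positivity)

lemma sqrt_le_weight (x : ℝ) (m : p.G) : Real.sqrt (1 + x ^ 2) ≤ p.weight x m :=
  Real.sqrt_le_sqrt (by have := p.sq_nonneg m; linarith)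

lemma one_le_sqrt (x : ℝ) : 1 ≤ Real.sqrt (1 + x ^ 2) := by
  rw [Real.one_le_sqrt]; nlinarith

lemma one_le_weight (x : ℝ) (m : p.G) : 1 ≤ p.weight x m :=
  (one_le_sqrt x).trans (p.sqrt_le_weight x m)

lemma weight_pos (x : ℝ) (m : p.G) : 0 < p.weight x m :=
  one_pos.trans_le (p.one_le_weight x m)

lemma infCoord_sq_le (j : Fin d) (m : p.G) : (p.infCoord j m : ℝ) ^ 2 ≤ p.sq m := by
  rw [sq_eq_sum_infCoord]
  exact Finset.single_le_sum (f := fun j => (p.infCoord j m : ℝ) ^ 2)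
    (fun i _ => by positivity) (Finset.mem_univ j)

lemma abs_infCoord_le_weight (x : ℝ) (j : Fin d) (m : p.G) :
    |(p.infCoord j m : ℝ)| ≤ p.weight x m := by
  refine abs_le_of_sq_le_sq' ?_ (p.weight_pos x m).le |> abs_le.2
  rw [weight_sq]
  have := p.infCoord_sq_le j m
  nlinarith

/-- The vector of the coordinates of infinite order, completed by `√(1 + x²)`. -/
noncomputable def infVector (x : ℝ) (m : p.G) : EuclideanSpace ℝ (Option (Fin d)) :=
  WithLp.toLp 2 fun o => o.elim (Real.sqrt (1 + x ^ 2)) fun j => (p.infCoord j m : ℝ)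

lemma norm_infVector (x : ℝ) (m : p.G) : ‖p.infVector x m‖ = p.weight x m := by
  rw [EuclideanSpace.norm_eq, Fintype.sum_option, weight, sq_eq_sum_infCoord]
  simp only [infVector, Option.elim, Real.norm_eq_abs, sq_abs]
  rw [Real.sq_sqrt (by positivity)]

lemma norm_infVector_sub (x : ℝ) (m g : p.G) :
    ‖p.infVector x m - p.infVector x (m - g)‖ = Real.sqrt (p.sq g) := by
  rw [EuclideanSpace.norm_eq, Fintype.sum_option, sq_eq_sum_infCoord]
  simp [infVector]

/-- The weight is the Euclidean norm of a vector depending affinely on $m$, so this is the reverse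
triangle inequality; the bound does not depend on $x$. -/
lemma abs_weight_sub_le (x : ℝ) (m g : p.G) :
    |p.weight x m - p.weight x (m - g)| ≤ Real.sqrt (p.sq g) := by
  rw [← norm_infVector, ← norm_infVector, ← norm_infVector_sub p x m g]
  exact abs_norm_sub_norm_le _ _

lemma abs_inv_weight_sub_le (x : ℝ) (m g : p.G) :
    |(p.weight x m)⁻¹ - (p.weight x (m - g))⁻¹| ≤
      Real.sqrt (p.sq g) / (p.weight x m * p.weight x (m - g)) := by
  have h1 := p.weight_pos x m
  have h2 := p.weight_pos x (m - g)
  rw [inv_sub_inv h1.ne' h2.ne', abs_div, abs_of_pos (mul_pos h1 h2), abs_sub_comm]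
  exact div_le_div_of_nonneg_right (p.abs_weight_sub_le x m g) (mul_pos h1 h2).le

/-- The multiplier of the operator `(1 + x² + ⟨m, m⟩)^{-1/2}`. -/
noncomputable def invWeight (x : ℝ) (m : p.G) : ℂ := ((p.weight x m)⁻¹ : ℝ)

/-- The symbol of `-i ∂_j (1 + x² + ⟨m, m⟩)^{-1/2}`. -/
noncomputable def symbol (j : Fin d) (x : ℝ) (m : p.G) : ℂ :=
  ((p.infCoord j m : ℝ) * (p.weight x m)⁻¹ : ℝ)

/-- The symbol of `√(1 + x²) (1 + x² + ⟨m, m⟩)^{-1/2}`. -/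
noncomputable def symbolTop (x : ℝ) (m : p.G) : ℂ :=
  (Real.sqrt (1 + x ^ 2) * (p.weight x m)⁻¹ : ℝ)

lemma norm_invWeight_le (x : ℝ) (m : p.G) : ‖p.invWeight x m‖ ≤ (Real.sqrt (1 + x ^ 2))⁻¹ := by
  rw [invWeight, Complex.norm_real, Real.norm_of_nonneg (inv_nonneg.2 (p.weight_pos x m).le)]
  exact inv_anti₀ (one_pos.trans_le (one_le_sqrt x)) (p.sqrt_le_weight x m)

lemma norm_invWeight_le_one (x : ℝ) (m : p.G) : ‖p.invWeight x m‖ ≤ 1 :=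
  (p.norm_invWeight_le x m).trans (inv_le_one_of_one_le₀ (one_le_sqrt x))

lemma norm_symbol_le (j : Fin d) (x : ℝ) (m : p.G) : ‖p.symbol j x m‖ ≤ 1 := by
  rw [symbol, Complex.norm_real, Real.norm_eq_abs, abs_mul,
    abs_of_pos (inv_pos.2 (p.weight_pos x m)), ← div_eq_mul_inv, div_le_one (p.weight_pos x m)]
  exact p.abs_infCoord_le_weight x j m

lemma norm_symbolTop_le (x : ℝ) (m : p.G) : ‖p.symbolTop x m‖ ≤ 1 := by
  rw [symbolTop, Complex.norm_real, Real.norm_eq_abs, abs_mul, abs_of_nonneg (Real.sqrt_nonneg _),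
    abs_of_pos (inv_pos.2 (p.weight_pos x m)), ← div_eq_mul_inv, div_le_one (p.weight_pos x m)]
  exact p.sqrt_le_weight x m

lemma exists_norm_invWeight_le (x : ℝ) : ∃ C, ∀ m, ‖p.invWeight x m‖ ≤ C :=
  ⟨1, p.norm_invWeight_le_one x⟩

lemma exists_norm_symbol_le (j : Fin d) (x : ℝ) : ∃ C, ∀ m, ‖p.symbol j x m‖ ≤ C :=
  ⟨1, p.norm_symbol_le j x⟩

lemma exists_norm_symbolTop_le (x : ℝ) : ∃ C, ∀ m, ‖p.symbolTop x m‖ ≤ C :=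
  ⟨1, p.norm_symbolTop_le x⟩

lemma norm_symbolTop_sub_le (x : ℝ) (m g : p.G) :
    ‖p.symbolTop x m - p.symbolTop x (m - g)‖ ≤
      2 * Real.sqrt (p.sq g) * (Real.sqrt (1 + x ^ 2))⁻¹ := by
  have h0 := one_le_sqrt x
  have h1 := p.weight_pos x m
  have h2 := p.weight_pos x (m - g)
  have hs := Real.sqrt_nonneg (p.sq g)
  rw [symbolTop, symbolTop, ← Complex.ofReal_sub, Complex.norm_real, Real.norm_eq_abs, ← mul_sub,
    abs_mul, abs_of_nonneg (Real.sqrt_nonneg _)]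
  calc _ ≤ Real.sqrt (1 + x ^ 2) *
        (Real.sqrt (p.sq g) / (Real.sqrt (1 + x ^ 2) * Real.sqrt (1 + x ^ 2))) := by
        refine mul_le_mul_of_nonneg_left ((p.abs_inv_weight_sub_le x m g).trans ?_)
          (Real.sqrt_nonneg _)
        exact div_le_div_of_nonneg_left hs (by positivity)
          (mul_le_mul (p.sqrt_le_weight x m) (p.sqrt_le_weight x _) (Real.sqrt_nonneg _) h1.le)
    _ = 1 * Real.sqrt (p.sq g) * (Real.sqrt (1 + x ^ 2))⁻¹ := by field_simp
    _ ≤ _ := by gcongr; norm_num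

/-- The difference splits into a variation of the coordinate and a variation of the inverse weight.
Each is at most $\sqrt{\langle g,g\rangle}$ divided by the weight, which is at least $\sqrt{1+x^2}$.
-/
lemma norm_symbol_sub_le (j : Fin d) (x : ℝ) (m g : p.G) :
    ‖p.symbol j x m - p.symbol j x (m - g)‖ ≤
      2 * Real.sqrt (p.sq g) * (Real.sqrt (1 + x ^ 2))⁻¹ := by
  have h0 := one_le_sqrt x
  have h0' : 0 < Real.sqrt (1 + x ^ 2) := one_pos.trans_le h0
  have h1 := p.weight_pos x m
  have h2 := p.weight_pos x (m - g)
  have hs := Real.sqrt_nonneg (p.sq g)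
  have hle : (p.weight x m)⁻¹ ≤ (Real.sqrt (1 + x ^ 2))⁻¹ := inv_anti₀ h0' (p.sqrt_le_weight x m)
  rw [symbol, symbol, ← Complex.ofReal_sub, Complex.norm_real, Real.norm_eq_abs]
  have h3 : (p.infCoord j m : ℝ) * (p.weight x m)⁻¹ -
      (p.infCoord j (m - g) : ℝ) * (p.weight x (m - g))⁻¹ =
      (p.infCoord j g : ℝ) * (p.weight x m)⁻¹ +
      (p.infCoord j (m - g) : ℝ) * ((p.weight x m)⁻¹ - (p.weight x (m - g))⁻¹) := by
    rw [map_sub]; push_cast; ring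
  have h4 : |(p.infCoord j g : ℝ)| ≤ Real.sqrt (p.sq g) := Real.abs_le_sqrt (p.infCoord_sq_le j g)
  rw [h3]
  refine (abs_add_le _ _).trans ?_
  rw [abs_mul, abs_mul, abs_of_pos (inv_pos.2 h1)]
  have h5 : |(p.infCoord j (m - g) : ℝ)| * |(p.weight x m)⁻¹ - (p.weight x (m - g))⁻¹| ≤
      Real.sqrt (p.sq g) * (p.weight x m)⁻¹ := by
    calc _ ≤ p.weight x (m - g) *
          (Real.sqrt (p.sq g) / (p.weight x m * p.weight x (m - g))) :=
          mul_le_mul (p.abs_infCoord_le_weight x j _) (p.abs_inv_weight_sub_le x m g)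
            (abs_nonneg _) h2.le
      _ = _ := by field_simp
  have h6 := mul_le_mul_of_nonneg_right h4 (inv_pos.2 h1).le
  have h7 := mul_le_mul_of_nonneg_left hle hs
  linarith

lemma tendsto_invWeight_cofinite (x : ℝ) : Tendsto (p.invWeight x) cofinite (𝓝 0) := by
  rw [Metric.tendsto_nhds]
  intro ε hε
  obtain ⟨N, hN⟩ := exists_nat_gt ε⁻¹
  rw [eventually_cofinite]
  refine (p.finite_setOf_coordInt_le fun _ => N).subset fun m hm j => ?_
  have h1 : ε ≤ (p.weight x m)⁻¹ := by
    have h2 : ¬ dist (p.invWeight x m) 0 < ε := hm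
    rw [dist_zero_right, invWeight, Complex.norm_real,
      Real.norm_of_nonneg (inv_nonneg.2 (p.weight_pos x m).le)] at h2
    exact not_lt.1 h2
  have h2 : p.weight x m ≤ N := by
    rw [le_inv_comm₀ hε (p.weight_pos x m)] at h1
    exact h1.trans hN.le
  have h3 := (p.abs_infCoord_le_weight x j m).trans h2
  exact_mod_cast h3

lemma sum_symbol_sq_add (x : ℝ) (m : p.G) :
    ∑ j, p.symbol j x m * p.symbol j x m + p.symbolTop x m * p.symbolTop x m = 1 := by
  have h1 := (p.weight_pos x m).ne'
  have h2 := p.weight_sq x m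
  have h3 : Real.sqrt (1 + x ^ 2) ^ 2 = 1 + x ^ 2 := Real.sq_sqrt (by positivity)
  simp only [symbol, symbolTop, ← Complex.ofReal_mul, ← Complex.ofReal_sum, ← Complex.ofReal_add]
  rw [← Complex.ofReal_one]
  congr 1
  have h4 : ∀ j, (p.infCoord j m : ℝ) * (p.weight x m)⁻¹ *
      ((p.infCoord j m : ℝ) * (p.weight x m)⁻¹) =
      (p.infCoord j m : ℝ) ^ 2 * ((p.weight x m) ^ 2)⁻¹ := fun j => by field_simp
  simp only [h4]
  rw [← Finset.sum_mul, ← sq_eq_sum_infCoord, mul_mul_mul_comm, ← _root_.sq, h3, ← mul_inv,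
    ← _root_.sq, ← add_mul, add_comm, ← h2]
  field_simp

lemma tendsto_inv_sqrt : Tendsto (fun x : ℝ => (Real.sqrt (1 + x ^ 2))⁻¹) atTop (𝓝 0) := by
  refine Tendsto.inv_tendsto_atTop (Real.tendsto_sqrt_atTop.comp ?_)
  exact tendsto_atTop_add_const_left _ _ (tendsto_pow_atTop two_ne_zero)

/-- Commutators with symbols of order `0` are asymptotically small. -/
lemma tendsto_commutator_of_mem_span {w : ℝ → p.G → ℂ} (hw : ∀ x, ∃ C, ∀ m, ‖w x m‖ ≤ C)
    (hw' : ∀ x m g, ‖w x m - w x (m - g)‖ ≤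
      2 * Real.sqrt (p.sq g) * (Real.sqrt (1 + x ^ 2))⁻¹)
    {A : p.Hilb →L[ℂ] p.Hilb} (hA : A ∈ Submodule.span ℂ (Set.range p.W)) :
    Tendsto (fun x => mulOp (w x) * A - A * mulOp (w x)) atTop (𝓝 0) := by
  induction hA using Submodule.span_induction with
  | mem A hA =>
    obtain ⟨g, rfl⟩ := hA
    refine squeeze_zero_norm (fun x => norm_mulOp_commutator_weightedPerm_le (hw x) _ _
      (by positivity) fun m => hw' x m g) ?_
    simpa using tendsto_inv_sqrt.const_mul (2 * Real.sqrt (p.sq g))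
  | zero => simp
  | add A B _ _ hA hB =>
    have := hA.add hB
    rw [add_zero] at this
    refine this.congr fun x => ?_
    noncomm_ring
  | smul z A _ hA =>
    have := hA.const_smul z
    rw [smul_zero] at this
    refine this.congr fun x => ?_
    rw [smul_sub, mul_smul_comm, smul_mul_assoc]

/-- Translations by $g$ with $g_j=0$ leave the factor $m_j$ unchanged, so both sides have the same
matrix, $m_j$ times both inverse weights. This is the commutation of $A$ with $\partial_j$ in
bounded form, and yields the symmetry of $D$. -/
lemma invWeight_mul_mul_symbol {j : Fin d} (x : ℝ) {A : p.Hilb →L[ℂ] p.Hilb}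
    (hA : A ∈ Submodule.span ℂ (p.W '' {g | p.infCoord j g = 0})) :
    mulOp (p.invWeight x) * A * mulOp (p.symbol j x) =
      mulOp (p.symbol j x) * A * mulOp (p.invWeight x) := by
  induction hA using Submodule.span_induction with
  | mem A hA =>
    obtain ⟨g, hg, rfl⟩ := hA
    have hg' : p.infCoord j g = 0 := hg
    ext ξ m
    change mulOp (p.invWeight x) (p.W g (mulOp (p.symbol j x) ξ)) m =
      mulOp (p.symbol j x) (p.W g (mulOp (p.invWeight x) ξ)) m
    rw [mulOp_apply (p.exists_norm_invWeight_le x), mulOp_apply (p.exists_norm_symbol_le j x),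
      W_apply, W_apply, mulOp_apply (p.exists_norm_invWeight_le x),
      mulOp_apply (p.exists_norm_symbol_le j x), symbol, symbol, map_sub, hg', sub_zero, invWeight,
      invWeight]
    push_cast
    simp only [smul_eq_mul]
    ring
  | zero => simp
  | add A B _ _ hA hB => rw [mul_add, add_mul, hA, hB, mul_add, add_mul]
  | smul z A _ hA => rw [mul_smul_comm, smul_mul_assoc, hA, mul_smul_comm, smul_mul_assoc]

end Xi

/-! ### The domain of $D$ as the range of $r_x$, and derivations on it. -/

section Sobolev

variable {d : ℕ} (p : Xi d) {E : Type*} [NormedAddCommGroup E] [InnerProductSpace ℂ E]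

lemma mem_sobolev_iff {ξ : L2 p.G E} :
    ξ ∈ p.sobolev E ↔ Memℓp (fun m => (Real.sqrt (1 + p.sq m) : ℂ) • ξ m) 2 := Iff.rfl

lemma mulOp_invWeight_mem_sobolev (x : ℝ) (ξ : L2 p.G E) :
    mulOp (p.invWeight x) ξ ∈ p.sobolev E := by
  rw [mem_sobolev_iff]
  refine L2.memℓp_of_bound (C := 1) (lp.memℓp ξ) fun m => ?_
  rw [mulOp_apply (p.exists_norm_invWeight_le x), norm_smul, norm_smul, ← mul_assoc]
  refine mul_le_mul_of_nonneg_right ?_ (norm_nonneg _)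
  rw [Xi.invWeight, Complex.norm_real, Complex.norm_real, Real.norm_of_nonneg (Real.sqrt_nonneg _),
    Real.norm_of_nonneg (inv_nonneg.2 (p.weight_pos x m).le), ← div_eq_mul_inv,
    div_le_one (p.weight_pos x m)]
  exact Real.sqrt_le_sqrt (by nlinarith)

/-- For each fixed $x$ the weights $\sqrt{1+x^2+\langle m,m\rangle}$ and $\sqrt{1+\langle
m,m\rangle}$ are comparable, so the domain is the range of $r_x$ for every $x$. -/
lemma exists_mulOp_invWeight_eq (x : ℝ) {ξ : L2 p.G E} (hξ : ξ ∈ p.sobolev E) :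
    ∃ η : L2 p.G E, mulOp (p.invWeight x) η = ξ := by
  rw [mem_sobolev_iff] at hξ
  have h : Memℓp (fun m => (p.weight x m : ℂ) • ξ m) 2 := by
    refine L2.memℓp_of_bound (C := Real.sqrt (1 + x ^ 2)) hξ fun m => ?_
    rw [norm_smul, norm_smul, ← mul_assoc]
    refine mul_le_mul_of_nonneg_right ?_ (norm_nonneg _)
    rw [Complex.norm_real, Complex.norm_real, Real.norm_of_nonneg (Real.sqrt_nonneg _),
      Real.norm_of_nonneg (p.weight_pos x m).le, ← Real.sqrt_mul (by positivity)]
    refine Real.sqrt_le_sqrt ?_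
    have := p.sq_nonneg m
    nlinarith [mul_nonneg (_root_.sq_nonneg x) this]
  refine ⟨⟨_, h⟩, ?_⟩
  ext m
  rw [mulOp_apply (p.exists_norm_invWeight_le x)]
  change p.invWeight x m • ((p.weight x m : ℂ) • ξ m) = ξ m
  rw [smul_smul, Xi.invWeight, ← Complex.ofReal_mul, inv_mul_cancel₀ (p.weight_pos x m).ne',
    Complex.ofReal_one, one_smul]

lemma single_mem_sobolev [DecidableEq p.G] (m : p.G) (a : E) :
    (lp.single 2 m a : L2 p.G E) ∈ p.sobolev E := by
  rw [mem_sobolev_iff]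
  have := lp.memℓp (lp.single 2 m ((Real.sqrt (1 + p.sq m) : ℂ) • a) : L2 p.G E)
  refine this.mono' fun n => ?_
  rw [lp.single_apply, lp.single_apply]
  by_cases h : n = m
  · subst h; simp
  · simp [Pi.single_eq_of_ne h]

lemma dense_sobolev : Dense (p.sobolev E : Set (L2 p.G E)) := by
  classical
  intro ξ
  have h := lp.hasSum_single (by norm_num) ξ
  refine mem_closure_of_tendsto h (Eventually.of_forall fun s => ?_)
  exact (p.sobolev E).sum_mem fun m _ => single_mem_sobolev p m _

lemma partialDeriv_apply (j : Fin d) (ξ : p.sobolev ℂ) (m : p.G) :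
    p.partialDeriv j ξ m = Complex.I * (p.infCoord j m : ℂ) * (ξ : p.Hilb) m := by
  change (if p.k j = ⊤ then Complex.I * (coordInt m j : ℂ) else 0) * (ξ : p.Hilb) m = _
  split_ifs with h
  · rw [p.infCoord_of_eq_top h]
  · rw [p.infCoord_of_ne_top h]; simp

lemma partialDeriv_mulOp_invWeight (j : Fin d) (x : ℝ) (ξ : p.Hilb) :
    p.partialDeriv j ⟨mulOp (p.invWeight x) ξ, mulOp_invWeight_mem_sobolev p x ξ⟩ =
      Complex.I • mulOp (p.symbol j x) ξ := by
  ext m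
  rw [partialDeriv_apply, lp.coeFn_smul, Pi.smul_apply, mulOp_apply (p.exists_norm_invWeight_le x),
    mulOp_apply (p.exists_norm_symbol_le j x), Xi.symbol, Xi.invWeight]
  push_cast
  simp only [smul_eq_mul]
  ring

/-- The weight at $m$ exceeds the one at $m-g$ by at most $\sqrt{\langle g,g\rangle}$, and weights
are at least 1. -/
lemma W_mem_sobolev (g : p.G) {ξ : L2 p.G E} (hξ : ξ ∈ p.sobolev E) (c : p.G → Circle) :
    weightedPerm (Equiv.subRight g) c ξ ∈ p.sobolev E := by
  rw [mem_sobolev_iff] at hξ ⊢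
  have h2 := memℓp_of_norm_eq (E := E) (F := E) (Equiv.subRight g)
    (g := fun m => (Real.sqrt (1 + p.sq (m - g)) : ℂ) • ξ (m - g)) hξ fun m => rfl
  refine L2.memℓp_of_bound (C := 1 + Real.sqrt (p.sq g)) h2 fun m => ?_
  rw [weightedPerm_apply, norm_smul, norm_smul, norm_smul, Circle.norm_coe, one_mul, ← mul_assoc]
  refine mul_le_mul_of_nonneg_right ?_ (norm_nonneg _)
  have h3 := p.abs_weight_sub_le 0 m g
  have h4 := p.one_le_weight 0 (m - g)
  have h5 : ∀ n, Real.sqrt (1 + p.sq n) = p.weight 0 n := fun n => by simp [Xi.weight]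
  rw [Complex.norm_real, Complex.norm_real, h5, h5, Real.norm_of_nonneg (p.weight_pos 0 _).le,
    Real.norm_of_nonneg (p.weight_pos 0 _).le]
  have h6 := (abs_le.1 h3).2
  nlinarith [Real.sqrt_nonneg (p.sq g)]

lemma partialDeriv_W (j : Fin d) (g : p.G) (ξ : p.sobolev ℂ) :
    p.partialDeriv j ⟨p.W g ξ, W_mem_sobolev p g ξ.2 _⟩ =
      p.W g (p.partialDeriv j ξ) + (Complex.I * (p.infCoord j g : ℂ)) • p.W g ξ := by
  ext m
  rw [partialDeriv_apply, lp.coeFn_add, Pi.add_apply, lp.coeFn_smul, Pi.smul_apply, Xi.W_apply,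
    Xi.W_apply, partialDeriv_apply, map_sub]
  push_cast
  simp only [smul_eq_mul]
  ring

end Sobolev

/-! ### Splitting $D$ into leading and bounded parts, and the Clifford relations. -/

section DiracOperator

variable {d d' : ℕ} {𝒞 : Type*} [NormedAddCommGroup 𝒞] [InnerProductSpace ℂ 𝒞] [CompleteSpace 𝒞]
  [FiniteDimensional ℂ 𝒞]

lemma tensorOp_apply (p : Xi d') (T : p.sobolev ℂ →ₗ[ℂ] p.Hilb) (t : 𝒞 →L[ℂ] 𝒞)
    (ξ : p.sobolev 𝒞) :
    tensorOp p T t ξ = ∑ i, tensorVec (t (stdOrthonormalBasis ℂ 𝒞 i))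
      (T ⟨coord p.G 𝒞 i (ξ : L2 p.G 𝒞), coord_mem_sobolev p i ξ⟩) := by
  rw [tensorOp, LinearMap.sum_apply]
  rfl

/-- This replaces an unbounded term by an amplified bounded operator once $\xi$ is written through
some $\eta$; it is applied with $\xi=r_x\eta$. -/
lemma tensorOp_eq_of_forall_coord (p : Xi d') {T : p.sobolev ℂ →ₗ[ℂ] p.Hilb} {t : 𝒞 →L[ℂ] 𝒞}
    {ξ : p.sobolev 𝒞} {η : L2 p.G 𝒞} {Q : p.Hilb →L[ℂ] p.Hilb}
    (h : ∀ i, T ⟨coord p.G 𝒞 i (ξ : L2 p.G 𝒞), coord_mem_sobolev p i ξ⟩ = Q (coord p.G 𝒞 i η)) :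
    tensorOp p T t ξ = amp p.G 𝒞 Q (lpMap t η) := by
  have h1 := (commute_amp_lpMap (G := p.G) Q t).eq
  have h2 : amp p.G 𝒞 Q (lpMap t η) = lpMap t (amp p.G 𝒞 Q η) :=
    congrArg (fun S : L2 p.G 𝒞 →L[ℂ] L2 p.G 𝒞 => S η) h1
  rw [tensorOp_apply, h2, amp_apply, map_sum]
  refine Finset.sum_congr rfl fun i _ => ?_
  rw [h i, lpMap_tensorVec]

lemma tensorVec_mem_sobolev (p : Xi d') (v : 𝒞) {η : p.Hilb} (hη : η ∈ p.sobolev ℂ) :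
    tensorVec v η ∈ p.sobolev 𝒞 := by
  rw [mem_sobolev_iff] at hη ⊢
  refine L2.memℓp_of_bound (C := ‖v‖) hη fun m => ?_
  change ‖(Real.sqrt (1 + p.sq m) : ℂ) • (η m • v)‖ ≤ _
  rw [norm_smul, norm_smul, norm_smul]
  exact le_of_eq (by ring)

lemma tensorOp_tensorVec (p : Xi d') (T : p.sobolev ℂ →ₗ[ℂ] p.Hilb) (t : 𝒞 →L[ℂ] 𝒞) (v : 𝒞)
    (η : p.sobolev ℂ) :
    tensorOp p T t ⟨tensorVec v (η : p.Hilb), tensorVec_mem_sobolev p v η.2⟩ =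
      tensorVec (t v) (T η) := by
  rw [tensorOp_apply]
  have h1 : ∀ i, (⟨coord p.G 𝒞 i (tensorVec v (η : p.Hilb)),
      coord_mem_sobolev p i ⟨_, tensorVec_mem_sobolev p v η.2⟩⟩ : p.sobolev ℂ) =
      inner ℂ (stdOrthonormalBasis ℂ 𝒞 i) v • η := fun i => by
    ext1
    exact coord_tensorVec' i v _
  simp only [h1, map_smul]
  conv_rhs => rw [← (stdOrthonormalBasis ℂ 𝒞).sum_repr' v]
  ext m
  rw [lp.coeFn_sum, Finset.sum_apply]
  simp only [tensorVec, lpMap_apply, ContinuousLinearMap.toSpanSingleton_apply, map_sum, map_smul,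
    Finset.smul_sum, lp.coeFn_smul, Pi.smul_apply, smul_smul]
  exact Finset.sum_congr rfl fun i _ => by rw [mul_comm]

/-- The direction in which the `i`-th term of the Dirac operator differentiates. -/
def direction (hdd' : d ≤ d') : Fin d ⊕ Fin d' → Fin d' := Sum.elim (Fin.castLE hdd') id

open Classical in
/-- The coefficient of the derivation in the `i`-th term of the Dirac operator. -/
noncomputable def leadingOp (hdd' : d ≤ d') (p : Xi d') (f : Equiv.Perm (Fin d')) :
    Fin d ⊕ Fin d' → p.Hilb →L[ℂ] p.Hilb
  | .inl i => if p.k (Fin.castLE hdd' i) = ⊤ then opX p f (Fin.castLE hdd' i) else 0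
  | .inr j => if p.k j = ⊤ then (if (j : ℕ) < d then opY p f j else 1) else 0

open Classical in
/-- The bounded part of the `i`-th term of the Dirac operator. -/
noncomputable def boundedOp (hdd' : d ≤ d') (p : Xi d') (f : Equiv.Perm (Fin d')) :
    Fin d ⊕ Fin d' → p.Hilb →L[ℂ] p.Hilb
  | .inl i => if p.k (Fin.castLE hdd' i) = ⊤ then 0 else
      (-((p.k (Fin.castLE hdd' i)).toNat : ℂ) / (2 * Complex.I * Real.pi)) •
        p.commutator (opY p f (Fin.castLE hdd' i))
  | .inr j => if p.k j = ⊤ then 0 else if (j : ℕ) < d then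
      (((p.k j).toNat : ℂ) / (2 * Complex.I * Real.pi)) • p.commutator (opX p f j)
      else (((p.k j).toNat : ℂ) / (2 * Complex.I * Real.pi)) • (1 - imPart (p.v (p.zGen j)))

/-- The operators `Γ_1, …, Γ_{d + d'}`. -/
noncomputable def gammaOp (hdd' : d ≤ d') (p : Xi d') (f : Equiv.Perm (Fin d')) :
    Fin d ⊕ Fin d' → p.sobolev ℂ →ₗ[ℂ] p.Hilb :=
  Sum.elim (gammaFst hdd' p f) (gammaSnd d p f)

lemma gammaOp_apply (hdd' : d ≤ d') (p : Xi d') (f : Equiv.Perm (Fin d')) (i : Fin d ⊕ Fin d')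
    (ξ : p.sobolev ℂ) :
    gammaOp hdd' p f i ξ =
      leadingOp hdd' p f i (p.partialDeriv (direction hdd' i) ξ) + boundedOp hdd' p f i ξ := by
  rcases i with i | j
  · change gammaFst hdd' p f i ξ = _
    simp only [gammaFst, leadingOp, boundedOp, direction, Sum.elim_inl]
    split_ifs with h
    · rw [zero_apply, add_zero]; rfl
    · rw [zero_apply, zero_add]; rfl
  · change gammaSnd d p f j ξ = _
    simp only [gammaSnd, leadingOp, boundedOp, direction, Sum.elim_inr, id]
    split_ifs with h h' h'
    · rw [zero_apply, add_zero]; rfl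
    · rw [zero_apply, zero_add]; rfl
    · rw [zero_apply, add_zero]; rfl
    · rw [zero_apply, zero_add]; rfl

/-- The representatives of the generators of the Clifford algebra. -/
noncomputable def cliffordOp (c : CliffordAlgebra (cliffordForm (d + d')) →ₐ[ℂ] (𝒞 →L[ℂ] 𝒞))
    (i : Fin d ⊕ Fin d') : 𝒞 →L[ℂ] 𝒞 :=
  c (cliffordGen (d + d') (finSumFinEquiv i))

lemma diracOp_apply (hdd' : d ≤ d') (p : Xi d') (f : Equiv.Perm (Fin d'))
    (c : CliffordAlgebra (cliffordForm (d + d')) →ₐ[ℂ] (𝒞 →L[ℂ] 𝒞)) (ξ : p.sobolev 𝒞) :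
    diracOp hdd' p f c ξ = ∑ i, tensorOp p (gammaOp hdd' p f i) (cliffordOp c i) ξ := by
  rw [Fintype.sum_sum_type]
  change (∑ i : Fin d, tensorOp p (gammaFst hdd' p f i) (c (cliffordGen (d + d')
    (Fin.castAdd d' i))) + ∑ j : Fin d', tensorOp p (gammaSnd d p f j) (c (cliffordGen (d + d')
    (Fin.natAdd d j)))) ξ = _
  rw [LinearMap.add_apply, LinearMap.sum_apply, LinearMap.sum_apply]
  rfl

lemma cliffordGen_mul_add (n : ℕ) (i j : Fin n) :
    cliffordGen n i * cliffordGen n j + cliffordGen n j * cliffordGen n i =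
      algebraMap ℂ _ (if i = j then -2 else 0) := by
  rw [cliffordGen, cliffordGen, CliffordAlgebra.ι_mul_ι_add_swap]
  congr 1
  simp only [QuadraticMap.polar, QuadraticMap.weightedSumSquares_apply, Pi.add_apply]
  rw [← Finset.sum_sub_distrib, ← Finset.sum_sub_distrib]
  split_ifs with h
  · subst h
    rw [Finset.sum_eq_single i]
    · simp; norm_num
    · intro b _ hb
      simp [Pi.single_eq_of_ne hb]
    · simp
  · refine Finset.sum_eq_zero fun b _ => ?_
    by_cases hb : b = i
    · subst hb
      simp [Pi.single_eq_of_ne h]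
    · simp [Pi.single_eq_of_ne hb]

variable {c : CliffordAlgebra (cliffordForm (d + d')) →ₐ[ℂ] (𝒞 →L[ℂ] 𝒞)}

lemma cliffordOp_anticomm {i s : Fin d ⊕ Fin d'} (h : i ≠ s) :
    cliffordOp c i * cliffordOp c s + cliffordOp c s * cliffordOp c i = 0 := by
  rw [cliffordOp, cliffordOp, ← map_mul, ← map_mul, ← map_add, cliffordGen_mul_add, if_neg]
  · simp
  · simpa using h

lemma cliffordOp_sq (i : Fin d ⊕ Fin d') : cliffordOp c i * cliffordOp c i = -1 := by
  have h := congrArg c (cliffordGen_mul_add (d + d') (finSumFinEquiv i) (finSumFinEquiv i))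
  rw [if_pos rfl, map_add, map_mul, ← two_smul ℂ, AlgHom.commutes,
    Algebra.algebraMap_eq_smul_one, neg_smul, ← smul_neg] at h
  exact smul_right_injective _ (two_ne_zero' ℂ) h

lemma star_cliffordOp (hc : IsFaithfulStarRep c) (i : Fin d ⊕ Fin d') :
    star (cliffordOp c i) = -cliffordOp c i := hc.star_gen _

/-- A skew-adjoint operator of square $-1$ is unitary. -/
lemma norm_cliffordOp_apply (hc : IsFaithfulStarRep c) (i : Fin d ⊕ Fin d') (v : 𝒞) :
    ‖cliffordOp c i v‖ = ‖v‖ := by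
  have h : star (cliffordOp c i) * cliffordOp c i = 1 := by
    rw [star_cliffordOp hc, neg_mul, cliffordOp_sq, neg_neg]
  exact (ContinuousLinearMap.norm_map_iff_adjoint_comp_self (cliffordOp c i)).2 h v

end DiracOperator

/-! ### Algebraic properties of the coefficients of the Dirac operator. -/

section LeadingOp

variable {d d' : ℕ} (hdd' : d ≤ d') (p : Xi d') (f : Equiv.Perm (Fin d'))

lemma sum_castLE {M : Type*} [AddCommMonoid M] (h : d ≤ d') (g : Fin d' → M) :
    ∑ i : Fin d, g (Fin.castLE h i) = ∑ j : Fin d', if (j : ℕ) < d then g j else 0 := by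
  obtain ⟨e, rfl⟩ := Nat.exists_eq_add_of_le h
  rw [Fin.sum_univ_add]
  simp only [Fin.val_castAdd, Fin.is_lt, if_true, Fin.val_natAdd, add_lt_iff_neg_left, not_lt_zero,
    if_false, Finset.sum_const_zero, add_zero]
  rfl

lemma star_opX (j : Fin d') : star (opX p f j) = opX p f j := Xi.star_rePart _

lemma star_opY (j : Fin d') : star (opY p f j) = opY p f j := by
  rw [opY, star_smul, Xi.star_imPart]
  split_ifs <;> simp

lemma opX_sq_add_opY_sq (j : Fin d') :
    opX p f j * opX p f j + opY p f j * opY p f j = 1 := by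
  rw [opX, opY, smul_mul_smul_comm]
  have h : (if j < f j then (1 : ℂ) else -1) * (if j < f j then (1 : ℂ) else -1) = 1 := by
    split_ifs <;> norm_num
  rw [h, one_smul, Xi.rePart_sq_add_imPart_sq_U]

variable {p f} in
lemma commute_opX {T : p.Hilb →L[ℂ] p.Hilb} {j : Fin d'} (h : Commute T (p.U (f j))) :
    Commute T (opX p f j) := p.commute_rePart_U h

variable {p f} in
lemma commute_opY {T : p.Hilb →L[ℂ] p.Hilb} {j : Fin d'} (h : Commute T (p.U (f j))) :
    Commute T (opY p f j) := (p.commute_imPart_U h).smul_right _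

variable {f} in
-- The operator $X_j$ only involves translations by $\pm e_{f(j)}$.
lemma opX_mem_span {j t : Fin d'} (h : t ≠ f j) :
    opX p f j ∈ Submodule.span ℂ (p.W '' {g | p.infCoord t g = 0}) := by
  have h0 := p.infCoord_single_of_ne h
  rw [opX, Xi.rePart_U]
  refine add_mem (Submodule.smul_mem _ _ (Submodule.subset_span ⟨_, h0, rfl⟩))
    (Submodule.smul_mem _ _ (Submodule.subset_span ⟨_, ?_, rfl⟩))
  change p.infCoord t _ = 0
  rw [map_neg, h0, neg_zero]

variable {f} in
lemma opY_mem_span {j t : Fin d'} (h : t ≠ f j) :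
    opY p f j ∈ Submodule.span ℂ (p.W '' {g | p.infCoord t g = 0}) := by
  have h0 := p.infCoord_single_of_ne h
  rw [opY, Xi.imPart_U]
  refine Submodule.smul_mem _ _ (add_mem
    (Submodule.smul_mem _ _ (Submodule.subset_span ⟨_, h0, rfl⟩))
    (Submodule.smul_mem _ _ (Submodule.subset_span ⟨_, ?_, rfl⟩)))
  change p.infCoord t _ = 0
  rw [map_neg, h0, neg_zero]

lemma star_leadingOp (i : Fin d ⊕ Fin d') :
    star (leadingOp hdd' p f i) = leadingOp hdd' p f i := by
  rcases i with i | j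
  · simp only [leadingOp]
    split_ifs
    · exact star_opX p f _
    · exact star_zero _
  · simp only [leadingOp]
    split_ifs
    · exact star_opY p f _
    · exact star_one _
    · exact star_zero _

variable {f} in
lemma leadingOp_mem_span (hno : ∀ j, f j ≠ j) (i : Fin d ⊕ Fin d') :
    leadingOp hdd' p f i ∈
      Submodule.span ℂ (p.W '' {g | p.infCoord (direction hdd' i) g = 0}) := by
  rcases i with i | j
  · simp only [leadingOp, direction, Sum.elim_inl]
    split_ifs
    · exact opX_mem_span p (hno _).symm
    · exact zero_mem _
  · simp only [leadingOp, direction, Sum.elim_inr, id]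
    split_ifs
    · exact opY_mem_span p (hno _).symm
    · rw [← p.W_zero]
      exact Submodule.subset_span ⟨0, map_zero _, rfl⟩
    · exact zero_mem _

variable {p f} in
lemma commute_leadingOp {T : p.Hilb →L[ℂ] p.Hilb}
    (h : ∀ i : Fin d, p.k (Fin.castLE hdd' i) = ⊤ → Commute T (p.U (f (Fin.castLE hdd' i))))
    (i : Fin d ⊕ Fin d') : Commute T (leadingOp hdd' p f i) := by
  rcases i with i | j
  · simp only [leadingOp]
    split_ifs with h1
    · exact commute_opX (h i h1)
    · exact Commute.zero_right _
  · simp only [leadingOp]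
    split_ifs with h1 h2
    · exact commute_opY (h ⟨j, h2⟩ h1)
    · exact Commute.one_right _
    · exact Commute.zero_right _

lemma mulOp_symbol_of_ne_top {j : Fin d'} (h : p.k j ≠ ⊤) (x : ℝ) :
    (mulOp (p.symbol j x) : p.Hilb →L[ℂ] p.Hilb) = 0 := by
  ext ξ m
  rw [mulOp_apply (p.exists_norm_symbol_le j x), Xi.symbol, p.infCoord_of_ne_top h]
  simp

/-- Ellipticity: each direction of infinite order receives total coefficient 1, either $X_j^2+Y_j^2$
or the single coefficient 1 beyond $d$, while symbols of finite order vanish. The remaining symbols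
and the top one form a unit vector at each point. -/
lemma sum_leadingOp_sq (x : ℝ) :
    ∑ i, leadingOp hdd' p f i * leadingOp hdd' p f i *
        (mulOp (p.symbol (direction hdd' i) x) * mulOp (p.symbol (direction hdd' i) x)) +
      mulOp (p.symbolTop x) * mulOp (p.symbolTop x) = 1 := by
  classical
  have h1 : ∑ i, leadingOp hdd' p f i * leadingOp hdd' p f i *
        (mulOp (p.symbol (direction hdd' i) x) * mulOp (p.symbol (direction hdd' i) x)) =
      ∑ j, mulOp (p.symbol j x) * mulOp (p.symbol j x) := by
    rw [Fintype.sum_sum_type]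
    simp only [leadingOp, direction, Sum.elim_inl, Sum.elim_inr, id]
    rw [sum_castLE hdd' (fun j => (if p.k j = ⊤ then opX p f j else 0) *
      (if p.k j = ⊤ then opX p f j else 0) * (mulOp (p.symbol j x) * mulOp (p.symbol j x))),
      ← Finset.sum_add_distrib]
    refine Finset.sum_congr rfl fun j _ => ?_
    by_cases hk : p.k j = ⊤
    · simp only [if_pos hk]
      split_ifs
      · rw [← add_mul, opX_sq_add_opY_sq, one_mul]
      · rw [zero_add, one_mul, one_mul]
    · rw [mulOp_symbol_of_ne_top p hk]
      simp
  rw [h1]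
  ext ξ m
  rw [add_apply, lp.coeFn_add, Pi.add_apply, sum_apply, lp.coeFn_sum, Finset.sum_apply,
    mul_apply_eq_comp, mulOp_apply (p.exists_norm_symbolTop_le x),
    mulOp_apply (p.exists_norm_symbolTop_le x)]
  have h2 : ∀ j ∈ Finset.univ, ((mulOp (p.symbol j x) * mulOp (p.symbol j x) :
      p.Hilb →L[ℂ] p.Hilb) ξ) m = p.symbol j x m * p.symbol j x m * ξ m := fun j _ => by
    rw [mul_apply_eq_comp, mulOp_apply (p.exists_norm_symbol_le j x),
      mulOp_apply (p.exists_norm_symbol_le j x), smul_eq_mul, smul_eq_mul, mul_assoc]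
  rw [Finset.sum_congr rfl h2, ← Finset.sum_mul, smul_eq_mul, smul_eq_mul, ← mul_assoc, ← add_mul,
    p.sum_symbol_sq_add, one_mul]
  rfl

lemma span_W_image_le (s : Set p.G) :
    Submodule.span ℂ (p.W '' s) ≤ Submodule.span ℂ (Set.range p.W) :=
  Submodule.span_mono (Set.image_subset_range _ _)

variable {f} in
lemma star_commutator_opX (j : Fin d') :
    star (p.commutator (opX p f j)) = p.commutator (opX p f j) := by
  have h : opX p f j ∈ Submodule.span ℂ (Set.range p.W) := by
    rw [opX, Xi.rePart_U]
    exact add_mem (Submodule.smul_mem _ _ (Submodule.subset_span ⟨_, rfl⟩))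
      (Submodule.smul_mem _ _ (Submodule.subset_span ⟨_, rfl⟩))
  rw [Xi.commutator, star_sub, p.star_rightMul_of_mem_span h, star_opX]

variable {f} in
lemma star_commutator_opY (j : Fin d') :
    star (p.commutator (opY p f j)) = p.commutator (opY p f j) := by
  have h : opY p f j ∈ Submodule.span ℂ (Set.range p.W) := by
    rw [opY, Xi.imPart_U]
    exact Submodule.smul_mem _ _ (add_mem
      (Submodule.smul_mem _ _ (Submodule.subset_span ⟨_, rfl⟩))
      (Submodule.smul_mem _ _ (Submodule.subset_span ⟨_, rfl⟩)))
  rw [Xi.commutator, star_sub, p.star_rightMul_of_mem_span h, star_opY]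

/-- Each nonzero term is a purely imaginary multiple of a self-adjoint operator; the sign is
compensated by the skew-adjoint Clifford generators. -/
lemma star_boundedOp (i : Fin d ⊕ Fin d') :
    star (boundedOp hdd' p f i) = -boundedOp hdd' p f i := by
  have h1 : ∀ N : ℕ, star ((N : ℂ) / (2 * Complex.I * Real.pi)) =
      -((N : ℂ) / (2 * Complex.I * Real.pi)) := fun N => by
    simp [div_neg]
  have h2 : ∀ N : ℕ, star (-(N : ℂ) / (2 * Complex.I * Real.pi)) =
      -(-(N : ℂ) / (2 * Complex.I * Real.pi)) := fun N => by
    rw [neg_div, star_neg, h1]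
  rcases i with i | j
  · simp only [boundedOp]
    split_ifs
    · simp
    · rw [star_smul, h2, star_commutator_opY, neg_smul]
  · simp only [boundedOp]
    split_ifs
    · simp
    · rw [star_smul, h1, star_commutator_opX, neg_smul]
    · rw [star_smul, h1, star_sub, star_one, Xi.star_imPart, neg_smul]

end LeadingOp

/-! ### Self-adjointness and compact resolvent of the Dirac operator. -/

section Ellipticity

variable {d d' : ℕ} (hdd' : d ≤ d') (p : Xi d') (f : Equiv.Perm (Fin d'))
  {𝒞 : Type*} [NormedAddCommGroup 𝒞] [InnerProductSpace ℂ 𝒞] [CompleteSpace 𝒞]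
  [FiniteDimensional ℂ 𝒞] (c : CliffordAlgebra (cliffordForm (d + d')) →ₐ[ℂ] (𝒞 →L[ℂ] 𝒞))

/-- The principal coefficients of the Dirac operator. -/
noncomputable def principalOp (i : Fin d ⊕ Fin d') : L2 p.G 𝒞 →L[ℂ] L2 p.G 𝒞 :=
  amp p.G 𝒞 (leadingOp hdd' p f i) * lpMap (cliffordOp c i)

/-- The bounded part of the Dirac operator. -/
noncomputable def boundedPart : L2 p.G 𝒞 →L[ℂ] L2 p.G 𝒞 :=
  ∑ i, amp p.G 𝒞 (boundedOp hdd' p f i) * lpMap (cliffordOp c i)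

lemma diracOp_mulOp_invWeight (x : ℝ) (η : L2 p.G 𝒞) :
    diracOp hdd' p f c ⟨mulOp (p.invWeight x) η, mulOp_invWeight_mem_sobolev p x η⟩ =
      (Complex.I • ∑ i, principalOp hdd' p f c i * mulOp (p.symbol (direction hdd' i) x) +
        boundedPart hdd' p f c * mulOp (p.invWeight x) : L2 p.G 𝒞 →L[ℂ] L2 p.G 𝒞) η := by
  have h1 : ∀ i, tensorOp p (gammaOp hdd' p f i) (cliffordOp c i)
      ⟨mulOp (p.invWeight x) η, mulOp_invWeight_mem_sobolev p x η⟩ =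
      amp p.G 𝒞 (Complex.I • (leadingOp hdd' p f i * mulOp (p.symbol (direction hdd' i) x)) +
        boundedOp hdd' p f i * mulOp (p.invWeight x)) (lpMap (cliffordOp c i) η) := by
    intro i
    refine tensorOp_eq_of_forall_coord p fun j => ?_
    have h2 : (⟨coord p.G 𝒞 j (mulOp (p.invWeight x) η),
        coord_mem_sobolev p j ⟨_, mulOp_invWeight_mem_sobolev p x η⟩⟩ : p.sobolev ℂ) =
        ⟨mulOp (p.invWeight x) (coord p.G 𝒞 j η), mulOp_invWeight_mem_sobolev p x _⟩ := by
      ext1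
      exact (mulOp_lpMap (p.exists_norm_invWeight_le x) _ _).symm
    simp only [h2]
    rw [gammaOp_apply, partialDeriv_mulOp_invWeight, map_smul]
    rfl
  refine (diracOp_apply hdd' p f c ⟨_, mulOp_invWeight_mem_sobolev p x η⟩).trans ?_
  rw [Finset.sum_congr rfl fun i _ => h1 i]
  simp only [map_add, map_smul, map_mul, amp_mulOp (p.exists_norm_symbol_le _ x),
    amp_mulOp (p.exists_norm_invWeight_le x)]
  rw [add_apply, smul_apply, sum_apply, boundedPart, Finset.sum_mul, sum_apply, Finset.smul_sum,
    ← Finset.sum_add_distrib]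
  refine Finset.sum_congr rfl fun i _ => ?_
  simp only [add_apply, smul_apply, mul_apply_eq_comp, principalOp,
    mulOp_lpMap (p.exists_norm_symbol_le _ x), mulOp_lpMap (p.exists_norm_invWeight_le x)]

variable {c}

lemma star_principalOp (hc : IsFaithfulStarRep c) (i : Fin d ⊕ Fin d') :
    star (principalOp hdd' p f c i) = -principalOp hdd' p f c i := by
  rw [principalOp, star_mul, star_lpMap, star_cliffordOp hc, ← map_star, star_leadingOp,
    ← (commute_amp_lpMap _ _).eq, ← mul_neg]
  rfl

lemma commute_mulOp_lpMap {w : p.G → ℂ} (h : ∃ C, ∀ m, ‖w m‖ ≤ C) (t : 𝒞 →L[ℂ] 𝒞) :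
    Commute (mulOp w : L2 p.G 𝒞 →L[ℂ] L2 p.G 𝒞) (lpMap t) := by
  ext1 ξ
  exact mulOp_lpMap h t ξ

variable {f} in
lemma invWeight_mul_principalOp_mul_symbol (hno : ∀ j, f j ≠ j) (i : Fin d ⊕ Fin d') (x : ℝ) :
    mulOp (p.invWeight x) * principalOp hdd' p f c i * mulOp (p.symbol (direction hdd' i) x) =
      mulOp (p.symbol (direction hdd' i) x) * principalOp hdd' p f c i *
        mulOp (p.invWeight x) := by
  have h := congrArg (amp p.G 𝒞)
    (p.invWeight_mul_mul_symbol x (leadingOp_mem_span hdd' p hno i))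
  simp only [map_mul, amp_mulOp (p.exists_norm_symbol_le _ x),
    amp_mulOp (p.exists_norm_invWeight_le x)] at h
  rw [principalOp, mul_assoc, mul_assoc _ (lpMap _),
    ← (commute_mulOp_lpMap p (p.exists_norm_symbol_le _ x) _).eq, ← mul_assoc, ← mul_assoc, h,
    mul_assoc _ (amp p.G 𝒞 _ * _), mul_assoc (amp p.G 𝒞 _),
    ← (commute_mulOp_lpMap p (p.exists_norm_invWeight_le x) _).eq]
  simp only [mul_assoc]

/-- In directions of infinite order the $U_{f(j)}$ commute with every generator, so the leading
coefficients commute and the sign comes from the Clifford factors alone. -/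
lemma principalOp_anticomm
    (htop : ∀ i : Fin d, p.k (Fin.castLE hdd' i) = ⊤ →
      ∀ s, Commute (p.U (f (Fin.castLE hdd' i))) (p.U s))
    {i s : Fin d ⊕ Fin d'} (h : i ≠ s) :
    principalOp hdd' p f c i * principalOp hdd' p f c s +
      principalOp hdd' p f c s * principalOp hdd' p f c i = 0 := by
  have h1 : Commute (leadingOp hdd' p f i) (leadingOp hdd' p f s) :=
    commute_leadingOp hdd' (fun j hj =>
      (commute_leadingOp hdd' (fun t ht => (htop t ht _).symm) i).symm) s
  have h2 : ∀ a b : Fin d ⊕ Fin d', principalOp hdd' p f c a * principalOp hdd' p f c b =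
      amp p.G 𝒞 (leadingOp hdd' p f a * leadingOp hdd' p f b) *
        lpMap (cliffordOp c a * cliffordOp c b) := by
    intro a b
    rw [principalOp, principalOp, mul_assoc, ← mul_assoc (lpMap _), ← (commute_amp_lpMap _ _).eq,
      map_mul, lpMap_mul]
    simp only [mul_assoc]
  rw [h2, h2, h1.eq, ← mul_add]
  have h3 : (lpMap (cliffordOp c i * cliffordOp c s) + lpMap (cliffordOp c s * cliffordOp c i) :
      L2 p.G 𝒞 →L[ℂ] L2 p.G 𝒞) = lpMap (cliffordOp c i * cliffordOp c s +
        cliffordOp c s * cliffordOp c i) := by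
    ext ξ m
    rfl
  rw [h3, cliffordOp_anticomm h]
  have h4 : (lpMap (0 : 𝒞 →L[ℂ] 𝒞) : L2 p.G 𝒞 →L[ℂ] L2 p.G 𝒞) = 0 := by
    ext ξ m
    rfl
  rw [h4, mul_zero]

lemma principalOp_sq (i : Fin d ⊕ Fin d') :
    principalOp hdd' p f c i * principalOp hdd' p f c i =
      -amp p.G 𝒞 (leadingOp hdd' p f i * leadingOp hdd' p f i) := by
  rw [principalOp, mul_assoc, ← mul_assoc (lpMap _), ← (commute_amp_lpMap _ _).eq,
      map_mul]
  have h : (lpMap (cliffordOp c i) * lpMap (cliffordOp c i) : L2 p.G 𝒞 →L[ℂ] L2 p.G 𝒞) = -1 := by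
    rw [← lpMap_mul, cliffordOp_sq]
    ext ξ m
    rfl
  rw [mul_assoc, h, mul_neg, mul_neg, mul_one]

lemma norm_amp_le (a : p.Hilb →L[ℂ] p.Hilb) : ‖amp p.G 𝒞 a‖ ≤ ‖a‖ :=
  NonUnitalStarAlgHom.norm_apply_le (amp p.G 𝒞) a

variable {f} in
-- The Clifford factor commutes with multiplication operators, so only the coefficient on
-- $\ell^2(G)$, a finite combination of translations, contributes.
lemma tendsto_commutator_principalOp (hno : ∀ j, f j ≠ j) {w : ℝ → p.G → ℂ}
    (hw : ∀ x, ∃ C, ∀ m, ‖w x m‖ ≤ C)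
    (hw' : ∀ x m g, ‖w x m - w x (m - g)‖ ≤
      2 * Real.sqrt (p.sq g) * (Real.sqrt (1 + x ^ 2))⁻¹) (i : Fin d ⊕ Fin d') :
    Tendsto (fun x => mulOp (w x) * principalOp hdd' p f c i -
      principalOp hdd' p f c i * mulOp (w x)) atTop (𝓝 0) := by
  have h1 := p.tendsto_commutator_of_mem_span hw hw'
    (span_W_image_le p _ (leadingOp_mem_span hdd' p hno i))
  have h2 : Tendsto (fun x => amp p.G 𝒞 (mulOp (w x) * leadingOp hdd' p f i -
      leadingOp hdd' p f i * mulOp (w x))) atTop (𝓝 0) :=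
    squeeze_zero_norm (fun x => norm_amp_le p _) (by simpa using h1.norm)
  refine (tendsto_zero_mul_of_norm_le (u := fun _ => lpMap (cliffordOp c i))
    (fun _ => le_rfl) h2).congr fun x => ?_
  rw [map_sub, map_mul, map_mul, amp_mulOp (hw x), principalOp, sub_mul, mul_assoc, mul_assoc,
    mul_assoc, (commute_mulOp_lpMap p (hw x) _).eq]

variable {f} in
/-- The Dirac operator is self-adjoint and has a compact resolvent. -/
theorem isSelfAdjoint_diracOp (hc : IsFaithfulStarRep c) (hno : ∀ j, f j ≠ j)
    (htop : ∀ i : Fin d, p.k (Fin.castLE hdd' i) = ⊤ →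
      ∀ s, Commute (p.U (f (Fin.castLE hdd' i))) (p.U s)) :
    IsSelfAdjoint (diracOp hdd' p f c) ∧ HasCompactResolvent (diracOp hdd' p f c) := by
  set T := principalOp hdd' p f c with hT
  set b : Fin d ⊕ Fin d' → ℝ → (L2 p.G 𝒞 →L[ℂ] L2 p.G 𝒞) :=
    fun i x => mulOp (p.symbol (direction hdd' i) x) with hb
  set t : ℝ → (L2 p.G 𝒞 →L[ℂ] L2 p.G 𝒞) := fun x => mulOp (p.symbolTop x) with ht
  set r : ℝ → (L2 p.G 𝒞 →L[ℂ] L2 p.G 𝒞) := fun x => mulOp (p.invWeight x) with hr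
  set B := boundedPart hdd' p f c with hB
  have hrn : ∀ x, ‖r x‖ ≤ (Real.sqrt (1 + x ^ 2))⁻¹ := fun x =>
    norm_mulOp_le (by positivity) (p.norm_invWeight_le x)
  have hrn1 : ∀ x, ‖r x‖ ≤ 1 := fun x => norm_mulOp_le one_pos.le (p.norm_invWeight_le_one x)
  have hS : Tendsto (fun x => B * r x) atTop (𝓝 0) :=
    tendsto_mul_zero_of_norm_le (u := fun _ => B) (fun _ => le_rfl)
      (squeeze_zero_norm hrn Xi.tendsto_inv_sqrt)
  have hsum : ∀ x, -(∑ i, T i * T i * (b i x * b i x)) + t x * t x = 1 := by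
    intro x
    have h1 := congrArg (amp p.G 𝒞) (sum_leadingOp_sq hdd' p f x)
    simp only [map_add, map_sum, map_mul, map_one, amp_mulOp (p.exists_norm_symbol_le _ x),
      amp_mulOp (p.exists_norm_symbolTop_le x)] at h1
    rw [← h1, ← Finset.sum_neg_distrib]
    congr 1
    refine Finset.sum_congr rfl fun i _ => ?_
    rw [hT, principalOp_sq, neg_mul, neg_neg, map_mul]
  have hbn : ∀ i x, ‖b i x‖ ≤ 1 := fun i x => norm_mulOp_le one_pos.le (p.norm_symbol_le _ x)
  have htn : ∀ x, ‖t x‖ ≤ 1 := fun x => norm_mulOp_le one_pos.le (p.norm_symbolTop_le x)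
  have hbb : ∀ i s x, Commute (b i x) (b s x) := fun i s x =>
    mulOp_comm (p.exists_norm_symbol_le _ x) (p.exists_norm_symbol_le _ x)
  have hbt : ∀ i x, Commute (b i x) (t x) := fun i x =>
    mulOp_comm (p.exists_norm_symbol_le _ x) (p.exists_norm_symbolTop_le x)
  have hbT : ∀ i s, Tendsto (fun x => b i x * T s - T s * b i x) atTop (𝓝 0) := fun i s =>
    tendsto_commutator_principalOp hdd' p hno (p.exists_norm_symbol_le _)
      (fun x m g => p.norm_symbol_sub_le _ x m g) s
  have htT : ∀ s, Tendsto (fun x => t x * T s - T s * t x) atTop (𝓝 0) := fun s =>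
    tendsto_commutator_principalOp hdd' p hno p.exists_norm_symbolTop_le
      (fun x m g => p.norm_symbolTop_sub_le x m g) s
  have hanti : ∀ i s, i ≠ s → T i * T s + T s * T i = 0 := fun i s his =>
    principalOp_anticomm hdd' p f htop his
  have hBC : ∀ x, ‖B * r x‖ ≤ max 1 ‖B‖ := fun x => (norm_mul_le _ _).trans <|
    (mul_le_of_le_one_right (norm_nonneg _) (hrn1 x)).trans (le_max_right _ _)
  have hlim1 := tendsto_parametrix_mul (C := max 1 ‖B‖) hanti hbb (Eventually.of_forall hsum)
    (fun i x => (hbn i x).trans (le_max_left _ _)) (fun x => (htn x).trans (le_max_left _ _)) hbt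
    hbT htT hS hBC
  -- Changing the sign of the top symbol exchanges the two factors, which gives the product in the
  -- other order.
  have hlim2 := tendsto_parametrix_mul (C := max 1 ‖B‖) (c := fun x => -t x) hanti hbb
    (Eventually.of_forall fun x => by rw [neg_mul_neg]; exact hsum x)
    (fun i x => (hbn i x).trans (le_max_left _ _))
    (fun x => by rw [norm_neg]; exact (htn x).trans (le_max_left _ _))
    (fun i x => (hbt i x).neg_right) hbT (fun s => by
      have := (htT s).neg
      rw [neg_zero] at this
      exact this.congr fun x => by noncomm_ring) hS hBC
  have hunit : ∀ᶠ y in 𝓝 (1 : L2 p.G 𝒞 →L[ℂ] L2 p.G 𝒞), IsUnit y :=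
    Units.isOpen.mem_nhds isUnit_one
  obtain ⟨x, hx1, hx2⟩ := ((hlim1.eventually hunit).and (hlim2.eventually hunit)).exists
  set K := Complex.I • ∑ i, T i * b i x - Complex.I • t x + B * r x with hK
  set K' := Complex.I • ∑ i, T i * b i x + Complex.I • t x + B * r x with hK'
  simp only [smul_neg, sub_neg_eq_add, ← sub_eq_add_neg] at hx2
  -- Invertibility of both $KK'$ and $K'K$ provides each factor with inverses on both sides.
  obtain ⟨hu, hu'⟩ : IsUnit K ∧ IsUnit K' := by
    obtain ⟨u, hu⟩ := hx1
    obtain ⟨v, hv⟩ := hx2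
    have h1 : K * (K' * ↑u⁻¹) = 1 := by rw [← mul_assoc, ← hu, Units.mul_inv]
    have h2 : (↑v⁻¹ * K') * K = 1 := by rw [mul_assoc, ← hv, Units.inv_mul]
    have h3 : K' * (K * ↑v⁻¹) = 1 := by rw [← mul_assoc, ← hv, Units.mul_inv]
    have h4 : (↑u⁻¹ * K) * K' = 1 := by rw [mul_assoc, ← hu, Units.inv_mul]
    exact ⟨isUnit_iff_exists_and_exists.2 ⟨⟨_, h1⟩, ⟨_, h2⟩⟩,
      isUnit_iff_exists_and_exists.2 ⟨⟨_, h3⟩, ⟨_, h4⟩⟩⟩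
  have hDr : ∀ η, diracOp hdd' p f c ⟨r x η, mulOp_invWeight_mem_sobolev p x η⟩ =
      (Complex.I • ∑ i, T i * b i x + B * r x) η := diracOp_mulOp_invWeight hdd' p f c x
  have htr : ∀ η, (Complex.I * (Real.sqrt (1 + x ^ 2) : ℝ)) • r x η = (Complex.I • t x) η := by
    intro η
    ext m
    rw [smul_apply, lp.coeFn_smul, lp.coeFn_smul, Pi.smul_apply, Pi.smul_apply,
      mulOp_apply (p.exists_norm_invWeight_le x), mulOp_apply (p.exists_norm_symbolTop_le x),
      smul_smul, smul_smul, Xi.invWeight, Xi.symbolTop]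
    push_cast
    rw [mul_assoc]
  -- symmetry
  have hrstar : star (r x) = r x := by
    rw [hr, star_mulOp (p.exists_norm_invWeight_le x)]
    exact congrArg mulOp (funext fun m => Complex.conj_ofReal _)
  have hbstar : ∀ i, star (b i x) = b i x := fun i => by
    rw [hb, star_mulOp (p.exists_norm_symbol_le _ x)]
    exact congrArg mulOp (funext fun m => Complex.conj_ofReal _)
  have hBstar : star B = B := by
    rw [hB, boundedPart, star_sum]
    refine Finset.sum_congr rfl fun i _ => ?_
    rw [star_mul, star_lpMap, star_cliffordOp hc, ← map_star, star_boundedOp,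
      ← (commute_amp_lpMap _ _).eq, map_neg, neg_mul, ← mul_neg]
    congr 1
    ext ξ m
    simp
  -- Symmetry of $D$ is the self-adjointness of the bounded operator $r_xDr_x$. Taking adjoints of
  -- its leading terms exchanges $r_x$ with the symbol, which `invWeight_mul_principalOp_mul_symbol`
  -- undoes.
  have hsa : star (r x * (Complex.I • ∑ i, T i * b i x + B * r x)) =
      r x * (Complex.I • ∑ i, T i * b i x + B * r x) := by
    rw [mul_add, star_add, ← mul_assoc (r x) B, star_mul _ (r x), star_mul (r x) B, hrstar, hBstar,
      mul_assoc, mul_smul_comm, star_smul, Finset.mul_sum, star_sum]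
    congr 1
    simp only [Complex.star_def, Complex.conj_I, neg_smul, ← smul_neg, ← Finset.sum_neg_distrib]
    congr 1
    refine Finset.sum_congr rfl fun i _ => ?_
    rw [star_mul, star_mul, hrstar, hbstar, star_principalOp hdd' p f hc, mul_neg, neg_mul, neg_neg,
      ← mul_assoc, invWeight_mul_principalOp_mul_symbol hdd' p hno i x]
  refine isSelfAdjoint_and_hasCompactResolvent (dense_sobolev p) (fun ξ η => ?_)
    (Real.sqrt (1 + x ^ 2)) (isCompactOperator_mulOp (p.tendsto_invWeight_cofinite x))
    (fun η => mulOp_invWeight_mem_sobolev p x η)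
    (fun ξ hξ => exists_mulOp_invWeight_eq p x hξ) (K := K) (K' := K')
    (fun η => ?_) (fun η => ?_) hu hu'
  · obtain ⟨ξ', hξ'⟩ := exists_mulOp_invWeight_eq p x ξ.2
    obtain ⟨η', hη'⟩ := exists_mulOp_invWeight_eq p x η.2
    have h1 : ξ = ⟨r x ξ', mulOp_invWeight_mem_sobolev p x ξ'⟩ := Subtype.ext hξ'.symm
    have h2 : η = ⟨r x η', mulOp_invWeight_mem_sobolev p x η'⟩ := Subtype.ext hη'.symm
    rw [h1, h2, hDr, hDr]
    change inner ℂ _ (r x η') = inner ℂ (r x ξ') _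
    rw [← ContinuousLinearMap.adjoint_inner_left (r x), ← ContinuousLinearMap.star_eq_adjoint,
      ← ContinuousLinearMap.adjoint_inner_right (r x), ← ContinuousLinearMap.star_eq_adjoint,
      hrstar, ← mul_apply_eq_comp, ← mul_apply_eq_comp]
    nth_rewrite 1 [← hsa]
    rw [ContinuousLinearMap.star_eq_adjoint, ContinuousLinearMap.adjoint_inner_left]
  · rw [hDr, htr, hK, ← sub_apply]
    congr 1
    abel
  · rw [hDr, htr, hK', ← add_apply]
    congr 1
    abel

end Ellipticity

/-! ### Schur multipliers and uniform truncation of matrices with bounded derivatives. -/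

section Multipliers

variable {G : Type*}

open Classical in
/-- The canonical basis vector of `ℓ²(G)` at `n`. -/
noncomputable def basisVec (n : G) : L2 G ℂ := lp.single 2 n 1

lemma basisVec_apply_self (n : G) : basisVec n n = 1 := by
  classical exact lp.single_apply_self _ _ _

lemma basisVec_apply_of_ne {m n : G} (h : m ≠ n) : basisVec n m = 0 := by
  classical exact lp.single_apply_ne _ _ _ h

lemma norm_basisVec (n : G) : ‖basisVec n‖ = 1 := by
  classical rw [basisVec, lp.norm_single (by norm_num), norm_one]

lemma ext_basisVec {S T : L2 G ℂ →L[ℂ] L2 G ℂ}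
    (h : ∀ m n, S (basisVec n) m = T (basisVec n) m) : S = T := by
  classical
  ext1 ξ
  have h1 := lp.hasSum_single (by norm_num) ξ
  have h2 : ∀ n (z : ℂ), S (lp.single 2 n z) = T (lp.single 2 n z) := fun n z => by
    have h3 : (lp.single 2 n z : L2 G ℂ) = z • basisVec n := by
      rw [basisVec, ← lp.single_smul, smul_eq_mul, mul_one]
    rw [h3, map_smul, map_smul]
    congr 1
    ext m
    exact h m n
  have h4 := S.hasSum h1
  have h5 := T.hasSum h1
  simp only [h2] at h4
  exact h4.unique h5

lemma L2.enorm_sq_eq_tsum {E : Type*} [NormedAddCommGroup E] (f : L2 G E) :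
    ‖f‖ₑ ^ 2 = ∑' m, ‖f m‖ₑ ^ 2 := by
  have h := L2.norm_sq_eq_tsum f
  have h2 := congrArg ENNReal.ofReal h
  rw [ENNReal.ofReal_tsum_of_nonneg (fun m => by positivity) (L2.summable_norm_sq f),
    ENNReal.ofReal_pow (norm_nonneg _), ofReal_norm] at h2
  rw [h2]
  refine tsum_congr fun m => ?_
  rw [ENNReal.ofReal_pow (norm_nonneg _), ofReal_norm]

lemma L2.memℓp_of_tsum_ne_top {E : Type*} [NormedAddCommGroup E] {f : G → E}
    (h : ∑' m, ‖f m‖ₑ ^ 2 ≠ ⊤) : Memℓp f 2 := by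
  refine L2.memℓp_of_summable ?_
  have h1 := ENNReal.summable_toReal h
  simpa [ENNReal.toReal_pow, toReal_enorm] using h1

open Classical in
/-- The orthogonal projection of `ℓ²(G)` onto the space of all families supported on `g ⁻¹' {q}`. -/
noncomputable def fiberProj (g : G → ℤ) (q : ℤ) : L2 G ℂ →L[ℂ] L2 G ℂ :=
  mulOp fun m => if g m = q then 1 else 0

open Classical in
lemma fiberProj_apply (g : G → ℤ) (q : ℤ) (ξ : L2 G ℂ) (m : G) :
    fiberProj g q ξ m = if g m = q then ξ m else 0 := by
  rw [fiberProj, mulOp_apply ⟨1, fun m => by split_ifs <;> simp⟩]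
  split_ifs <;> simp

/-- The fibres of $g$ partition the group, so this is Pythagoras. -/
lemma tsum_enorm_fiberProj_sq (g : G → ℤ) (ξ : L2 G ℂ) :
    ∑' q, ‖fiberProj g q ξ‖ₑ ^ 2 = ‖ξ‖ₑ ^ 2 := by
  simp only [L2.enorm_sq_eq_tsum]
  rw [ENNReal.tsum_comm]
  refine tsum_congr fun m => ?_
  rw [tsum_eq_single (g m)]
  · rw [fiberProj_apply, if_pos rfl]
  · intro q hq
    rw [fiberProj_apply, if_neg hq.symm]
    simp

lemma tsum_tsum_enorm_apply_fiberProj_le (g : G → ℤ) (T : L2 G ℂ →L[ℂ] L2 G ℂ) (ξ : L2 G ℂ) :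
    ∑' m, ∑' q, ‖T (fiberProj g q ξ) m‖ₑ ^ 2 ≤ (‖T‖ₑ * ‖ξ‖ₑ) ^ 2 := by
  rw [ENNReal.tsum_comm]
  simp only [← L2.enorm_sq_eq_tsum]
  rw [mul_pow, ← tsum_enorm_fiberProj_sq g ξ, ← ENNReal.tsum_mul_left]
  refine ENNReal.tsum_le_tsum fun q => ?_
  rw [← mul_pow]
  exact pow_le_pow_left' (T.le_opENorm _) 2

/-- The family of the `m`-th components of the images by `T` of the homogeneous components of a
vector. -/
noncomputable def componentVec (g : G → ℤ) (T : L2 G ℂ →L[ℂ] L2 G ℂ) (m : G) :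
    L2 G ℂ →ₗ[ℂ] L2 ℤ ℂ where
  toFun ξ := ⟨fun q => T (fiberProj g q ξ) m, L2.memℓp_of_tsum_ne_top <|
    ((ENNReal.le_tsum m).trans (tsum_tsum_enorm_apply_fiberProj_le g T ξ)).trans_lt
      (ENNReal.pow_lt_top (ENNReal.mul_lt_top enorm_lt_top enorm_lt_top)) |>.ne⟩
  map_add' ξ η := by ext q; change T (fiberProj g q (ξ + η)) m = _; rw [map_add, map_add]; rfl
  map_smul' z ξ := by ext q; change T (fiberProj g q (z • ξ)) m = _; rw [map_smul, map_smul]; rfl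

lemma componentVec_apply (g : G → ℤ) (T : L2 G ℂ →L[ℂ] L2 G ℂ) (m : G) (ξ : L2 G ℂ) (q : ℤ) :
    componentVec g T m ξ q = T (fiberProj g q ξ) m := rfl

/-- The family `q ↦ conj (ψ (l - q))`. -/
noncomputable def reflectConj (ψ : L2 ℤ ℂ) (l : ℤ) : L2 ℤ ℂ :=
  ⟨fun q => conj (ψ (l - q)), memℓp_of_norm_eq (Equiv.subLeft l) (lp.memℓp ψ) fun q => by simp⟩

lemma enorm_reflectConj (ψ : L2 ℤ ℂ) (l : ℤ) : ‖reflectConj ψ l‖ₑ = ‖ψ‖ₑ := by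
  rw [← ofReal_norm, ← ofReal_norm, norm_eq_of_norm_eq (Equiv.subLeft l) ψ (reflectConj ψ l)]
  intro q
  simp [reflectConj]

/-- With $P_q$ the projection onto the fibre at $q$, the Schur product sends $\xi$ to
$m\mapsto\sum_q\psi(g(m)-q)(TP_q\xi)(m)$. Cauchy-Schwarz in $q$ extracts $\|\psi\|^2$, and summing
over $m$ leaves $\sum_q\|TP_q\xi\|^2\le\|T\|^2\|\xi\|^2$. -/
lemma tsum_enorm_inner_reflectConj_le (g : G → ℤ) (T : L2 G ℂ →L[ℂ] L2 G ℂ) (ψ : L2 ℤ ℂ)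
    (ξ : L2 G ℂ) :
    ∑' m, ‖inner ℂ (reflectConj ψ (g m)) (componentVec g T m ξ)‖ₑ ^ 2 ≤
      (‖ψ‖ₑ * (‖T‖ₑ * ‖ξ‖ₑ)) ^ 2 := by
  rw [mul_pow]
  refine le_trans ?_ (mul_le_mul_right (tsum_tsum_enorm_apply_fiberProj_le g T ξ) _)
  rw [← ENNReal.tsum_mul_left]
  refine ENNReal.tsum_le_tsum fun m => ?_
  have h1 : ∑' q, ‖T (fiberProj g q ξ) m‖ₑ ^ 2 = ‖componentVec g T m ξ‖ₑ ^ 2 :=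
    (L2.enorm_sq_eq_tsum (componentVec g T m ξ)).symm
  rw [h1, ← mul_pow, ← enorm_reflectConj ψ (g m)]
  refine pow_le_pow_left' ?_ 2
  rw [← ofReal_norm, ← ofReal_norm, ← ofReal_norm, ← ENNReal.ofReal_mul (norm_nonneg _)]
  exact ENNReal.ofReal_le_ofReal (norm_inner_le_norm _ _)

/-- The Schur product of a bounded operator and of the matrix `ψ (g m - g n)`, with `ψ` square
summable. -/
noncomputable def schurProd (g : G → ℤ) (ψ : L2 ℤ ℂ) (T : L2 G ℂ →L[ℂ] L2 G ℂ) :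
    L2 G ℂ →L[ℂ] L2 G ℂ :=
  LinearMap.mkContinuous
    { toFun := fun ξ => ⟨fun m => inner ℂ (reflectConj ψ (g m)) (componentVec g T m ξ),
        L2.memℓp_of_tsum_ne_top <| ((tsum_enorm_inner_reflectConj_le g T ψ ξ).trans_lt
          (ENNReal.pow_lt_top (ENNReal.mul_lt_top enorm_lt_top
            (ENNReal.mul_lt_top enorm_lt_top enorm_lt_top)))).ne⟩
      map_add' := fun ξ η => by ext m; exact (congrArg _ (map_add _ ξ η)).trans (inner_add_right _ _ _)
      map_smul' := fun z ξ => by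
        ext m
        exact (congrArg _ (map_smul _ z ξ)).trans (inner_smul_right _ _ _) }
    (‖ψ‖ * ‖T‖) fun ξ => by
      rw [← ENNReal.ofReal_le_ofReal_iff (by positivity), ofReal_norm, mul_assoc,
        ENNReal.ofReal_mul (norm_nonneg _), ENNReal.ofReal_mul (norm_nonneg _), ofReal_norm,
        ofReal_norm, ofReal_norm, ← (ENNReal.pow_right_strictMono two_ne_zero).le_iff_le,
        L2.enorm_sq_eq_tsum]
      exact tsum_enorm_inner_reflectConj_le g T ψ ξ

lemma norm_schurProd_le (g : G → ℤ) (ψ : L2 ℤ ℂ) (T : L2 G ℂ →L[ℂ] L2 G ℂ) :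
    ‖schurProd g ψ T‖ ≤ ‖ψ‖ * ‖T‖ :=
  LinearMap.mkContinuous_norm_le _ (by positivity) _

lemma schurProd_basisVec (g : G → ℤ) (ψ : L2 ℤ ℂ) (T : L2 G ℂ →L[ℂ] L2 G ℂ) (m n : G) :
    schurProd g ψ T (basisVec n) m = ψ (g m - g n) * T (basisVec n) m := by
  classical
  change inner ℂ (reflectConj ψ (g m)) (componentVec g T m (basisVec n)) = _
  have h1 : componentVec g T m (basisVec n) = lp.single 2 (g n) (T (basisVec n) m) := by
    ext q
    rw [componentVec_apply, lp.single_apply]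
    have h2 : fiberProj g q (basisVec n) = if g n = q then basisVec n else 0 := by
      ext x
      rw [fiberProj_apply]
      by_cases hx : x = n
      · subst hx
        split_ifs <;> simp
      · rw [basisVec_apply_of_ne hx, ite_self]
        split_ifs
        · exact (basisVec_apply_of_ne hx).symm
        · rfl
    rw [h2]
    by_cases hq : q = g n
    · subst hq
      simp
    · rw [if_neg (Ne.symm hq), map_zero, Pi.single_eq_of_ne hq]
      rfl
  rw [h1, lp.inner_single_right]
  simp [reflectConj, mul_comm]

variable [AddCommGroup G]

/-- The function `Ψ` defines a bounded Schur multiplier `Ψ (m - n)`. -/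
def IsMultiplier (Ψ : G → ℂ) (C : ℝ) : Prop :=
  ∀ T : L2 G ℂ →L[ℂ] L2 G ℂ, ∃ S : L2 G ℂ →L[ℂ] L2 G ℂ,
    (∀ m n, S (basisVec n) m = Ψ (m - n) * T (basisVec n) m) ∧ ‖S‖ ≤ C * ‖T‖

lemma IsMultiplier.mul {Ψ Ψ' : G → ℂ} {C C' : ℝ} (hC : 0 ≤ C) (h : IsMultiplier Ψ C)
    (h' : IsMultiplier Ψ' C') : IsMultiplier (fun m => Ψ m * Ψ' m) (C * C') := by
  intro T
  obtain ⟨S', hS', hn'⟩ := h' T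
  obtain ⟨S, hS, hn⟩ := h S'
  refine ⟨S, fun m n => by rw [hS, hS', mul_assoc], hn.trans ?_⟩
  rw [mul_assoc]
  exact mul_le_mul_of_nonneg_left hn' hC

lemma isMultiplier_one : IsMultiplier (fun _ : G => 1) 1 := fun T =>
  ⟨T, fun m n => by rw [one_mul], by rw [one_mul]⟩

lemma isMultiplier_comp (g : G →+ ℤ) (ψ : L2 ℤ ℂ) : IsMultiplier (fun m => ψ (g m)) ‖ψ‖ :=
  fun T => ⟨schurProd g ψ T, fun m n =>
    (schurProd_basisVec g ψ T m n).trans (by simp only [map_sub]),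
    norm_schurProd_le g ψ T⟩

/-- The indicator function of a finite set of integers. -/
noncomputable def indicatorVec (F : Finset ℤ) : L2 ℤ ℂ := ∑ q ∈ F, basisVec q

lemma indicatorVec_apply (F : Finset ℤ) (l : ℤ) :
    indicatorVec F l = if l ∈ F then 1 else 0 := by
  rw [indicatorVec, lp.coeFn_sum, Finset.sum_apply]
  have h : ∀ q ∈ F, basisVec q l = if l = q then (1 : ℂ) else 0 := fun q _ => by
    split_ifs with h
    · rw [h, basisVec_apply_self]
    · exact basisVec_apply_of_ne h
  rw [Finset.sum_congr rfl h, Finset.sum_ite_eq]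

/-- The function `l ↦ 1 / l` is a limit in `ℓ²(ℤ)` of its truncations. -/
lemma exists_truncation {ε : ℝ} (hε : 0 < ε) :
    ∃ (F : Finset ℤ) (ψ : L2 ℤ ℂ), ‖ψ‖ ≤ ε ∧ ∀ l : ℤ, ψ l * l = 1 - indicatorVec F l := by
  have hmem : Memℓp (fun l : ℤ => ((l : ℂ))⁻¹) 2 := by
    refine L2.memℓp_of_summable ?_
    have := (Real.summable_one_div_int_pow (p := 2)).2 one_lt_two
    refine this.congr fun l => ?_
    rw [norm_inv, Complex.norm_intCast, inv_pow, sq_abs, one_div]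
  set v : L2 ℤ ℂ := ⟨_, hmem⟩ with hv
  have h1 := lp.hasSum_single (by norm_num) v
  have h2 := (Metric.tendsto_atTop.1 h1) ε hε
  obtain ⟨F, hF⟩ := h2
  -- The point 0 is put in the truncation set because the required identity at $l=0$ forces the
  -- indicator to be 1 there.
  refine ⟨insert 0 F, v - ∑ l ∈ insert 0 F, lp.single 2 l (v l), ?_, fun l => ?_⟩
  · have := hF (insert 0 F) (Finset.subset_insert _ _)
    rw [dist_comm, dist_eq_norm] at this
    exact this.le
  · have h3 : (v - ∑ l ∈ insert 0 F, lp.single 2 l (v l) : L2 ℤ ℂ) l =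
        v l - if l ∈ insert 0 F then v l else 0 := by
      rw [lp.coeFn_sub, Pi.sub_apply, lp.coeFn_sum, Finset.sum_apply]
      have h : ∀ q ∈ insert 0 F, (lp.single 2 q (v q) : L2 ℤ ℂ) l = if l = q then v l else 0 := by
        intro q _
        rw [lp.single_apply]
        split_ifs with h
        · rw [h, Pi.single_eq_same]
        · rw [Pi.single_eq_of_ne h]
      rw [Finset.sum_congr rfl h, Finset.sum_ite_eq]
    rw [h3, indicatorVec_apply]
    split_ifs with hl
    · simp
    · have h0 : (l : ℂ) ≠ 0 := by
        intro h0
        refine hl (Finset.mem_insert.2 (Or.inl ?_))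
        exact_mod_cast h0
      rw [sub_zero, sub_zero, hv]
      exact inv_mul_cancel₀ h0

/-- Operators with bounded derivatives are approximated, uniformly, by their truncations. -/
theorem exists_uniform_truncation {ι : Type*} (g : ι → G →+ ℤ) (s : Finset ι) {ε : ℝ}
    (hε : 0 < ε) :
    ∃ (F : ι → Finset ℤ) (C : ℝ), 0 ≤ C ∧
      IsMultiplier (fun m => ∏ j ∈ s, indicatorVec (F j) (g j m)) C ∧
      ∀ T : L2 G ℂ →L[ℂ] L2 G ℂ,
        (∀ j, ∃ T' : L2 G ℂ →L[ℂ] L2 G ℂ, ‖T'‖ ≤ 1 ∧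
          ∀ m n, T' (basisVec n) m = (g j (m - n) : ℂ) * T (basisVec n) m) →
        ∃ S : L2 G ℂ →L[ℂ] L2 G ℂ, ‖T - S‖ ≤ ε ∧
          ∀ m n, S (basisVec n) m =
            (∏ j ∈ s, indicatorVec (F j) (g j (m - n))) * T (basisVec n) m := by
  classical
  induction s using Finset.induction_on generalizing ε with
  | empty =>
    refine ⟨fun _ => ∅, 1, one_pos.le, by simpa using isMultiplier_one, fun T _ => ⟨T, ?_, ?_⟩⟩
    · simpa using hε.le
    · simp
  | insert j s hj ih =>
    obtain ⟨F, C, hC, hmult, happ⟩ := ih (half_pos hε)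
    -- The new tail is chosen after the multiplier constant of the previous truncations, since these
    -- are then applied to it; `C + 1` avoids dividing by zero.
    obtain ⟨F', ψ, hψ, hψ'⟩ := exists_truncation (show 0 < ε / 2 / (C + 1) by positivity)
    have hF : ∀ m, (∏ i ∈ insert j s, indicatorVec (Function.update F j F' i) (g i m)) =
        indicatorVec F' (g j m) * ∏ i ∈ s, indicatorVec (F i) (g i m) := by
      intro m
      rw [Finset.prod_insert hj, Function.update_self]
      congr 1
      refine Finset.prod_congr rfl fun i hi => ?_
      rw [Function.update_of_ne (ne_of_mem_of_not_mem hi hj)]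
    refine ⟨Function.update F j F', ‖indicatorVec F'‖ * C, by positivity, ?_, fun T hT => ?_⟩
    · simp only [hF]
      exact IsMultiplier.mul (norm_nonneg _) (isMultiplier_comp (g j) (indicatorVec F')) hmult
    · obtain ⟨S₁, hS₁, hS₁'⟩ := happ T hT
      obtain ⟨T', hT', hT''⟩ := hT j
      obtain ⟨R, hR, hRn⟩ := isMultiplier_comp (g j) ψ T'
      obtain ⟨S₂, hS₂, hS₂n⟩ := hmult R
      -- The operator `S₂` is the truncation in the directions of `s` of the tail of $T$ in
      -- direction $j$, so subtracting it from `S₁` truncates in direction $j$ as well.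
      refine ⟨S₁ - S₂, ?_, fun m n => ?_⟩
      · have h1 : ‖S₂‖ ≤ ε / 2 := by
          have hR1 : ‖R‖ ≤ ε / 2 / (C + 1) :=
            hRn.trans ((mul_le_of_le_one_right (norm_nonneg _) hT').trans hψ)
          calc ‖S₂‖ ≤ C * (ε / 2 / (C + 1)) := hS₂n.trans (mul_le_mul_of_nonneg_left hR1 hC)
            _ ≤ (C + 1) * (ε / 2 / (C + 1)) := by gcongr; linarith
            _ = ε / 2 := by field_simp
        have h2 : T - (S₁ - S₂) = (T - S₁) + S₂ := by abel
        rw [h2]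
        exact (norm_add_le _ _).trans (by linarith)
      · have h3 := hψ' (g j (m - n))
        rw [sub_apply, lp.coeFn_sub, Pi.sub_apply, hS₁', hS₂, hR, hT'', hF,
          ← mul_assoc (ψ _), h3]
        ring

end Multipliers

/-! ### The spectral triple. -/

section SpectralTriple

variable {d d' : ℕ} (hdd' : d ≤ d') (p : Xi d') (f : Equiv.Perm (Fin d'))
  {𝒞 : Type*} [NormedAddCommGroup 𝒞] [InnerProductSpace ℂ 𝒞] [CompleteSpace 𝒞]
  [FiniteDimensional ℂ 𝒞] (c : CliffordAlgebra (cliffordForm (d + d')) →ₐ[ℂ] (𝒞 →L[ℂ] 𝒞))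

/-- By the Leibniz rule the derivation of $W^g$ is a multiple of $W^g$. Commutation with the leading
coefficient removes the only unbounded term. -/
lemma gammaOp_W_sub (g : p.G) (i : Fin d ⊕ Fin d') (h : Commute (p.W g) (leadingOp hdd' p f i))
    (ξ : p.sobolev ℂ) :
    gammaOp hdd' p f i ⟨p.W g ξ, W_mem_sobolev p g ξ.2 _⟩ - p.W g (gammaOp hdd' p f i ξ) =
      ((Complex.I * (p.infCoord (direction hdd' i) g : ℂ)) • (leadingOp hdd' p f i * p.W g) +
        (boundedOp hdd' p f i * p.W g - p.W g * boundedOp hdd' p f i)) (ξ : p.Hilb) := by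
  have h1 : ∀ η, p.W g (leadingOp hdd' p f i η) = leadingOp hdd' p f i (p.W g η) := fun η =>
    congrArg (fun T : p.Hilb →L[ℂ] p.Hilb => T η) h.eq
  rw [gammaOp_apply, gammaOp_apply, partialDeriv_W, map_add, map_add, map_smul, h1, add_apply,
    smul_apply, sub_apply]
  simp only [mul_apply_eq_comp]
  abel

variable {f} in
lemma commNorm_lt_top {a : subTorus hdd' p} {g : p.G} (ha : (a : p.Hilb →L[ℂ] p.Hilb) = p.W g)
    (h : ∀ i, Commute (p.W g) (leadingOp hdd' p f i)) :
    commNorm (torusRep hdd' p 𝒞) (diracOp hdd' p f c) a < ⊤ := by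
  set Z : Fin d ⊕ Fin d' → (p.Hilb →L[ℂ] p.Hilb) := fun i =>
    (Complex.I * (p.infCoord (direction hdd' i) g : ℂ)) • (leadingOp hdd' p f i * p.W g) +
        (boundedOp hdd' p f i * p.W g - p.W g * boundedOp hdd' p f i) with hZ
  have hrep : torusRep hdd' p 𝒞 a = amp p.G 𝒞 (p.W g) := congrArg (amp p.G 𝒞) ha
  have hmem : ∀ ξ : p.sobolev 𝒞, amp p.G 𝒞 (p.W g) (ξ : L2 p.G 𝒞) ∈ p.sobolev 𝒞 := fun ξ => by
    rw [Xi.W, amp_weightedPerm]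
    exact W_mem_sobolev p g ξ.2 _
  have hT : ∀ i (ξ : p.sobolev 𝒞), tensorOp p (gammaOp hdd' p f i) (cliffordOp c i)
      ⟨amp p.G 𝒞 (p.W g) (ξ : L2 p.G 𝒞), hmem ξ⟩ -
      amp p.G 𝒞 (p.W g) (tensorOp p (gammaOp hdd' p f i) (cliffordOp c i) ξ) =
      (lpMap (cliffordOp c i) * amp p.G 𝒞 (Z i) : L2 p.G 𝒞 →L[ℂ] L2 p.G 𝒞) (ξ : L2 p.G 𝒞) := by
    intro i ξ
    rw [tensorOp_apply, tensorOp_apply, map_sum, mul_apply_eq_comp, amp_apply (Z i) (ξ : L2 p.G 𝒞),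
      map_sum, ← Finset.sum_sub_distrib]
    refine Finset.sum_congr rfl fun s _ => ?_
    have h1 : (⟨coord p.G 𝒞 s (amp p.G 𝒞 (p.W g) (ξ : L2 p.G 𝒞)),
        coord_mem_sobolev p s ⟨_, hmem ξ⟩⟩ : p.sobolev ℂ) =
        ⟨p.W g (coord p.G 𝒞 s (ξ : L2 p.G 𝒞)),
          W_mem_sobolev p g (coord_mem_sobolev p s ξ) _⟩ := Subtype.ext (coord_amp _ _ _)
    rw [amp_tensorVec, lpMap_tensorVec, ← map_sub]
    congr 1
    simp only [h1]
    exact gammaOp_W_sub hdd' p f g i (h i) ⟨_, coord_mem_sobolev p s ξ⟩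
  have hle : commNorm (torusRep hdd' p 𝒞) (diracOp hdd' p f c) a ≤
      (‖∑ i, (lpMap (cliffordOp c i) * amp p.G 𝒞 (Z i) : L2 p.G 𝒞 →L[ℂ] L2 p.G 𝒞)‖₊ : ℝ≥0∞) := by
    rw [commNorm_le_iff, hrep]
    refine ⟨hmem, fun ξ => ?_⟩
    have h2 : diracOp hdd' p f c ⟨amp p.G 𝒞 (p.W g) (ξ : L2 p.G 𝒞), hmem ξ⟩ -
        amp p.G 𝒞 (p.W g) (diracOp hdd' p f c ξ) =
        (∑ i, (lpMap (cliffordOp c i) * amp p.G 𝒞 (Z i) : L2 p.G 𝒞 →L[ℂ] L2 p.G 𝒞)) ξ := by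
      refine (congrArg₂ (· - ·) (diracOp_apply hdd' p f c ⟨_, hmem ξ⟩)
        (congrArg (amp p.G 𝒞 (p.W g)) (diracOp_apply hdd' p f c ξ))).trans ?_
      rw [map_sum, ← Finset.sum_sub_distrib, sum_apply]
      exact Finset.sum_congr rfl fun i _ => hT i ξ
    rw [h2]
    exact ContinuousLinearMap.le_opNorm _ _
  exact hle.trans_lt ENNReal.coe_lt_top

variable {c f} in
-- The dense *-subalgebra is that of all elements with bounded commutator; it contains the
-- generators because they commute with the leading coefficients.
theorem isSpectralTriple_diracOp (hc : IsFaithfulStarRep c) (hno : ∀ j, f j ≠ j)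
    (htop : ∀ i : Fin d, p.k (Fin.castLE hdd' i) = ⊤ →
      ∀ s, Commute (p.U (f (Fin.castLE hdd' i))) (p.U s)) :
    IsSpectralTriple (torusRep hdd' p 𝒞) (diracOp hdd' p f c) := by
  obtain ⟨hD, hres⟩ := isSelfAdjoint_diracOp hdd' p hc hno htop
  refine ⟨dense_sobolev p, hD, hres, lipschitzAlgebra (torusRep hdd' p 𝒞) hD, ?_,
    fun a ha => ha⟩
  have h1 : StarAlgebra.adjoin ℂ (Set.range fun j : Fin d => p.U (Fin.castLE hdd' j)) ≤
      (lipschitzAlgebra (torusRep hdd' p 𝒞) hD).map (subTorus hdd' p).subtype := by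
    refine StarAlgebra.adjoin_le ?_
    rintro _ ⟨j, rfl⟩
    have h2 : p.U (Fin.castLE hdd' j) ∈ subTorus hdd' p :=
      StarSubalgebra.le_topologicalClosure _ (StarAlgebra.subset_adjoin ℂ _ ⟨j, rfl⟩)
    exact ⟨⟨_, h2⟩, commNorm_lt_top hdd' p c (g := Pi.single (Fin.castLE hdd' j) 1) rfl fun i =>
      commute_leadingOp hdd' (fun t ht => (htop t ht _).symm) i, rfl⟩
  intro x
  rw [closure_subtype]
  exact closure_mono h1 x.2

end SpectralTriple

/-! ### Isolating the components of the commutator by the trace on $\mathscr C$. -/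

section Clifford

variable {d d' : ℕ} {𝒞 : Type*} [NormedAddCommGroup 𝒞] [InnerProductSpace ℂ 𝒞] [CompleteSpace 𝒞]
  [FiniteDimensional ℂ 𝒞] {c : CliffordAlgebra (cliffordForm (d + d')) →ₐ[ℂ] (𝒞 →L[ℂ] 𝒞)}

lemma IsFaithfulStarRep.nontrivial (hc : IsFaithfulStarRep c) : Nontrivial 𝒞 := by
  have : Invertible (2 : ℂ) := invertibleOfNonzero two_ne_zero
  by_contra h
  rw [not_nontrivial_iff_subsingleton] at h
  have h1 : (1 : CliffordAlgebra (cliffordForm (d + d'))) = 0 :=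
    hc.injective (ContinuousLinearMap.ext fun v => Subsingleton.elim _ _)
  exact one_ne_zero h1

/-- For distinct indices, $\operatorname{tr}(\gamma_i\gamma_s)$ is its own opposite, by
anticommutation and by invariance of the trace under exchange of factors. -/
lemma sum_inner_cliffordOp (hc : IsFaithfulStarRep c) (i s : Fin d ⊕ Fin d') :
    ∑ v, inner ℂ (cliffordOp c i (stdOrthonormalBasis ℂ 𝒞 v))
      (cliffordOp c s (stdOrthonormalBasis ℂ 𝒞 v)) =
      if i = s then (Module.finrank ℂ 𝒞 : ℂ) else 0 := by
  split_ifs with h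
  · subst h
    simp [inner_self_eq_norm_sq_to_K, norm_cliffordOp_apply hc]
  · have h1 : ∀ v, inner ℂ (cliffordOp c i (stdOrthonormalBasis ℂ 𝒞 v))
        (cliffordOp c s (stdOrthonormalBasis ℂ 𝒞 v)) = -inner ℂ (stdOrthonormalBasis ℂ 𝒞 v)
          ((cliffordOp c i * cliffordOp c s : 𝒞 →L[ℂ] 𝒞).toLinearMap
            (stdOrthonormalBasis ℂ 𝒞 v)) := fun v => by
      rw [← ContinuousLinearMap.adjoint_inner_right, ← ContinuousLinearMap.star_eq_adjoint,
        star_cliffordOp hc, neg_apply, inner_neg_right]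
      rfl
    simp only [h1]
    rw [Finset.sum_neg_distrib, ← LinearMap.trace_eq_sum_inner]
    have h2 : (cliffordOp c i * cliffordOp c s : 𝒞 →L[ℂ] 𝒞).toLinearMap +
        (cliffordOp c s * cliffordOp c i : 𝒞 →L[ℂ] 𝒞).toLinearMap = 0 :=
      congrArg ContinuousLinearMap.toLinearMap (cliffordOp_anticomm (c := c) h)
    have h3 := congrArg (LinearMap.trace ℂ 𝒞) h2
    have h4 : LinearMap.trace ℂ 𝒞 (cliffordOp c s * cliffordOp c i : 𝒞 →L[ℂ] 𝒞).toLinearMap =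
        LinearMap.trace ℂ 𝒞 (cliffordOp c i * cliffordOp c s : 𝒞 →L[ℂ] 𝒞).toLinearMap :=
      LinearMap.trace_mul_comm ℂ (cliffordOp c s).toLinearMap (cliffordOp c i).toLinearMap
    rw [map_add, h4, map_zero] at h3
    rw [add_self_eq_zero.1 h3, neg_zero]

lemma norm_tensorVec {G : Type*} (v : 𝒞) (η : L2 G ℂ) : ‖tensorVec v η‖ ≤ ‖v‖ * ‖η‖ := by
  refine (ContinuousLinearMap.le_opNorm _ _).trans ?_
  refine mul_le_mul_of_nonneg_right ?_ (norm_nonneg _)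
  exact (norm_lpMap_le _).trans (by rw [ContinuousLinearMap.norm_toSpanSingleton])

/-- The coefficients of the generators of a Clifford algebra are bounded by the norm of their
combination. -/
lemma norm_le_of_norm_sum_tensorVec_le (hc : IsFaithfulStarRep c) {G : Type*}
    {δ : Fin d ⊕ Fin d' → L2 G ℂ} {C : ℝ}
    (h : ∀ v : 𝒞, ‖v‖ = 1 → ‖∑ s, tensorVec (cliffordOp c s v) (δ s)‖ ≤ C)
    (i : Fin d ⊕ Fin d') : ‖δ i‖ ≤ C := by
  have := hc.nontrivial
  set b := stdOrthonormalBasis ℂ 𝒞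
  -- Pairing with $\gamma_ib_v$ and summing over an orthonormal basis leaves the dimension times the
  -- $i$-th component; each of the pairings is a contraction.
  have h1 : ∑ v, (lpMap (innerSL ℂ (cliffordOp c i (b v))) : L2 G 𝒞 →L[ℂ] L2 G ℂ)
      (∑ s, tensorVec (cliffordOp c s (b v)) (δ s)) = (Module.finrank ℂ 𝒞 : ℂ) • δ i := by
    have h2 : ∀ v s, (lpMap (innerSL ℂ (cliffordOp c i (b v))) : L2 G 𝒞 →L[ℂ] L2 G ℂ)
        (tensorVec (cliffordOp c s (b v)) (δ s)) =
        inner ℂ (cliffordOp c i (b v)) (cliffordOp c s (b v)) • δ s := fun v s => by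
      ext m
      simp [tensorVec, mul_comm]
    simp only [map_sum, h2]
    rw [Finset.sum_comm]
    simp only [← Finset.sum_smul, b, sum_inner_cliffordOp hc, ite_smul, zero_smul,
      Finset.sum_ite_eq, Finset.mem_univ, if_true]
  have h3 : (0 : ℝ) < Module.finrank ℂ 𝒞 := by exact_mod_cast Module.finrank_pos
  have h4 : (Module.finrank ℂ 𝒞 : ℝ) * ‖δ i‖ ≤ (Module.finrank ℂ 𝒞 : ℝ) * C := by
    have h5 := congrArg norm h1
    rw [norm_smul, Complex.norm_natCast] at h5
    rw [← h5]
    refine (norm_sum_le _ _).trans ((Finset.sum_le_card_nsmul _ _ C fun v _ => ?_).trans_eq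
      (by rw [Finset.card_univ, Fintype.card_fin, nsmul_eq_mul]))
    have hb : ‖b v‖ = 1 := b.orthonormal.1 v
    refine (ContinuousLinearMap.le_opNorm _ _).trans ((mul_le_of_le_one_left (norm_nonneg _)
      ((norm_lpMap_le _).trans ?_)).trans (h _ hb))
    rw [innerSL_apply_norm, norm_cliffordOp_apply hc, hb]
  exact le_of_mul_le_mul_left h4 h3

variable (hdd' : d ≤ d') (p : Xi d') (f : Equiv.Perm (Fin d'))

variable (c) in
lemma diracOp_tensorVec (v : 𝒞) (η : p.sobolev ℂ) :
    diracOp hdd' p f c ⟨tensorVec v (η : p.Hilb), tensorVec_mem_sobolev p v η.2⟩ =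
      ∑ s, tensorVec (cliffordOp c s v) (gammaOp hdd' p f s η) :=
  (diracOp_apply hdd' p f c ⟨_, tensorVec_mem_sobolev p v η.2⟩).trans
    (Finset.sum_congr rfl fun _ _ => tensorOp_tensorVec p _ _ v η)

variable {hdd' p f} in
lemma amp_mem_sobolev_and_norm_diracOp_sub_le {a : subTorus hdd' p} {C : NNReal}
    (h : commNorm (torusRep hdd' p 𝒞) (diracOp hdd' p f c) a ≤ C) (ξ : p.sobolev 𝒞) :
    amp p.G 𝒞 a (ξ : L2 p.G 𝒞) ∈ p.sobolev 𝒞 ∧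
      ∀ ζ : p.sobolev 𝒞, (ζ : L2 p.G 𝒞) = amp p.G 𝒞 a (ξ : L2 p.G 𝒞) →
        ‖diracOp hdd' p f c ζ - amp p.G 𝒞 a (diracOp hdd' p f c ξ)‖ ≤ C * ‖(ξ : L2 p.G 𝒞)‖ := by
  obtain ⟨hdom, hbd⟩ := commNorm_le_iff.1 h
  refine ⟨hdom ξ, fun ζ hζ => ?_⟩
  obtain ⟨ζ, hζ'⟩ := ζ
  obtain rfl : ζ = _ := hζ
  exact hbd ξ

variable {hdd' p f} in
/-- A bound on the commutator with the Dirac operator yields bounds on the commutators with all its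
components. -/
lemma mem_sobolev_and_norm_gammaOp_sub_le (hc : IsFaithfulStarRep c) {a : subTorus hdd' p}
    {C : NNReal} (h : commNorm (torusRep hdd' p 𝒞) (diracOp hdd' p f c) a ≤ C)
    (η : p.sobolev ℂ) :
    (a : p.Hilb →L[ℂ] p.Hilb) (η : p.Hilb) ∈ p.sobolev ℂ ∧
      ∀ ζ : p.sobolev ℂ, (ζ : p.Hilb) = (a : p.Hilb →L[ℂ] p.Hilb) (η : p.Hilb) →
        ∀ i, ‖gammaOp hdd' p f i ζ - (a : p.Hilb →L[ℂ] p.Hilb) (gammaOp hdd' p f i η)‖ ≤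
          C * ‖(η : p.Hilb)‖ := by
  have hnt := hc.nontrivial
  constructor
  -- Any basis vector would do: tensoring with it and reading the same coordinate recovers $a\eta$.
  · let i : Fin (Module.finrank ℂ 𝒞) := ⟨0, Module.finrank_pos⟩
    have h1 := (amp_mem_sobolev_and_norm_diracOp_sub_le h
      ⟨_, tensorVec_mem_sobolev p (stdOrthonormalBasis ℂ 𝒞 i) η.2⟩).1
    have h2 := coord_mem_sobolev p i ⟨_, h1⟩
    rwa [coord_amp, coord_tensorVec, if_pos rfl] at h2
  · intro ζ hζ
    refine norm_le_of_norm_sum_tensorVec_le hc fun v hv => ?_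
    have h1 := (amp_mem_sobolev_and_norm_diracOp_sub_le h ⟨_, tensorVec_mem_sobolev p v η.2⟩).2
      ⟨_, tensorVec_mem_sobolev p v ζ.2⟩ ((congrArg (tensorVec v) hζ).trans (amp_tensorVec _ _ _).symm)
    have h2 := (congrArg₂ (fun x y => ‖x - amp p.G 𝒞 (a : p.Hilb →L[ℂ] p.Hilb) y‖)
      (diracOp_tensorVec c hdd' p f v ζ) (diracOp_tensorVec c hdd' p f v η)).symm.trans_le h1
    simp only [map_sum, amp_tensorVec, ← Finset.sum_sub_distrib, ← map_sub] at h2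
    refine h2.trans (mul_le_mul_of_nonneg_left ?_ C.2)
    exact (norm_tensorVec v _).trans (by rw [hv, one_mul])

end Clifford

/-! ### Fourier coefficients of the elements of the algebra. -/

section Coefficients

variable {d d' : ℕ} {hdd' : d ≤ d'} (p : Xi d')

lemma basisVec_mem_sobolev (n : p.G) : basisVec n ∈ p.sobolev ℂ :=
  @single_mem_sobolev _ p ℂ _ _ (fun _ _ => Classical.propDecidable _) n 1

lemma W_basisVec (g n : p.G) : p.W g (basisVec n) = (p.σ g n : ℂ) • basisVec (g + n) := by
  ext m
  rw [Xi.W_apply, lp.coeFn_smul, Pi.smul_apply, smul_eq_mul]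
  by_cases h : m = g + n
  · rw [h, add_sub_cancel_left, basisVec_apply_self, basisVec_apply_self]
  · rw [basisVec_apply_of_ne h, basisVec_apply_of_ne fun h' => h (by rw [← h', add_sub_cancel]),
      mul_zero, mul_zero]

lemma rightW_basisVec_zero (n : p.G) : p.rightW n (basisVec 0) = basisVec n := by
  ext m
  rw [Xi.rightW_apply]
  by_cases h : m = n
  · rw [h, sub_self, basisVec_apply_self, basisVec_apply_self, p.isCocycle.zero_left,
      Circle.coe_one, one_mul]
  · rw [basisVec_apply_of_ne h, basisVec_apply_of_ne (sub_ne_zero.2 h), mul_zero]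

variable {p} {a : p.Hilb →L[ℂ] p.Hilb}

/-- Elements of the algebra commute with right translations, which carry the basis vector at 0 to
all the others. The column at 0, that is, the family of Fourier coefficients, therefore determines
the operator. -/
lemma apply_basisVec_of_mem_subTorus (ha : a ∈ subTorus hdd' p) (m n : p.G) :
    a (basisVec n) m = (p.σ (m - n) n : ℂ) * a (basisVec 0) (m - n) := by
  have h : Commute (p.rightW n) a :=
    commute_of_mem_subTorus hdd' p (fun i => p.commute_rightW_W n _) ha
  have h1 : a (p.rightW n (basisVec 0)) = p.rightW n (a (basisVec 0)) :=
    congrArg (fun T : p.Hilb →L[ℂ] p.Hilb => T (basisVec 0)) h.eq.symm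
  rw [← rightW_basisVec_zero, h1, Xi.rightW_apply]

/-- For $j$ beyond $d$, the generators do not move the $j$-th coordinate, so the algebra commutes
with the projection onto $\{m_j=0\}$, which fixes the basis vector at 0. -/
lemma apply_basisVec_zero_eq_zero (ha : a ∈ subTorus hdd' p) {g : p.G} {j : Fin d'}
    (hj : d ≤ (j : ℕ)) (hg : g j ≠ 0) : a (basisVec 0) g = 0 := by
  classical
  set w : p.G → ℂ := fun m => if m j = 0 then 1 else 0 with hw
  have hb : ∃ C, ∀ m, ‖w m‖ ≤ C := ⟨1, fun m => by simp only [hw]; split_ifs <;> simp⟩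
  have h : Commute (mulOp w : p.Hilb →L[ℂ] p.Hilb) a := by
    refine commute_of_mem_subTorus hdd' p (fun i => ?_) ha
    ext ξ m
    rw [mul_apply_eq_comp, mul_apply_eq_comp, mulOp_apply hb, Xi.U, Xi.W_apply, Xi.W_apply,
      mulOp_apply hb]
    have hij : j ≠ Fin.castLE hdd' i := fun h => by
      have := i.2
      rw [h, Fin.val_castLE] at hj
      omega
    have h2 : w (m - Pi.single (Fin.castLE hdd' i) 1) = w m := by
      simp only [hw, Pi.sub_apply, Pi.single_eq_of_ne hij, sub_zero]
    rw [h2, smul_eq_mul, smul_eq_mul, mul_left_comm]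
  have h1 : mulOp w (basisVec 0 : p.Hilb) = basisVec 0 := by
    ext m
    rw [mulOp_apply hb]
    by_cases hm : m = 0
    · simp [hw, hm]
    · rw [basisVec_apply_of_ne hm, smul_zero]
  have h2 : mulOp w (a (basisVec 0)) = a (mulOp w (basisVec 0)) :=
    congrArg (fun T : p.Hilb →L[ℂ] p.Hilb => T (basisVec 0)) h.eq
  rw [← h1, ← h2, mulOp_apply hb]
  simp [hw, hg]

lemma W_mem_subTorus {g : p.G} (hg : ∀ j : Fin d', d ≤ (j : ℕ) → g j = 0) :
    p.W g ∈ subTorus hdd' p := by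
  let H : AddSubgroup p.G :=
    { carrier := {g | p.W g ∈ subTorus hdd' p}
      zero_mem' := by
        change p.W 0 ∈ subTorus hdd' p
        rw [p.W_zero]
        exact one_mem _
      add_mem' := fun {m n} hm hn => by
        have h1 : p.W (m + n) = ((p.σ m n : ℂ))⁻¹ • (p.W m * p.W n) := by
          rw [p.W_mul, smul_smul, inv_mul_cancel₀ (Circle.coe_ne_zero _), one_smul]
        change p.W (m + n) ∈ subTorus hdd' p
        rw [h1]
        exact (subTorus hdd' p).smul_mem
          (mul_mem (show p.W m ∈ subTorus hdd' p from hm) (show p.W n ∈ subTorus hdd' p from hn)) _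
      neg_mem' := fun {m} hm => by
        change p.W (-m) ∈ subTorus hdd' p
        rw [← p.star_W]
        exact star_mem (show p.W m ∈ subTorus hdd' p from hm) }
  change g ∈ H
  rw [← p.sum_coordInt_smul_single g]
  refine sum_mem fun j _ => ?_
  by_cases hj : (j : ℕ) < d
  · exact H.zsmul_mem (show p.U j ∈ subTorus hdd' p from
      StarSubalgebra.le_topologicalClosure _ (StarAlgebra.subset_adjoin ℂ _ ⟨⟨j, hj⟩, rfl⟩)) _
  · rw [p.coordInt_eq_zero_iff.2 (hg j (not_lt.1 hj)), zero_smul]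
    exact zero_mem _

end Coefficients

/-! ### The commutation character of the cocycle. -/

section Commutation

variable {d : ℕ} (p : Xi d)

/-- The character `g ↦ σ(e, g) / σ(g, e)`. -/
noncomputable def Xi.commChar (e : p.G) : p.G →+ Additive Circle :=
  AddMonoidHom.mk' (fun g => Additive.ofMul (p.σ e g / p.σ g e)) fun g h => by
    have h1 := p.isCocycle.cocycle e g h
    have h2 := p.isCocycle.cocycle g e h
    have h3 := p.isCocycle.cocycle g h e
    rw [add_comm g e] at h2
    rw [add_comm h e] at h3
    rw [← ofMul_mul]
    refine congrArg Additive.ofMul ?_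
    rw [div_mul_div_comm, div_eq_div_iff_mul_eq_mul]
    -- This common factor makes both sides products of the sides of the three cocycle identities.
    refine mul_right_cancel (b := p.σ (e + g) h * p.σ g (e + h) * p.σ g h) ?_
    calc _ = (p.σ e (g + h) * p.σ g h) * (p.σ g e * p.σ (e + g) h) *
          (p.σ g (e + h) * p.σ h e) := by ac_rfl
      _ = (p.σ e g * p.σ (e + g) h) * (p.σ g (e + h) * p.σ e h) * (p.σ g h * p.σ (g + h) e) := by
          rw [← h1, h2, h3]
      _ = _ := by simp only [mul_assoc, mul_comm, mul_left_comm]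

lemma Xi.commChar_eq_zero_iff {e g : p.G} : p.commChar e g = 0 ↔ p.σ e g = p.σ g e := by
  change p.σ e g / p.σ g e = 1 ↔ _
  exact div_eq_one

lemma Xi.σ_eq_of_mul_eq_smul {e g : p.G} {z : ℂ} (h : p.W e * p.W g = z • (p.W g * p.W e)) :
    (p.σ e g : ℂ) = z * p.σ g e := by
  have h1 := congrArg (fun T : p.Hilb →L[ℂ] p.Hilb => T (basisVec 0) (e + g)) h
  simp only [mul_apply_eq_comp, smul_apply, W_basisVec, lp.coeFn_smul, Pi.smul_apply, add_zero,
    p.isCocycle.zero_right, Circle.coe_one, one_smul, add_comm g e, basisVec_apply_self,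
    smul_eq_mul, mul_one] at h1
  exact h1

/-- The character $g\mapsto\sigma(e,g)/\sigma(g,e)$ is trivial on all generators but the $j$-th,
where it is $\omega$. Its value at $g$ is thus $\omega^{g_j}$ with $0<g_j<k(j)$, which is not 1. -/
lemma Xi.σ_ne_of_isPrimitiveRoot {e g : p.G} {j : Fin d} {ω : ℂ} (hk : p.k j ≠ ⊤)
    (hω : IsPrimitiveRoot ω (p.k j).toNat)
    (hj : p.W e * p.U j = ω • (p.U j * p.W e))
    (hs : ∀ s, s ≠ j → p.W e * p.U s = p.U s * p.W e) (hg : g j ≠ 0) : p.σ e g ≠ p.σ g e := by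
  rw [Ne, ← p.commChar_eq_zero_iff]
  have h1 : p.commChar e g = coordInt g j • p.commChar e (Pi.single j 1) := by
    conv_lhs => rw [← p.sum_coordInt_smul_single g]
    rw [map_sum, Finset.sum_eq_single j]
    · rw [map_zsmul]
    · intro s _ h
      have h2 : p.commChar e (Pi.single s 1) = 0 := by
        rw [p.commChar_eq_zero_iff]
        refine Circle.ext ?_
        have := p.σ_eq_of_mul_eq_smul (e := e) (g := Pi.single s 1) (z := 1)
          (by rw [one_smul]; exact hs s h)
        rwa [one_mul] at this
      rw [map_zsmul, h2, smul_zero]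
    · simp
  obtain ⟨h3, h4⟩ := p.coordInt_mem_Ico hk g
  obtain ⟨n, hn⟩ := Int.eq_ofNat_of_zero_le h3
  have h5 : n ≠ 0 := fun h0 => hg (p.coordInt_eq_zero_iff.1 (by rw [hn, h0]; rfl))
  have h6 : n < (p.k j).toNat := by rw [hn] at h4; exact_mod_cast h4
  rw [h1, hn]
  intro h7
  have h8 : (p.σ e (Pi.single j 1) / p.σ (Pi.single j 1) e) ^ n = 1 := by
    rw [natCast_zsmul] at h7
    exact h7
  have h9 : ((p.σ e (Pi.single j 1) / p.σ (Pi.single j 1) e : Circle) : ℂ) = ω := by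
    rw [Circle.coe_div, p.σ_eq_of_mul_eq_smul hj, mul_div_cancel_right₀ _ (Circle.coe_ne_zero _)]
  have h10 := congrArg (fun z : Circle => (z : ℂ)) h8
  simp only [Circle.coe_pow, h9, Circle.coe_one] at h10
  exact hω.pow_ne_one_of_pos_of_lt h5 h6 h10

end Commutation

/-! ### From the Dirac commutator to bounded derivations and Fourier coefficients. -/

section LipschitzBounds

variable {d d' : ℕ} {hdd' : d ≤ d'} {p : Xi d'} {f : Equiv.Perm (Fin d')}
  {𝒞 : Type*} [NormedAddCommGroup 𝒞] [InnerProductSpace ℂ 𝒞] [CompleteSpace 𝒞]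
  [FiniteDimensional ℂ 𝒞] {c : CliffordAlgebra (cliffordForm (d + d')) →ₐ[ℂ] (𝒞 →L[ℂ] 𝒞)}

/-- The matrix of the commutator of `a` with a derivation is that of a bounded operator, when `a`
has a bounded commutator with the Dirac operator. -/
lemma exists_derivation (hc : IsFaithfulStarRep c)
    (hcom : ∀ (i : Fin d) (s : Fin d'), s ≠ Fin.castLE hdd' i ∨ p.k (Fin.castLE hdd' i) = ⊤ →
      Commute (p.U (f (Fin.castLE hdd' i))) (p.U s)) (i : Fin d) :
    ∃ K : ℝ, 0 ≤ K ∧ ∀ (a : subTorus hdd' p) (C : NNReal),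
      commNorm (torusRep hdd' p 𝒞) (diracOp hdd' p f c) a ≤ C →
      ∃ T' : p.Hilb →L[ℂ] p.Hilb, ‖T'‖ ≤ K * C ∧ ∀ m n, T' (basisVec n) m =
        (p.infCoord (Fin.castLE hdd' i) (m - n) : ℂ) *
          (a : p.Hilb →L[ℂ] p.Hilb) (basisVec n) m := by
  set j := Fin.castLE hdd' i with hj
  by_cases hk : p.k j = ⊤
  swap
  · refine ⟨0, le_rfl, fun a C _ => ⟨0, by simp, fun m n => ?_⟩⟩
    rw [p.infCoord_of_ne_top hk, Int.cast_zero, zero_mul]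
    rfl
  refine ⟨‖opX p f j‖ + ‖opY p f j‖, by positivity, fun a C h => ?_⟩
  set A := (a : p.Hilb →L[ℂ] p.Hilb) with hA
  have hcomm : Commute A (p.U (f j)) :=
    (commute_of_mem_subTorus hdd' p (fun t => hcom i _ (.inr hk)) a.2).symm
  have hX : ∀ η, A (opX p f j η) = opX p f j (A η) := fun η =>
    congrArg (fun T : p.Hilb →L[ℂ] p.Hilb => T η) (commute_opX hcomm).eq
  have hY : ∀ η, A (opY p f j η) = opY p f j (A η) := fun η =>
    congrArg (fun T : p.Hilb →L[ℂ] p.Hilb => T η) (commute_opY hcomm).eq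
  have hmem := fun η : p.sobolev ℂ => (mem_sobolev_and_norm_gammaOp_sub_le hc h η).1
  let δ : p.sobolev ℂ →ₗ[ℂ] p.Hilb :=
    p.partialDeriv j ∘ₗ (A.toLinearMap.restrict (p := p.sobolev ℂ) (q := p.sobolev ℂ)
      fun η hη => hmem ⟨η, hη⟩) - A.toLinearMap ∘ₗ p.partialDeriv j
  have hδ : ∀ η : p.sobolev ℂ, ‖δ η‖ ≤
      ((‖opX p f j‖ + ‖opY p f j‖) * C) * ‖(p.sobolev ℂ).subtype η‖ := by
    intro η
    have hb := (mem_sobolev_and_norm_gammaOp_sub_le hc h η).2 ⟨_, hmem η⟩ rfl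
    have h1 : ‖opX p f j (δ η)‖ ≤ C * ‖(η : p.Hilb)‖ := by
      refine le_of_eq_of_le (congrArg norm ?_) (hb (.inl i))
      rw [gammaOp_apply, gammaOp_apply]
      simp only [leadingOp, boundedOp, direction, Sum.elim_inl]
      rw [if_pos hk, if_pos hk, zero_apply, zero_apply, add_zero, add_zero, hX]
      exact map_sub _ _ _
    have h2 : ‖opY p f j (δ η)‖ ≤ C * ‖(η : p.Hilb)‖ := by
      refine le_of_eq_of_le (congrArg norm ?_) (hb (.inr j))
      rw [gammaOp_apply, gammaOp_apply]
      simp only [leadingOp, boundedOp, direction, Sum.elim_inr, id]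
      rw [if_pos hk, if_pos hk, if_pos (show (j : ℕ) < d from i.2), zero_apply, zero_apply,
        add_zero, add_zero, hY]
      exact map_sub _ _ _
    -- As $X$ and $Y$ commute with $a$, the two components of the commutator are $X\delta$ and
    -- $Y\delta$; the identity $X^2+Y^2=1$ recovers $\delta$.
    have h3 : δ η = opX p f j (opX p f j (δ η)) + opY p f j (opY p f j (δ η)) :=
      (congrArg (fun T : p.Hilb →L[ℂ] p.Hilb => T (δ η)) (opX_sq_add_opY_sq p f j)).symm
    have h4 : ‖δ η‖ ≤ ‖opX p f j‖ * (C * ‖(η : p.Hilb)‖) + ‖opY p f j‖ * (C * ‖(η : p.Hilb)‖) := by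
      conv_lhs => rw [h3]
      exact (norm_add_le _ _).trans (add_le_add
        ((ContinuousLinearMap.le_opNorm _ _).trans (mul_le_mul_of_nonneg_left h1 (norm_nonneg _)))
        ((ContinuousLinearMap.le_opNorm _ _).trans (mul_le_mul_of_nonneg_left h2 (norm_nonneg _))))
    rw [Submodule.subtype_apply]
    linarith
  have hdense : DenseRange (p.sobolev ℂ).subtype := by
    rw [DenseRange, Submodule.coe_subtype, Subtype.range_coe]
    exact dense_sobolev p
  -- The bounded extension of $[\partial_j,a]$ has matrix $i(m_j-n_j)a_{mn}$, whence the factor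
  -- $-i$.
  refine ⟨-Complex.I • δ.extendOfNorm (p.sobolev ℂ).subtype, ?_, fun m n => ?_⟩
  · rw [norm_smul, norm_neg, Complex.norm_I, one_mul]
    exact LinearMap.opNorm_extendOfNorm_le hdense (by positivity) hδ
  · have h1 : δ.extendOfNorm (p.sobolev ℂ).subtype (basisVec n) =
        δ ⟨basisVec n, basisVec_mem_sobolev p n⟩ :=
      LinearMap.extendOfNorm_eq hdense ⟨_, hδ⟩ ⟨basisVec n, basisVec_mem_sobolev p n⟩
    have h2 : p.partialDeriv j ⟨basisVec n, basisVec_mem_sobolev p n⟩ =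
        (Complex.I * (p.infCoord j n : ℂ)) • basisVec n := by
      ext l
      rw [partialDeriv_apply, lp.coeFn_smul, Pi.smul_apply, smul_eq_mul]
      by_cases hl : l = n
      · rw [hl]
      · simp only [basisVec_apply_of_ne hl, mul_zero]
    have h3 : δ ⟨basisVec n, basisVec_mem_sobolev p n⟩ m =
        Complex.I * (p.infCoord j m : ℂ) * A (basisVec n) m -
          Complex.I * (p.infCoord j n : ℂ) * A (basisVec n) m := by
      change (p.partialDeriv j ⟨A (basisVec n), _⟩ - A (p.partialDeriv j _) : p.Hilb) m = _
      rw [lp.coeFn_sub, Pi.sub_apply, partialDeriv_apply, h2, map_smul, lp.coeFn_smul,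
        Pi.smul_apply, smul_eq_mul]
    rw [smul_apply, lp.coeFn_smul, Pi.smul_apply, h1, h3, map_sub, smul_eq_mul]
    push_cast
    linear_combination -((p.infCoord j m : ℂ) - p.infCoord j n) * A (basisVec n) m * Complex.I_mul_I

/-- In a direction of finite order, the commutator of `a` with `U_{f(j)}` is controlled by its
commutator with the Dirac operator. -/
lemma exists_norm_U_commutator_le (hc : IsFaithfulStarRep c) {i : Fin d}
    (hk : p.k (Fin.castLE hdd' i) ≠ ⊤) :
    ∃ K : ℝ, ∀ (a : subTorus hdd' p) (C : NNReal),
      commNorm (torusRep hdd' p 𝒞) (diracOp hdd' p f c) a ≤ C → ∀ η : p.sobolev ℂ,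
        ‖(p.U (f (Fin.castLE hdd' i)) * (a : p.Hilb →L[ℂ] p.Hilb) -
          (a : p.Hilb →L[ℂ] p.Hilb) * p.U (f (Fin.castLE hdd' i))) (η : p.Hilb)‖ ≤
          K * C * ‖(η : p.Hilb)‖ := by
  set j := Fin.castLE hdd' i with hj
  have hN : ((p.k j).toNat : ℂ) ≠ 0 := by
    have h1 := p.coordInt_mem_Ico hk 0
    have : (0 : ℤ) < (p.k j).toNat := h1.1.trans_lt h1.2
    exact_mod_cast this.ne'
  set z : ℂ := ((p.k j).toNat : ℂ) / (2 * Complex.I * Real.pi) with hz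
  have hz0 : z ≠ 0 := div_ne_zero hN
    (mul_ne_zero (mul_ne_zero two_ne_zero Complex.I_ne_zero) (by exact_mod_cast Real.pi_ne_zero))
  refine ⟨2 * ‖z⁻¹‖, fun a C h η => ?_⟩
  set A := (a : p.Hilb →L[ℂ] p.Hilb) with hA
  have hb := (mem_sobolev_and_norm_gammaOp_sub_le hc h η).2
    ⟨_, (mem_sobolev_and_norm_gammaOp_sub_le hc h η).1⟩ rfl
  -- Right multiplications commute with the algebra, so only the left half of $[b,\cdot]$
  -- contributes to the commutator with $a$.
  have hr : ∀ {b : p.Hilb →L[ℂ] p.Hilb}, b ∈ Submodule.span ℂ (Set.range p.W) →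
      p.commutator b * A - A * p.commutator b = b * A - A * b := fun {b} hb => by
    have h1 : Commute (p.rightMul b) A :=
      commute_of_mem_subTorus hdd' p (fun t => p.commute_rightMul_of_mem_span hb _) a.2
    rw [Xi.commutator, sub_mul, mul_sub, h1.eq]
    abel
  have hXs : opX p f j ∈ Submodule.span ℂ (Set.range p.W) := by
    rw [opX, Xi.rePart_U]
    exact add_mem (Submodule.smul_mem _ _ (Submodule.subset_span ⟨_, rfl⟩))
      (Submodule.smul_mem _ _ (Submodule.subset_span ⟨_, rfl⟩))
  have hYs : opY p f j ∈ Submodule.span ℂ (Set.range p.W) := by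
    rw [opY, Xi.imPart_U]
    exact Submodule.smul_mem _ _ (add_mem (Submodule.smul_mem _ _ (Submodule.subset_span ⟨_, rfl⟩))
      (Submodule.smul_mem _ _ (Submodule.subset_span ⟨_, rfl⟩)))
  have h1 : ‖(opY p f j * A - A * opY p f j) (η : p.Hilb)‖ ≤ ‖z⁻¹‖ * (C * ‖(η : p.Hilb)‖) := by
    have h2 := hb (.inl i)
    rw [gammaOp_apply, gammaOp_apply] at h2
    simp only [leadingOp, boundedOp, direction, Sum.elim_inl] at h2
    rw [if_neg hk, if_neg hk, zero_apply, zero_apply, zero_add, zero_add, neg_div] at h2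
    have h3 : (opY p f j * A - A * opY p f j) (η : p.Hilb) = (-z⁻¹) •
        (((-z) • p.commutator (opY p f j)) (A η) - A (((-z) • p.commutator (opY p f j)) η)) := by
      rw [← hr hYs, smul_apply, smul_apply, map_smul, ← smul_sub, smul_smul, neg_mul_neg,
        inv_mul_cancel₀ hz0, one_smul]
      rfl
    rw [h3, norm_smul, norm_neg]
    exact mul_le_mul_of_nonneg_left h2 (norm_nonneg _)
  have h1' : ‖(opX p f j * A - A * opX p f j) (η : p.Hilb)‖ ≤ ‖z⁻¹‖ * (C * ‖(η : p.Hilb)‖) := by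
    have h2 := hb (.inr j)
    rw [gammaOp_apply, gammaOp_apply] at h2
    simp only [leadingOp, boundedOp, direction, Sum.elim_inr, id] at h2
    rw [if_neg hk, if_neg hk, if_pos (show (j : ℕ) < d from i.2), zero_apply, zero_apply, zero_add,
      zero_add] at h2
    have h3 : (opX p f j * A - A * opX p f j) (η : p.Hilb) = z⁻¹ •
        ((z • p.commutator (opX p f j)) (A η) - A ((z • p.commutator (opX p f j)) η)) := by
      rw [← hr hXs, smul_apply, smul_apply, map_smul, ← smul_sub, smul_smul,
        inv_mul_cancel₀ hz0, one_smul]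
      rfl
    rw [h3, norm_smul]
    exact mul_le_mul_of_nonneg_left h2 (norm_nonneg _)
  obtain ⟨ε, hε, hU⟩ : ∃ ε : ℂ, ‖ε‖ = 1 ∧ p.U (f j) = opX p f j + ε • opY p f j := by
    have h2 : p.U (f j) = rePart (p.U (f j)) + Complex.I • imPart (p.U (f j)) := by
      rw [rePart, imPart, smul_smul]
      have : Complex.I * (1 / (2 * Complex.I)) = 1 / 2 := by
        field_simp
      rw [this, ← smul_add, add_add_sub_cancel, ← two_smul ℂ, smul_smul]
      norm_num
    refine ⟨Complex.I * (if j < f j then 1 else -1), by split_ifs <;> simp, ?_⟩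
    rw [opX, opY, smul_smul, mul_assoc]
    have h3 : (if j < f j then (1 : ℂ) else -1) * (if j < f j then (1 : ℂ) else -1) = 1 := by
      split_ifs <;> norm_num
    rw [h3, mul_one]
    exact h2
  have h4 : (p.U (f j) * A - A * p.U (f j)) (η : p.Hilb) =
      (opX p f j * A - A * opX p f j) (η : p.Hilb) +
        ε • (opY p f j * A - A * opY p f j) (η : p.Hilb) := by
    rw [hU, ← smul_apply, ← add_apply]
    congr 1
    rw [add_mul, mul_add, smul_mul_assoc, mul_smul_comm, smul_sub]
    abel
  rw [h4]
  refine (norm_add_le _ _).trans ?_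
  rw [norm_smul, hε, one_mul]
  linarith

/-- The Fourier coefficients of the elements of the Lipschitz algebra, other than the coefficient
at `0`, are controlled by the commutator with the Dirac operator. -/
lemma exists_norm_coeff_le (hc : IsFaithfulStarRep c)
    (hcom : ∀ (i : Fin d) (s : Fin d'), s ≠ Fin.castLE hdd' i ∨ p.k (Fin.castLE hdd' i) = ⊤ →
      Commute (p.U (f (Fin.castLE hdd' i))) (p.U s))
    (hfin : ∀ i : Fin d, p.k (Fin.castLE hdd' i) ≠ ⊤ → ∃ ω : ℂ,
      IsPrimitiveRoot ω (p.k (Fin.castLE hdd' i)).toNat ∧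
      p.U (f (Fin.castLE hdd' i)) * p.U (Fin.castLE hdd' i) =
        ω • (p.U (Fin.castLE hdd' i) * p.U (f (Fin.castLE hdd' i))))
    {g : p.G} (hg : g ≠ 0) :
    ∃ K : ℝ, ∀ (a : subTorus hdd' p) (C : NNReal),
      commNorm (torusRep hdd' p 𝒞) (diracOp hdd' p f c) a ≤ C →
        ‖(a : p.Hilb →L[ℂ] p.Hilb) (basisVec 0) g‖ ≤ K * C := by
  obtain ⟨j, hj⟩ : ∃ j, g j ≠ 0 := Function.ne_iff.1 hg
  by_cases hjd : d ≤ (j : ℕ)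
  · refine ⟨0, fun a C _ => ?_⟩
    rw [apply_basisVec_zero_eq_zero a.2 hjd hj, norm_zero, zero_mul]
  obtain ⟨i, rfl⟩ : ∃ i : Fin d, Fin.castLE hdd' i = j := ⟨⟨j, not_le.1 hjd⟩, rfl⟩
  by_cases hk : p.k (Fin.castLE hdd' i) = ⊤
  · obtain ⟨K, -, hK⟩ := exists_derivation hc hcom i
    have hne : (p.infCoord (Fin.castLE hdd' i) g : ℂ) ≠ 0 := by
      rw [p.infCoord_of_eq_top hk]
      exact_mod_cast mt p.coordInt_eq_zero_iff.1 hj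
    refine ⟨‖(p.infCoord (Fin.castLE hdd' i) g : ℂ)‖⁻¹ * K, fun a C h => ?_⟩
    obtain ⟨T', hT', hm⟩ := hK a C h
    have h1 := (lp.norm_apply_le_norm (by norm_num) (T' (basisVec 0)) g).trans (T'.le_opNorm _)
    rw [hm, sub_zero, norm_basisVec, mul_one, norm_mul] at h1
    rw [mul_assoc, ← div_eq_inv_mul, le_div_iff₀ (norm_pos_iff.2 hne), mul_comm]
    exact h1.trans hT'
  · obtain ⟨K, hK⟩ := exists_norm_U_commutator_le (f := f) hc hk
    obtain ⟨ω, hω, hU⟩ := hfin i hk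
    set e : p.G := Pi.single (f (Fin.castLE hdd' i)) 1 with he
    -- This difference is the factor by which $[U_{f(j)},\cdot]$ multiplies the coefficient at $g$,
    -- read at the position $e+g$.
    have hne : (p.σ e g : ℂ) - p.σ g e ≠ 0 := sub_ne_zero.2 fun h =>
      p.σ_ne_of_isPrimitiveRoot (e := e) hk hω hU (fun s hs => (hcom i s (.inl hs)).eq) hj
        (Circle.ext h)
    refine ⟨‖(p.σ e g : ℂ) - p.σ g e‖⁻¹ * K, fun a C h => ?_⟩
    have h1 := hK a C h ⟨basisVec 0, basisVec_mem_sobolev p 0⟩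
    have h2 := (lp.norm_apply_le_norm (by norm_num) _ (e + g)).trans h1
    have h3 : ((p.U (f (Fin.castLE hdd' i)) * (a : p.Hilb →L[ℂ] p.Hilb) -
        (a : p.Hilb →L[ℂ] p.Hilb) * p.U (f (Fin.castLE hdd' i))) (basisVec 0) : p.Hilb) (e + g) =
        ((p.σ e g : ℂ) - p.σ g e) * (a : p.Hilb →L[ℂ] p.Hilb) (basisVec 0) g := by
      rw [sub_apply, lp.coeFn_sub, Pi.sub_apply, mul_apply_eq_comp, mul_apply_eq_comp, Xi.U,
        Xi.W_apply, W_basisVec, map_smul, lp.coeFn_smul, Pi.smul_apply, p.isCocycle.zero_right,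
        Circle.coe_one, one_smul, add_zero, apply_basisVec_of_mem_subTorus a.2 _ (Pi.single _ _),
        add_sub_cancel_left, sub_mul]
    rw [h3, norm_mul, norm_basisVec, mul_one] at h2
    rwa [mul_assoc, ← div_eq_inv_mul, le_div_iff₀ (norm_pos_iff.2 hne), mul_comm]

end LipschitzBounds

/-! ### Kernel of the seminorm, finite approximation, and conclusion. -/

section Main

variable {d d' : ℕ} {hdd' : d ≤ d'} {p : Xi d'} {f : Equiv.Perm (Fin d')}
  {𝒞 : Type*} [NormedAddCommGroup 𝒞] [InnerProductSpace ℂ 𝒞] [CompleteSpace 𝒞]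
  [FiniteDimensional ℂ 𝒞] {c : CliffordAlgebra (cliffordForm (d + d')) →ₐ[ℂ] (𝒞 →L[ℂ] 𝒞)}

lemma sum_smul_W_apply_basisVec {a : p.Hilb →L[ℂ] p.Hilb} (ha : a ∈ subTorus hdd' p)
    (B : Finset p.G) (m n : p.G) :
    (∑ g ∈ B, a (basisVec 0) g • p.W g) (basisVec n) m =
      if m - n ∈ B then a (basisVec n) m else 0 := by
  classical
  have h1 : ∀ g ∈ B, (a (basisVec 0) g • p.W g) (basisVec n) m =
      if m - n = g then a (basisVec n) m else 0 := fun g _ => by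
    rw [smul_apply, W_basisVec, lp.coeFn_smul, Pi.smul_apply, lp.coeFn_smul, Pi.smul_apply]
    split_ifs with h
    · subst h
      rw [sub_add_cancel, basisVec_apply_self, apply_basisVec_of_mem_subTorus ha m n, smul_eq_mul,
        smul_eq_mul, mul_one, mul_comm]
    · rw [basisVec_apply_of_ne fun h' => h (by rw [h', add_sub_cancel_right]), smul_zero,
        smul_zero]
  rw [sum_apply, lp.coeFn_sum, Finset.sum_apply, Finset.sum_congr rfl h1, Finset.sum_ite_eq]

/-- All coefficients away from 0 vanish, which leaves a scalar; it is real because the element is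
self-adjoint. -/
lemma eq_smul_one_of_diracSeminorm_eq_zero
    (hcoeff : ∀ g : p.G, g ≠ 0 → ∃ K : ℝ, ∀ (a : subTorus hdd' p) (C : NNReal),
      commNorm (torusRep hdd' p 𝒞) (diracOp hdd' p f c) a ≤ C →
        ‖(a : p.Hilb →L[ℂ] p.Hilb) (basisVec 0) g‖ ≤ K * C)
    {a : selfAdjoint (subTorus hdd' p)}
    (h : diracSeminorm (torusRep hdd' p 𝒞) (diracOp hdd' p f c) a = 0) :
    ∃ r : ℝ, (a : subTorus hdd' p) = r • (1 : subTorus hdd' p) := by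
  set A : p.Hilb →L[ℂ] p.Hilb := ((a : subTorus hdd' p) : p.Hilb →L[ℂ] p.Hilb) with hA
  have h1 : ∀ g : p.G, g ≠ 0 → A (basisVec 0) g = 0 := fun g hg => by
    obtain ⟨K, hK⟩ := hcoeff g hg
    have h2 := hK a 0 (le_of_eq h)
    rw [NNReal.coe_zero, mul_zero] at h2
    exact norm_le_zero_iff.1 h2
  set z : ℂ := A (basisVec 0) 0 with hz
  have h2 : A = z • 1 := by
    refine ext_basisVec fun m n => ?_
    change _ = z • basisVec n m
    rw [apply_basisVec_of_mem_subTorus (a : subTorus hdd' p).2]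
    by_cases hmn : m = n
    · rw [hmn, sub_self, p.isCocycle.zero_left, Circle.coe_one, one_mul, basisVec_apply_self,
        smul_eq_mul, mul_one]
    · rw [basisVec_apply_of_ne hmn, smul_zero]
      exact mul_eq_zero_of_right _ (h1 _ (sub_ne_zero.2 hmn))
  have h3 : star A = A := congrArg Subtype.val a.2.star_eq
  have h4 : conj z = z := by
    rw [h2, star_smul, star_one] at h3
    have h5 := congrArg (fun T : p.Hilb →L[ℂ] p.Hilb => T (basisVec 0) 0) h3
    simpa [basisVec_apply_self] using h5
  refine ⟨z.re, Subtype.ext ?_⟩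
  change A = z.re • (1 : p.Hilb →L[ℂ] p.Hilb)
  rw [h2]
  ext ξ m
  change z * ξ m = z.re • ξ m
  rw [Complex.real_smul, Complex.conj_eq_iff_re.1 h4]

lemma finite_setOf_infCoord_mem (F : Fin d → Finset ℤ) :
    {g : p.G | (∀ i, p.infCoord (Fin.castLE hdd' i) g ∈ F i) ∧
      ∀ j : Fin d', d ≤ (j : ℕ) → g j = 0}.Finite := by
  refine (p.finite_setOf_coordInt_le fun j => if h : (j : ℕ) < d then
    ∑ q ∈ F ⟨j, h⟩, q.natAbs else 0).subset fun g hg j => ?_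
  split_ifs with h
  · have h1 := hg.1 ⟨j, h⟩
    have h2 : (p.infCoord j g).natAbs ≤ ∑ q ∈ F ⟨j, h⟩, q.natAbs :=
      Finset.single_le_sum (f := Int.natAbs) (fun _ _ => Nat.zero_le _) h1
    rw [Int.abs_eq_natAbs]
    exact_mod_cast h2
  · by_cases hk : p.k j = ⊤
    · rw [p.infCoord_of_eq_top hk, p.coordInt_eq_zero_iff.2 (hg.2 j (not_lt.1 h))]
      simp
    · rw [p.infCoord_of_ne_top hk]
      simp

/-- The elements of the unit ball of the Lipschitz seminorm are uniformly approximated by finite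
partial sums of their Fourier series. -/
lemma exists_norm_sub_sum_le
    (hder : ∀ i : Fin d, ∃ K : ℝ, 0 ≤ K ∧ ∀ (a : subTorus hdd' p) (C : NNReal),
      commNorm (torusRep hdd' p 𝒞) (diracOp hdd' p f c) a ≤ C →
      ∃ T' : p.Hilb →L[ℂ] p.Hilb, ‖T'‖ ≤ K * C ∧ ∀ m n, T' (basisVec n) m =
        (p.infCoord (Fin.castLE hdd' i) (m - n) : ℂ) *
          (a : p.Hilb →L[ℂ] p.Hilb) (basisVec n) m) {ε : ℝ} (hε : 0 < ε) :
    ∃ B : Finset p.G, (∀ g ∈ B, ∀ j : Fin d', d ≤ (j : ℕ) → g j = 0) ∧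
      ∀ a : subTorus hdd' p, commNorm (torusRep hdd' p 𝒞) (diracOp hdd' p f c) a ≤ 1 →
        ‖(a : p.Hilb →L[ℂ] p.Hilb) -
          ∑ g ∈ B, (a : p.Hilb →L[ℂ] p.Hilb) (basisVec 0) g • p.W g‖ ≤ ε := by
  classical
  choose K hK0 hK using hder
  -- A common positive bound for all the constants: division by it makes every derivation of norm at
  -- most 1, as the truncation theorem requires.
  set R : ℝ := 1 + ∑ i, K i with hR
  have hR0 : 0 < R := by
    have : 0 ≤ ∑ i, K i := Finset.sum_nonneg fun i _ => hK0 i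
    linarith
  have hKR : ∀ i, K i ≤ R := fun i => by
    have := Finset.single_le_sum (f := K) (fun i _ => hK0 i) (Finset.mem_univ i)
    linarith
  obtain ⟨F, -, -, -, hF⟩ := exists_uniform_truncation
    (fun i : Fin d => p.infCoord (Fin.castLE hdd' i)) Finset.univ (div_pos hε hR0)
  set B : Finset p.G := (finite_setOf_infCoord_mem (hdd' := hdd') (p := p) F).toFinset with hB
  have hmemB : ∀ g, g ∈ B ↔ (∀ i, p.infCoord (Fin.castLE hdd' i) g ∈ F i) ∧
      ∀ j : Fin d', d ≤ (j : ℕ) → g j = 0 := fun g => Set.Finite.mem_toFinset _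
  refine ⟨B, fun g hg => ((hmemB g).1 hg).2, fun a ha => ?_⟩
  set A : p.Hilb →L[ℂ] p.Hilb := (a : p.Hilb →L[ℂ] p.Hilb) with hA
  obtain ⟨S, hS, hSm⟩ := hF ((R⁻¹ : ℂ) • A) fun i => by
    obtain ⟨T', hT', hm⟩ := hK i a 1 (by rwa [ENNReal.coe_one])
    refine ⟨(R⁻¹ : ℂ) • T', ?_, fun m n => ?_⟩
    · rw [norm_smul, norm_inv, Complex.norm_real, Real.norm_of_nonneg hR0.le,
        inv_mul_le_iff₀ hR0, mul_one]
      rw [NNReal.coe_one, mul_one] at hT'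
      exact hT'.trans (hKR i)
    · rw [smul_apply, smul_apply, lp.coeFn_smul, Pi.smul_apply, lp.coeFn_smul, Pi.smul_apply, hm,
        smul_eq_mul, smul_eq_mul, mul_left_comm]
  have hRC : (R : ℂ) ≠ 0 := by exact_mod_cast hR0.ne'
  have hS2 : (R : ℂ) • S = ∑ g ∈ B, A (basisVec 0) g • p.W g := by
    refine ext_basisVec fun m n => ?_
    rw [sum_smul_W_apply_basisVec a.2, smul_apply, lp.coeFn_smul,
      Pi.smul_apply, hSm, smul_apply, lp.coeFn_smul, Pi.smul_apply, smul_eq_mul, smul_eq_mul,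
      mul_left_comm, mul_inv_cancel_left₀ hRC]
    simp only [indicatorVec_apply, Finset.prod_ite_zero, Finset.prod_const_one, ite_mul, one_mul,
      zero_mul, Finset.mem_univ, true_imp_iff]
    -- The truncation only constrains the first $d$ coordinates; when a later coordinate of $m-n$ is
    -- nonzero, the matrix entry is already 0.
    by_cases h : ∀ j : Fin d', d ≤ (j : ℕ) → (m - n) j = 0
    · refine if_congr ?_ rfl rfl
      rw [hmemB]
      exact ⟨fun h' => ⟨h', h⟩, fun h' => h'.1⟩
    · rw [if_neg (show m - n ∉ B from fun h' => h ((hmemB _).1 h').2)]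
      push Not at h
      obtain ⟨j, hj, hj'⟩ := h
      have h0 : A (basisVec n) m = 0 := by
        rw [apply_basisVec_of_mem_subTorus a.2 m n, apply_basisVec_zero_eq_zero a.2 hj hj',
          mul_zero]
      rw [h0, ite_self]
  have h1 : A - (R : ℂ) • S = (R : ℂ) • ((R⁻¹ : ℂ) • A - S) := by
    rw [smul_sub, smul_smul, mul_inv_cancel₀ hRC, one_smul]
  rw [← hS2, h1, norm_smul, Complex.norm_real, Real.norm_of_nonneg hR0.le, mul_comm,
    ← le_div_iff₀ hR0]
  exact hS

lemma hasFiniteApproximation_diracSeminorm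
    (hsum : ∀ ε > (0 : ℝ), ∃ B : Finset p.G, (∀ g ∈ B, ∀ j : Fin d', d ≤ (j : ℕ) → g j = 0) ∧
      ∀ a : subTorus hdd' p, commNorm (torusRep hdd' p 𝒞) (diracOp hdd' p f c) a ≤ 1 →
        ‖(a : p.Hilb →L[ℂ] p.Hilb) -
          ∑ g ∈ B, (a : p.Hilb →L[ℂ] p.Hilb) (basisVec 0) g • p.W g‖ ≤ ε)
    (hcoeff : ∀ g : p.G, g ≠ 0 → ∃ K : ℝ, ∀ (a : subTorus hdd' p) (C : NNReal),
      commNorm (torusRep hdd' p 𝒞) (diracOp hdd' p f c) a ≤ C →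
        ‖(a : p.Hilb →L[ℂ] p.Hilb) (basisVec 0) g‖ ≤ K * C) :
    HasFiniteApproximation (diracSeminorm (torusRep hdd' p 𝒞) (diracOp hdd' p f c)) := by
  classical
  intro ε hε
  have hcoeff' : ∀ g : p.G, ∃ K : ℝ, ∀ (a : subTorus hdd' p),
      commNorm (torusRep hdd' p 𝒞) (diracOp hdd' p f c) a ≤ 1 →
        ‖if g = 0 then 0 else (a : p.Hilb →L[ℂ] p.Hilb) (basisVec 0) g‖ ≤ K := by
    intro g
    by_cases hg : g = 0
    · exact ⟨0, fun a _ => by rw [if_pos hg, norm_zero]⟩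
    · obtain ⟨K, hK⟩ := hcoeff g hg
      refine ⟨K, fun a ha => ?_⟩
      have := hK a 1 (by rwa [ENNReal.coe_one])
      rw [NNReal.coe_one, mul_one] at this
      rwa [if_neg hg]
  choose M hM using hcoeff'
  obtain ⟨B, hB, hBa⟩ := hsum ε hε
  refine ⟨B, inferInstance, fun g => ⟨p.W g, W_mem_subTorus (hB g g.2)⟩, fun g => M g,
    fun a ha => ?_⟩
  set A : p.Hilb →L[ℂ] p.Hilb := ((a : subTorus hdd' p) : p.Hilb →L[ℂ] p.Hilb) with hA
  -- The coefficient at 0, which the seminorm does not control, is absorbed in the free scalar; the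
  -- others are bounded uniformly on the unit ball.
  refine ⟨∑ g ∈ B, if g = 0 then A (basisVec 0) 0 else 0,
    fun g => if (g : p.G) = 0 then 0 else A (basisVec 0) g, fun g => hM g a ha,
    le_of_eq_of_le ?_ (hBa a ha)⟩
  have hsum : (∑ g ∈ B, if g = 0 then A (basisVec 0) 0 else 0) • (1 : p.Hilb →L[ℂ] p.Hilb) +
      ∑ g : B, (if (g : p.G) = 0 then 0 else A (basisVec 0) g) • p.W g =
      ∑ g ∈ B, A (basisVec 0) g • p.W g := by
    rw [Finset.sum_coe_sort B fun g => (if g = 0 then 0 else A (basisVec 0) g) • p.W g,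
      Finset.sum_smul, ← Finset.sum_add_distrib]
    refine Finset.sum_congr rfl fun g _ => ?_
    split_ifs with h
    · rw [h, p.W_zero, zero_smul, add_zero]
    · rw [zero_smul, zero_add]
  rw [← hsum]
  change ‖(subTorus hdd' p).subtype _‖ = _
  simp only [map_sub, map_add, map_smul, map_one, map_sum]
  rfl

/-- Only a single parameter is involved, and of the commutation relations only a primitive root of
unity is needed in each direction of finite order, whatever its sign convention. -/
theorem isQuantumCompactMetricSpace_and_isMetricSpectralTriple_diracOp
    (hc : IsFaithfulStarRep c) (hno : ∀ j, f j ≠ j)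
    (hcom : ∀ (i : Fin d) (s : Fin d'), s ≠ Fin.castLE hdd' i ∨ p.k (Fin.castLE hdd' i) = ⊤ →
      Commute (p.U (f (Fin.castLE hdd' i))) (p.U s))
    (hfin : ∀ i : Fin d, p.k (Fin.castLE hdd' i) ≠ ⊤ → ∃ ω : ℂ,
      IsPrimitiveRoot ω (p.k (Fin.castLE hdd' i)).toNat ∧
      p.U (f (Fin.castLE hdd' i)) * p.U (Fin.castLE hdd' i) =
        ω • (p.U (Fin.castLE hdd' i) * p.U (f (Fin.castLE hdd' i)))) :
    IsQuantumCompactMetricSpace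
        (diracSeminorm (torusRep hdd' p 𝒞) (diracOp hdd' p f c)) ∧
      IsMetricSpectralTriple (torusRep hdd' p 𝒞) (diracOp hdd' p f c) := by
  have hST : IsSpectralTriple (torusRep hdd' p 𝒞) (diracOp hdd' p f c) :=
    isSpectralTriple_diracOp hdd' p hc hno fun i hi s => hcom i s (.inr hi)
  have hcoeff := fun (g : p.G) (hg : g ≠ 0) => exists_norm_coeff_le hc hcom hfin hg
  have hQ := isQuantumCompactMetricSpace_of_isSpectralTriple hST
    (fun a => eq_smul_one_of_diracSeminorm_eq_zero hcoeff)
    (hasFiniteApproximation_diracSeminorm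
      (fun _ hε => exists_norm_sub_sum_le (exists_derivation hc hcom) hε) hcoeff)
  exact ⟨hQ, hST, hQ⟩

end Main

end QuantumTori

theorem mainTheorem5 {d d' : ℕ} (hd : 2 ≤ d) (hdd' : d ≤ d')
    (p : ℕ∞ → Xi d) (hp : IsApproximation p)
    (f : Equiv.Perm (Fin d')) (p' : ℕ∞ → Xi d') (hp' : IsInnerification hdd' p f p')
    {𝒞 : Type*} [NormedAddCommGroup 𝒞] [InnerProductSpace ℂ 𝒞] [CompleteSpace 𝒞]
    [FiniteDimensional ℂ 𝒞]
    (c : CliffordAlgebra (cliffordForm (d + d')) →ₐ[ℂ] (𝒞 →L[ℂ] 𝒞)) (hc : IsFaithfulStarRep c)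
    (n : ℕ∞) :
    IsQuantumCompactMetricSpace
        (diracSeminorm (torusRep hdd' (p' n) 𝒞) (diracOp hdd' (p' n) f c)) ∧
      IsMetricSpectralTriple (torusRep hdd' (p' n) 𝒞) (diracOp hdd' (p' n) f c) := by
  have hk := fun i => (hp'.k_eq n i).2
  refine isQuantumCompactMetricSpace_and_isMetricSpectralTriple_diracOp hc hp'.no_fixed_point
    (fun i s h => (hp'.commutation n i s).2.2 (by rwa [← hk i])) fun i hi => ?_
  obtain ⟨h1, h2, -⟩ := hp'.commutation n i (Fin.castLE hdd' i)
  have hN : (((p' n).k (Fin.castLE hdd' i)).toNat) ≠ 0 := by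
    have h3 := (p' n).coordInt_mem_Ico hi 0
    have : (0 : ℤ) < ((p' n).k (Fin.castLE hdd' i)).toNat := h3.1.trans_lt h3.2
    exact_mod_cast this.ne'
  have hω := Complex.isPrimitiveRoot_exp _ hN
  have e1 : 2 * (Real.pi : ℂ) * Complex.I / ((p' n).k (Fin.castLE hdd' i)).toNat =
      2 * Complex.I * Real.pi / ((p' n).k (Fin.castLE hdd' i)).toNat := by ring
  rw [e1] at hω
  rw [← hk i] at h1 h2
  -- According to the order of $j$ and $f(j)$, the root is $e^{2i\pi/k(j)}$ or its inverse; both are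
  -- primitive.
  rcases lt_or_gt_of_ne (hp'.no_fixed_point (Fin.castLE hdd' i)) with h | h
  · refine ⟨_, hω.inv, ?_⟩
    rw [← Complex.exp_neg, ← neg_div]
    exact h2 rfl hi h
  · exact ⟨_, hω, h1 rfl hi h⟩
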